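/- **Syntax and semantics.** Let $V_{\mathbb R}$ be the set of real variables (unprimed variables $x$, together with a differential variable $x'$ for each of them), let $V_{\mathcal T}$ be the set of trace variables, and let channel names be the natural numbers. A *trace* is a finite sequence of events (channel, value, time) in $\mathbb N\times\mathbb R\times\mathbb R$, and a *state* maps real variables to reals and trace variables to traces. *Polynomials* $p$ are built from real variables, rational constants, $+$, $\cdot$ and differential terms $(p)'$, where $(p)'$ has the value $\sum_x x'\,\partial p/\partial x$. *Real terms* $\theta$ are built from the same ingredients and the channel, value and time of the last event of a trace term ($0$ for the empty trace) and its length. *Trace terms* are trace variables, the empty trace $\epsilon$, single events $\langle \mathrm{ch},p_1,p_2\rangle$, concatenations, projections $te\downarrow C$ onto finite or cofinite channel sets $C$, and accesses $te[\theta]$ to the $\lfloor\theta\rfloor$-th event (counted from $0$; $\epsilon$ if out of bounds). *First-order real arithmetic* consists of the first-order formulas, with atoms $=$ and $\ge$, over polynomials. $\mathrm{Chan}$*-FOD formulas* are built from the atoms $\theta_1=\theta_2$, $\theta_1\ge\theta_2$, $te_1=te_2$, $te_1\preceq te_2$ (prefix), and the differential equation properties $[x'=p]\chi$ and $\langle x'=p\rangle\chi$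 ($\chi$ holds after every, respectively some, evolution along the system $x'=p$; $\chi$ is a formula of first-order real arithmetic), by $\neg$, $\wedge$ and quantification over real and trace variables. *FOD formulas* are the $\mathrm{Chan}$-FOD formulas without trace terms, operators on traces, and trace variables. A formula is *valid*, $\vDash\phi$, if it holds in all states. **Encoding.** A real $Z$ is an *$\mathbb R$-Gödel encoding* of a trace $\tau$ if it encodes, by distributing binary digits, an infinite sequence of reals whose $k$-th member, for each $k<|\tau|$, encodes by interleaving binary digits the triple (channel, value, time) of the $k$-th event of $\tau$; the other members are arbitrary. (Signs are encoded by an extra digit.) For each $\mathrm{Chan}$-FOD formula $\phi$ and each trace variable $h$ fix real variables $h^\dagger, h^\ddagger$, pairwise distinct and not occurring in $\phi$. A variable is *free* in $\phi$ if the truth of $\phi$ can change when only its value changes. A state $w$ is an *FOD-dual state* of $v$ with respect to $\phi$ if $w=v$ except that, for each free trace variable $h$ of $\phi$, $w(h^\ddagger)=|v(h)|$ and $w(h^\dagger)$ is an $\mathbb R$-Gödel encoding of $v(h)$. **Proposition (Equiexpressiveness of $\mathrm{Chan}$-FOD and FOD).** There is an effective (computable) translation that maps every $\mathrm{Chan}$-FOD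 formula $\phi$ to an FOD formula $\phi^\#$ such that the following holds for every $\phi$. 1. Every state $v$ has an FOD-dual state with respect to $\phi$, and for every state $v$ and every FOD-dual state $w$ of $v$ with respect to $\phi$, $$ v\vDash\phi \quad\text{iff}\quad w\vDash\phi^\#. $$ 2. In particular, $\vDash\phi$ iff $\vDash\phi^\#$. -/

import Mathlib

namespace ChanFOD

/-! ## Variables, traces and states -/

/-- Real variables: the unprimed variables `x` and, for each of them, the differential
variable `x'`. -/
inductive RVar where
  | base (n : ℕ)
  | prime (n : ℕ)
deriving DecidableEq

/-- The name of a real variable; `x` and `x'` share it. -/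
def RVar.index : RVar → ℕ
  | .base n => n
  | .prime n => n

/-- Trace variables. -/
abbrev TVar := ℕ

/-- Channel names. -/
abbrev Chan := ℕ

/-- A communication event: channel, value, time. -/
abbrev Event := Chan × ℝ × ℝ

/-- A communication trace is a finite sequence of events. -/
abbrev Trace := List Event

/-- A state gives a real to every real variable and a trace to every trace variable. -/
@[ext] structure State where
  real : RVar → ℝ
  trace : TVar → Trace

/-- Update of a real variable. -/
def State.setReal (v : State) (x : RVar) (r : ℝ) : State :=
  { v with real := Function.update v.real x r }

/-- Update of a trace variable. -/
def State.setTrace (v : State) (t : TVar) (τ : Trace) : State :=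
  { v with trace := Function.update v.trace t τ }

/-! ## Syntax -/

/-- Polynomials over the real variables with rational coefficients, including
differential terms `(p)'`. -/
inductive Poly where
  | var (x : RVar)
  | rat (q : ℚ)
  | add (p q : Poly)
  | mul (p q : Poly)
  | diff (p : Poly)

/-- Finite presentation of a finite or cofinite set of channels. -/
inductive ChanSet where
  | finite (l : List Chan)
  | cofinite (l : List Chan)

/-- Membership of a channel in a (co)finite channel set, as a Boolean. -/
def ChanSet.has : ChanSet → Chan → Bool
  | .finite l, c => decide (c ∈ l)
  | .cofinite l, c => decide (c ∉ l)

mutual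

/-- Real terms. The last four are the channel, the value and the time of the last event of a
trace, and its length. -/
inductive RTerm where
  | var (x : RVar)
  | rat (q : ℚ)
  | add (a b : RTerm)
  | mul (a b : RTerm)
  | diff (p : Poly)
  | chan (e : TTerm)
  | val (e : TTerm)
  | time (e : TTerm)
  | len (e : TTerm)

/-- Trace terms: variables, the empty trace, a single event on channel `c` with value `p` at
time `q`, concatenation, projection onto a channel set, and access `e[a]`. -/
inductive TTerm where
  | var (t : TVar)
  | empty
  | event (c : Chan) (p q : Poly)
  | concat (e f : TTerm)
  | proj (e : TTerm) (C : ChanSet)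
  | item (e : TTerm) (a : RTerm)

end

/-- Formulas of first-order real arithmetic. -/
inductive FolRA where
  | eq (p q : Poly)
  | ge (p q : Poly)
  | not (χ : FolRA)
  | and (χ ξ : FolRA)
  | all (x : RVar) (χ : FolRA)

/-- A differential equation system `x₁' = p₁, …, xₙ' = pₙ` (without domain constraint) in
pairwise distinct unprimed variables, each given by its name. -/
structure ODE where
  eqs : List (ℕ × Poly)
  nonempty : eqs ≠ []
  nodup : (eqs.map Prod.fst).Nodup

/-- `Chan-FOD` formulas: the first-order fragment of the dynamic logic of communicating hybrid
programs, plus the differential equation properties `[x' = p] χ` and `⟨x' = p⟩ χ` for formulas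
`χ` of first-order real arithmetic. -/
inductive Formula where
  | realEq (a b : RTerm)
  | realGe (a b : RTerm)
  | traceEq (e f : TTerm)
  | tracePrefix (e f : TTerm)
  | not (φ : Formula)
  | and (φ ψ : Formula)
  | allReal (x : RVar) (φ : Formula)
  | allTrace (t : TVar) (φ : Formula)
  | box (o : ODE) (χ : FolRA)
  | dia (o : ODE) (χ : FolRA)

/-- The real term is a polynomial over the real variables, without any trace operator. -/
def RTerm.IsPoly : RTerm → Prop
  | .var _ => True
  | .rat _ => True
  | .add a b => a.IsPoly ∧ b.IsPoly
  | .mul a b => a.IsPoly ∧ b.IsPoly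
  | .diff _ => True
  | .chan _ => False
  | .val _ => False
  | .time _ => False
  | .len _ => False

/-- `FOD` formulas: the `Chan-FOD` formulas without traces, that is, first-order real arithmetic
plus differential equation properties. -/
def Formula.IsFOD : Formula → Prop
  | .realEq a b => a.IsPoly ∧ b.IsPoly
  | .realGe a b => a.IsPoly ∧ b.IsPoly
  | .traceEq _ _ => False
  | .tracePrefix _ _ => False
  | .not φ => φ.IsFOD
  | .and φ ψ => φ.IsFOD ∧ ψ.IsFOD
  | .allReal _ φ => φ.IsFOD
  | .allTrace _ _ => False
  | .box _ _ => True
  | .dia _ _ => True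

/-! ## Semantics -/

/-- Value of a polynomial; `(p)'` evaluates to `∑ x' · ∂p/∂x` over the unprimed variables `x`
(only the finitely many `x` that occur in `p` contribute). -/
noncomputable def Poly.eval : Poly → (RVar → ℝ) → ℝ
  | .var x, ρ => ρ x
  | .rat q, _ => (q : ℝ)
  | .add p q, ρ => p.eval ρ + q.eval ρ
  | .mul p q, ρ => p.eval ρ * q.eval ρ
  | .diff p, ρ => ∑ᶠ n : ℕ, ρ (.prime n) *
      deriv (fun r : ℝ => p.eval (Function.update ρ (.base n) r)) (ρ (.base n))

/-- The `⌊r⌋`-th item of a trace (counted from `0`) as a trace, empty if out of bounds. -/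
noncomputable def Trace.item (τ : Trace) (r : ℝ) : Trace :=
  if 0 ≤ ⌊r⌋ then (τ[⌊r⌋.toNat]?).toList else []

/-- Channel of the last event, `0` if there is none. -/
def Trace.lastChan (τ : Trace) : ℝ := (τ.getLast?.map fun e => (e.1 : ℝ)).getD 0

/-- Value of the last event, `0` if there is none. -/
def Trace.lastVal (τ : Trace) : ℝ := (τ.getLast?.map fun e => e.2.1).getD 0

/-- Time of the last event, `0` if there is none. -/
def Trace.lastTime (τ : Trace) : ℝ := (τ.getLast?.map fun e => e.2.2).getD 0

mutual

/-- Value of a real term. -/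
noncomputable def RTerm.eval : RTerm → State → ℝ
  | .var x, v => v.real x
  | .rat q, _ => (q : ℝ)
  | .add a b, v => a.eval v + b.eval v
  | .mul a b, v => a.eval v * b.eval v
  | .diff p, v => (Poly.diff p).eval v.real
  | .chan e, v => Trace.lastChan (e.eval v)
  | .val e, v => Trace.lastVal (e.eval v)
  | .time e, v => Trace.lastTime (e.eval v)
  | .len e, v => ((e.eval v).length : ℝ)

/-- Value of a trace term. -/
noncomputable def TTerm.eval : TTerm → State → Trace
  | .var t, v => v.trace t
  | .empty, _ => []
  | .event c p q, v => [(c, p.eval v.real, q.eval v.real)]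
  | .concat e f, v => e.eval v ++ f.eval v
  | .proj e C, v => (e.eval v).filter fun ev => C.has ev.1
  | .item e a, v => Trace.item (e.eval v) (a.eval v)

end

/-- Satisfaction of a formula of first-order real arithmetic. -/
def FolRA.Sat : FolRA → (RVar → ℝ) → Prop
  | .eq p q, ρ => p.eval ρ = q.eval ρ
  | .ge p q, ρ => p.eval ρ ≥ q.eval ρ
  | .not χ, ρ => ¬ χ.Sat ρ
  | .and χ ξ, ρ => χ.Sat ρ ∧ ξ.Sat ρ
  | .all x χ, ρ => ∀ r : ℝ, χ.Sat (Function.update ρ x r)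

/-- `o.Reach ρ ω`: the differential equation system `o` can evolve from `ρ` to `ω`. There are a
duration `d ≥ 0` and a solution `Φ` on `[0, d]` that starts in `ρ` up to the differential
variables of `o`, changes only the variables `x, x'` of `o`, satisfies the equations, and gives
`x'` the time derivative of `x` (no constraint for `d = 0`), with `ω = Φ d`. -/
def ODE.Reach (o : ODE) (ρ ω : RVar → ℝ) : Prop :=
  ∃ (d : ℝ) (Φ : ℝ → RVar → ℝ), 0 ≤ d ∧
    (∀ y : RVar, (∀ e ∈ o.eqs, y ≠ .prime e.1) → Φ 0 y = ρ y) ∧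
    (∀ s ∈ Set.Icc 0 d,
      (∀ y : RVar, (∀ e ∈ o.eqs, y ≠ .base e.1 ∧ y ≠ .prime e.1) → Φ s y = Φ 0 y) ∧
      ∀ e ∈ o.eqs,
        Φ s (.prime e.1) = e.2.eval (Φ s) ∧
        HasDerivWithinAt (fun r => Φ r (.base e.1)) (Φ s (.prime e.1)) (Set.Icc 0 d) s) ∧
    ω = Φ d

/-- Satisfaction of a `Chan-FOD` formula in a state. -/
def Formula.Sat : Formula → State → Prop
  | .realEq a b, v => a.eval v = b.eval v
  | .realGe a b, v => a.eval v ≥ b.eval v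
  | .traceEq e f, v => e.eval v = f.eval v
  | .tracePrefix e f, v => e.eval v <+: f.eval v
  | .not φ, v => ¬ φ.Sat v
  | .and φ ψ, v => φ.Sat v ∧ ψ.Sat v
  | .allReal x φ, v => ∀ r : ℝ, φ.Sat (v.setReal x r)
  | .allTrace t φ, v => ∀ τ : Trace, φ.Sat (v.setTrace t τ)
  | .box o χ, v => ∀ ω : RVar → ℝ, o.Reach v.real ω → χ.Sat ω
  | .dia o χ, v => ∃ ω : RVar → ℝ, o.Reach v.real ω ∧ χ.Sat ω

/-- Validity: satisfaction in all states. -/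
def Formula.Valid (φ : Formula) : Prop := ∀ v : State, φ.Sat v

/-- The free trace variables: those whose value can affect the truth of the formula. -/
def Formula.freeTVars (φ : Formula) : Set TVar :=
  {t | ∃ (v : State) (τ : Trace), ¬ (φ.Sat v ↔ φ.Sat (v.setTrace t τ))}

/-! ## Gödel encodings of real sequences and of traces by single reals -/

/-- The binary digit of `a ≥ 0` at position `i`: fractional digits for `i ≥ 1`, digits of the
integer part for `i ≤ 0`. -/
noncomputable def binDigit (a : ℝ) (i : ℤ) : ℤ := ⌊(2 : ℝ) ^ i * a⌋ % 2

/-- A real as a nonnegative real: the integer part of `|z|` is shifted by one binary digit, and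
the digit gained at position `0` holds the sign. -/
noncomputable def signFold (z : ℝ) : ℝ :=
  2 * (⌊|z|⌋ : ℝ) + Int.fract |z| + (if z < 0 then 1 else 0)

/-- `Z` encodes a sequence of `n` reals, by interleaving their binary digits, with `z` at
position `j ∈ {1, …, n}`. -/
def GoedelAt (Z : ℝ) (n j : ℕ) (z : ℝ) : Prop :=
  0 ≤ Z ∧ 1 ≤ j ∧ j ≤ n ∧
    ∀ i : ℤ, binDigit (signFold z) i = binDigit Z ((n : ℤ) * (i - 1) + (j : ℤ))

/-- The bijection `0, 1, 2, … ↦ 0, 2, 4, …` and `-1, -2, -3, … ↦ 1, 3, 5, …`. -/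
def intCode : ℤ → ℕ
  | .ofNat n => 2 * n
  | .negSucc n => 2 * n + 1

/-- `Z` encodes an infinite sequence of reals with `z` at position `k ∈ {0, 1, 2, …}`: a pairing
function distributes the binary digits of all its members over the fractional digits of `Z`. -/
def GoedelAtInf (Z : ℝ) (k : ℕ) (z : ℝ) : Prop :=
  0 ≤ Z ∧ ∀ i : ℤ,
    binDigit (signFold z) i = binDigit Z ((Nat.pair k (intCode i) : ℤ) + 1)

/-- `Z` is a Gödel encoding of the trace `τ`: it encodes an infinite sequence of reals whose
members at the positions of `τ` encode the triples (channel, value, time) of the events, and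
whose other members are arbitrary. -/
def IsTraceCode (Z : ℝ) (τ : Trace) : Prop :=
  ∃ s : ℕ → ℝ, (∀ k : ℕ, GoedelAtInf Z k (s k)) ∧
    ∀ (k : ℕ) (h : k < τ.length),
      GoedelAt (s k) 3 1 ((τ[k]).1 : ℝ) ∧
      GoedelAt (s k) 3 2 (τ[k]).2.1 ∧
      GoedelAt (s k) 3 3 (τ[k]).2.2

/-! ## Fresh representants and dual states -/

/-- A number above the names of all real variables of a polynomial. -/
def Poly.bound : Poly → ℕ
  | .var x => x.index + 1
  | .rat _ => 0
  | .add p q => max p.bound q.bound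
  | .mul p q => max p.bound q.bound
  | .diff p => p.bound

mutual

/-- A number above the names of all real variables of a real term. -/
def RTerm.bound : RTerm → ℕ
  | .var x => x.index + 1
  | .rat _ => 0
  | .add a b => max a.bound b.bound
  | .mul a b => max a.bound b.bound
  | .diff p => p.bound
  | .chan e => e.bound
  | .val e => e.bound
  | .time e => e.bound
  | .len e => e.bound

/-- A number above the names of all real variables of a trace term. -/
def TTerm.bound : TTerm → ℕ
  | .var _ => 0
  | .empty => 0
  | .event _ p q => max p.bound q.bound
  | .concat e f => max e.bound f.bound
  | .proj e _ => e.bound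
  | .item e a => max e.bound a.bound

end

/-- A number above the names of all variables of a formula of real arithmetic. -/
def FolRA.bound : FolRA → ℕ
  | .eq p q => max p.bound q.bound
  | .ge p q => max p.bound q.bound
  | .not χ => χ.bound
  | .and χ ξ => max χ.bound ξ.bound
  | .all x χ => max (x.index + 1) χ.bound

/-- A number above the names of all variables of a differential equation system. -/
def ODE.bound (o : ODE) : ℕ :=
  (o.eqs.map fun e => max (e.1 + 1) e.2.bound).foldr max 0

/-- A number above the names of all real variables, free or bound, of a formula. -/
def Formula.bound : Formula → ℕ
  | .realEq a b => max a.bound b.bound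
  | .realGe a b => max a.bound b.bound
  | .traceEq e f => max e.bound f.bound
  | .tracePrefix e f => max e.bound f.bound
  | .not φ => φ.bound
  | .and φ ψ => max φ.bound ψ.bound
  | .allReal x φ => max (x.index + 1) φ.bound
  | .allTrace _ φ => φ.bound
  | .box o χ => max o.bound χ.bound
  | .dia o χ => max o.bound χ.bound

/-- The real variable, fresh for `φ`, that represents the trace variable `t`. -/
def Formula.codeVar (φ : Formula) (t : TVar) : RVar := .base (φ.bound + 2 * t)

/-- The real variable, fresh for `φ`, that represents the length of the trace variable `t`. -/
def Formula.lenVar (φ : Formula) (t : TVar) : RVar := .base (φ.bound + (2 * t + 1))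

/-- `w` is a `FOD`-dual state of `v` with respect to `φ`: it equals `v`, except that the
representants of each free trace variable of `φ` hold a Gödel encoding of the trace and its
length. -/
def IsFODDual (φ : Formula) (v w : State) : Prop :=
  w.trace = v.trace ∧
  (∀ t ∈ φ.freeTVars,
    IsTraceCode (w.real (φ.codeVar t)) (v.trace t) ∧
    w.real (φ.lenVar t) = ((v.trace t).length : ℝ)) ∧
  ∀ x : RVar, (∀ t ∈ φ.freeTVars, x ≠ φ.codeVar t ∧ x ≠ φ.lenVar t) → w.real x = v.real x

/-! ## Gödel numbers of formulas, and effective translations -/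

/-- Number of a real variable. -/
def RVar.code : RVar → ℕ
  | .base n => 2 * n
  | .prime n => 2 * n + 1

/-- Number of a rational. -/
def ratCode (q : ℚ) : ℕ := Nat.pair (intCode q.num) q.den

/-- Number of a polynomial. -/
def Poly.code : Poly → ℕ
  | .var x => Nat.pair 0 x.code
  | .rat q => Nat.pair 1 (ratCode q)
  | .add p q => Nat.pair 2 (Nat.pair p.code q.code)
  | .mul p q => Nat.pair 3 (Nat.pair p.code q.code)
  | .diff p => Nat.pair 4 p.code

/-- Number of a channel set. -/
def ChanSet.code : ChanSet → ℕ
  | .finite l => Nat.pair 0 (Encodable.encode l)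
  | .cofinite l => Nat.pair 1 (Encodable.encode l)

mutual

/-- Number of a real term. -/
def RTerm.code : RTerm → ℕ
  | .var x => Nat.pair 0 x.code
  | .rat q => Nat.pair 1 (ratCode q)
  | .add a b => Nat.pair 2 (Nat.pair a.code b.code)
  | .mul a b => Nat.pair 3 (Nat.pair a.code b.code)
  | .diff p => Nat.pair 4 p.code
  | .chan e => Nat.pair 5 e.code
  | .val e => Nat.pair 6 e.code
  | .time e => Nat.pair 7 e.code
  | .len e => Nat.pair 8 e.code

/-- Number of a trace term. -/
def TTerm.code : TTerm → ℕ
  | .var t => Nat.pair 0 t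
  | .empty => Nat.pair 1 0
  | .event c p q => Nat.pair 2 (Nat.pair c (Nat.pair p.code q.code))
  | .concat e f => Nat.pair 3 (Nat.pair e.code f.code)
  | .proj e C => Nat.pair 4 (Nat.pair e.code C.code)
  | .item e a => Nat.pair 5 (Nat.pair e.code a.code)

end

/-- Number of a formula of real arithmetic. -/
def FolRA.code : FolRA → ℕ
  | .eq p q => Nat.pair 0 (Nat.pair p.code q.code)
  | .ge p q => Nat.pair 1 (Nat.pair p.code q.code)
  | .not χ => Nat.pair 2 χ.code
  | .and χ ξ => Nat.pair 3 (Nat.pair χ.code ξ.code)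
  | .all x χ => Nat.pair 4 (Nat.pair x.code χ.code)

/-- Number of a differential equation system. -/
def ODE.code (o : ODE) : ℕ :=
  Encodable.encode (o.eqs.map fun e => Nat.pair e.1 e.2.code)

/-- Gödel number of a formula. -/
def Formula.code : Formula → ℕ
  | .realEq a b => Nat.pair 0 (Nat.pair a.code b.code)
  | .realGe a b => Nat.pair 1 (Nat.pair a.code b.code)
  | .traceEq e f => Nat.pair 2 (Nat.pair e.code f.code)
  | .tracePrefix e f => Nat.pair 3 (Nat.pair e.code f.code)
  | .not φ => Nat.pair 4 φ.code
  | .and φ ψ => Nat.pair 5 (Nat.pair φ.code ψ.code)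
  | .allReal x φ => Nat.pair 6 (Nat.pair x.code φ.code)
  | .allTrace t φ => Nat.pair 7 (Nat.pair t φ.code)
  | .box o χ => Nat.pair 8 (Nat.pair o.code χ.code)
  | .dia o χ => Nat.pair 9 (Nat.pair o.code χ.code)

/-- A translation of formulas is effective if a computable function on Gödel numbers
performs it. -/
def Effective (T : Formula → Formula) : Prop :=
  ∃ g : ℕ → ℕ, Computable g ∧ ∀ φ : Formula, g φ.code = (T φ).code

end ChanFOD

/-!
The idea of the translation is to replace every trace by two reals, a Gödel encoding and a length.
The function `decode` reads a trace off any two reals. It is total, with the empty trace for reals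
that encode nothing, and surjective, since every trace has an encoding. A quantifier over traces is
therefore equivalent to two quantifiers over reals.

What remains is to express the operations on traces in `FOD`. The flow of the system
`s' = c, c' = -s, t' = 1, e' = e` makes the graphs of sine, cosine and the exponential function
definable. The natural numbers are the quotients of the periods of the rotation by the least one,
and powers of two come from the exponential function, so that integer parts, binary digits, the
Gödel encodings and finally the events of a decoded trace are definable (`Dfn.eventAt`). Here
`Dfn` is an inductive predicate for definable relations in de Bruijn style, which spares the
bookkeeping of bound variables; `Dfn.exists_formula` turns a definable relation into a formula.
Equality, prefixes, concatenation, access and the last event are first-order over the events. A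
projection is described by the running counts of the kept events, which are themselves stored in a
trace (`eq_filter_iff`).

Each operation thus has one fixed formula `Op.formula`, whose arguments are held by fixed variables,
and the translation of a term is a formula that specifies the value of the term, obtained by
applying these fixed formulas to specifications of the subterms (`Op.specifies_apply`). The
auxiliary variables for this are differential variables above the bound of the formula, whereas the
representants of trace variables are unprimed. By `Formula.sat_translate`, the translation holds in
a state if and only if the formula holds for the traces decoded from the representants. A dual
state decodes to the right traces on the free trace variables. The others do not matter: freeness
is semantic, and since truth depends on only finitely many trace variables, these can be changed one
at a time (`Formula.sat_congr_freeTVars`).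

The translation is effective because it is a structural recursion that uses finitely many fixed
formulas. On Gödel numbers it is a course-of-values recursion with a primitive recursive step
(`primrec_courseOfValues`, `translateCode_code`).
-/

namespace ChanFOD

/-! ### Binary digits -/

theorem binDigit_eq_zero_or_one (a : ℝ) (i : ℤ) : binDigit a i = 0 ∨ binDigit a i = 1 :=
  Int.emod_two_eq_zero_or_one _

theorem floor_two_zpow_succ (a : ℝ) (i : ℤ) :
    ⌊(2 : ℝ) ^ (i + 1) * a⌋ = 2 * ⌊(2 : ℝ) ^ i * a⌋ + binDigit a (i + 1) := by
  unfold binDigit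
  have h : ⌊(2 : ℝ) ^ (i + 1) * a⌋ / 2 = ⌊(2 : ℝ) ^ i * a⌋ := by
    have := Int.floor_div_natCast ((2 : ℝ) ^ (i + 1) * a) 2
    rw [show ((2 : ℕ) : ℤ) = 2 from rfl] at this
    rw [← this, zpow_add_one₀ two_ne_zero]
    congr 1
    push_cast
    ring
  omega

/-- A nonnegative real lies below some power of two, so its digits vanish far to the left. -/
theorem exists_floor_eq_zero {a : ℝ} (ha : 0 ≤ a) :
    ∃ M : ℤ, ∀ i ≤ M, ⌊(2 : ℝ) ^ i * a⌋ = 0 := by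
  obtain ⟨n, hn⟩ := pow_unbounded_of_one_lt a (one_lt_two (α := ℝ))
  refine ⟨-n, fun i hi => ?_⟩
  rw [Int.floor_eq_zero_iff]
  refine ⟨by positivity, ?_⟩
  calc (2 : ℝ) ^ i * a ≤ (2 : ℝ) ^ (-(n : ℤ)) * a := by
        gcongr
        norm_num
    _ < (2 : ℝ) ^ (-(n : ℤ)) * 2 ^ n := by gcongr
    _ = 1 := by rw [zpow_neg, zpow_natCast, inv_mul_cancel₀ (by positivity)]

theorem exists_binDigit_eq_zero {a : ℝ} (ha : 0 ≤ a) :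
    ∃ M : ℤ, ∀ i ≤ M, binDigit a i = 0 := by
  obtain ⟨M, hM⟩ := exists_floor_eq_zero ha
  exact ⟨M, fun i hi => by simp [binDigit, hM i hi]⟩

/-- Digits obtained by rounding down are never eventually one. -/
theorem exists_binDigit_zero_gt (a : ℝ) (i : ℤ) : ∃ j > i, binDigit a j = 0 := by
  by_contra! H
  have h1 : ∀ j > i, binDigit a j = 1 := fun j hj =>
    (binDigit_eq_zero_or_one a j).resolve_left (H j hj)
  have h2 : ∀ k : ℕ, ⌊(2 : ℝ) ^ (i + k) * a⌋ + 1 = 2 ^ k * (⌊(2 : ℝ) ^ i * a⌋ + 1) := by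
    intro k
    induction k with
    | zero => simp
    | succ k ih =>
      have := floor_two_zpow_succ a (i + k)
      rw [h1 _ (by omega)] at this
      push_cast
      rw [← add_assoc, this, pow_succ]
      linarith
  set x := (2 : ℝ) ^ i * a with hx
  have hlt : x < ⌊x⌋ + 1 := Int.lt_floor_add_one x
  obtain ⟨k, hk⟩ := pow_unbounded_of_one_lt (1 / (⌊x⌋ + 1 - x)) (one_lt_two (α := ℝ))
  rw [div_lt_iff₀ (by linarith)] at hk
  have h3 := Int.floor_le ((2 : ℝ) ^ (i + k) * a)
  have h4 : (⌊(2 : ℝ) ^ (i + k) * a⌋ : ℝ) + 1 = 2 ^ k * (⌊x⌋ + 1) := by exact_mod_cast h2 k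
  rw [zpow_add₀ two_ne_zero, zpow_natCast] at h3 h4
  have h5 : (2 : ℝ) ^ i * 2 ^ k * a = 2 ^ k * x := by rw [hx]; ring
  rw [h5] at h3 h4
  nlinarith

/-- A nonnegative real is determined by its binary digits. -/
theorem eq_of_binDigit_eq {a b : ℝ} (ha : 0 ≤ a) (hb : 0 ≤ b)
    (h : ∀ i, binDigit a i = binDigit b i) : a = b := by
  obtain ⟨M, hM⟩ := exists_floor_eq_zero ha
  obtain ⟨M', hM'⟩ := exists_floor_eq_zero hb
  have key : ∀ k : ℕ, ⌊(2 : ℝ) ^ (min M M' + k) * a⌋ = ⌊(2 : ℝ) ^ (min M M' + k) * b⌋ := by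
    intro k
    induction k with
    | zero => simp [hM _ (min_le_left M M'), hM' _ (min_le_right M M')]
    | succ k ih =>
      push_cast
      rw [← add_assoc, floor_two_zpow_succ, floor_two_zpow_succ, ih, h]
  by_contra hne
  obtain ⟨n, hn⟩ := pow_unbounded_of_one_lt (1 / |a - b|) (one_lt_two (α := ℝ))
  have hpos : 0 < |a - b| := abs_pos.mpr (sub_ne_zero.mpr hne)
  rw [div_lt_iff₀ hpos] at hn
  obtain ⟨k, hk⟩ : ∃ k : ℕ, (n : ℤ) ≤ min M M' + k := ⟨(n - min M M').toNat, by omega⟩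
  have h2 : (2 : ℝ) ^ n ≤ (2 : ℝ) ^ (min M M' + (k : ℤ)) := by
    rw [← zpow_natCast]
    exact zpow_le_zpow_right₀ one_le_two hk
  have h3 := Int.abs_sub_lt_one_of_floor_eq_floor (key k)
  rw [← mul_sub, abs_mul, abs_of_pos (by positivity)] at h3
  nlinarith

/-- Digits that vanish far to the left and are not eventually one are the digits of a real. -/
theorem exists_binDigit_eq (d : ℤ → ℤ) (hd : ∀ i, d i = 0 ∨ d i = 1)
    (hl : ∃ M, ∀ i ≤ M, d i = 0) (hr : ∀ i, ∃ j > i, d j = 0) :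
    ∃ Z : ℝ, 0 ≤ Z ∧ ∀ i, binDigit Z i = d i := by
  obtain ⟨M, hM⟩ := hl
  -- `S k` is the integer whose digits are those of `d` up to position `M + k`.
  obtain ⟨S, hS0, hS⟩ : ∃ S : ℕ → ℤ, S 0 = 0 ∧
      ∀ k : ℕ, S (k + 1) = 2 * S k + d (M + (k + 1)) :=
    ⟨fun k => Nat.rec 0 (fun k s => 2 * s + d (M + (k + 1))) k, rfl, fun k => rfl⟩
  let lo : ℕ → ℝ := fun k => (S k : ℝ) / (2 : ℝ) ^ (M + (k : ℤ))
  let up : ℕ → ℝ := fun k => ((S k : ℝ) + 1) / (2 : ℝ) ^ (M + (k : ℤ))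
  have hz : ∀ k : ℕ, (2 : ℝ) ^ (M + ((k + 1 : ℕ) : ℤ)) = 2 * 2 ^ (M + (k : ℤ)) := fun k => by
    push_cast
    rw [← add_assoc, zpow_add_one₀ two_ne_zero, mul_comm]
  have hp : ∀ k : ℕ, (0 : ℝ) < 2 ^ (M + (k : ℤ)) := fun k => by positivity
  have hlo : Monotone lo := monotone_nat_of_le_succ fun k => by
    change (S k : ℝ) / _ ≤ S (k + 1) / _
    rw [hz, hS, div_le_div_iff₀ (hp k) (by have := hp k; positivity)]
    have := hp k
    rcases hd (M + (k + 1)) with h | h <;> rw [h] <;> push_cast <;> nlinarith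
  have hup : Antitone up := antitone_nat_of_succ_le fun k => by
    change ((S (k + 1) : ℝ) + 1) / _ ≤ (S k + 1) / _
    rw [hz, hS, div_le_div_iff₀ (by have := hp k; positivity) (hp k)]
    have := hp k
    rcases hd (M + (k + 1)) with h | h <;> rw [h] <;> push_cast <;> nlinarith
  have hlu : ∀ k, lo k < up k := fun k => by
    have := hp k
    change (S k : ℝ) / _ < (S k + 1) / _
    gcongr
    linarith
  have hle : ∀ j k, lo j ≤ up k := fun j k =>
    (hlo (le_max_left j k)).trans ((hlu _).le.trans (hup (le_max_right j k)))
  have hbdd : BddAbove (Set.range lo) := ⟨up 0, by rintro _ ⟨j, rfl⟩; exact hle j 0⟩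
  let Z := ⨆ k, lo k
  have hZlo : ∀ k, lo k ≤ Z := le_ciSup hbdd
  have hZle : ∀ k, Z ≤ up k := fun k => ciSup_le fun j => hle j k
  have hZup : ∀ k, Z < up k := fun k => by
    obtain ⟨j, hj, hj0⟩ := hr (M + k)
    obtain ⟨m, rfl⟩ : ∃ m : ℕ, j = M + ((m : ℤ) + 1) := ⟨(j - M - 1).toNat, by omega⟩
    refine (hZle (m + 1)).trans_lt (lt_of_lt_of_le ?_ (hup (show k ≤ m by omega)))
    change ((S (m + 1) : ℝ) + 1) / _ < (S m + 1) / _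
    rw [hz, hS, hj0, div_lt_div_iff₀ (by have := hp m; positivity) (hp m)]
    have := hp m
    push_cast
    nlinarith
  have hfl : ∀ k : ℕ, ⌊(2 : ℝ) ^ (M + (k : ℤ)) * Z⌋ = S k := fun k => by
    rw [Int.floor_eq_iff, mul_comm]
    have h1 := hZlo k
    have h2 := hZup k
    simp only [lo, up] at h1 h2
    rw [div_le_iff₀ (hp k)] at h1
    rw [lt_div_iff₀ (hp k)] at h2
    exact ⟨h1, h2⟩
  have hZ0 : 0 ≤ Z := by
    have := hZlo 0
    simpa [lo, hS0] using this
  refine ⟨Z, hZ0, fun i => ?_⟩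
  rcases le_or_gt i M with hi | hi
  · rw [hM i hi]
    have h0 : ⌊(2 : ℝ) ^ i * Z⌋ = 0 := by
      have h1 := hfl 0
      simp only [Nat.cast_zero, add_zero, hS0, Int.floor_eq_zero_iff] at h1
      rw [Int.floor_eq_zero_iff]
      refine ⟨by positivity, lt_of_le_of_lt ?_ h1.2⟩
      gcongr
      norm_num
    simp [binDigit, h0]
  · obtain ⟨m, rfl⟩ : ∃ m : ℕ, i = M + ((m : ℤ) + 1) := ⟨(i - M - 1).toNat, by omega⟩
    have h1 := hfl (m + 1)
    push_cast at h1
    rw [binDigit, h1, hS]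
    rcases hd (M + (m + 1)) with h | h <;> rw [h] <;> omega

/-! ### Existence and uniqueness of Gödel encodings -/

theorem signFold_nonneg (z : ℝ) : 0 ≤ signFold z := by
  have h1 : (0 : ℝ) ≤ ⌊|z|⌋ := by exact_mod_cast Int.floor_nonneg.mpr (abs_nonneg z)
  have h2 := Int.fract_nonneg |z|
  unfold signFold
  split_ifs <;> linarith

theorem signFold_injective : Function.Injective signFold := by
  intro x y h
  have key : ∀ z : ℝ, ⌊signFold z⌋ = 2 * ⌊|z|⌋ + (if z < 0 then 1 else 0) ∧
      Int.fract (signFold z) = Int.fract |z| := by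
    intro z
    have e : signFold z = Int.fract |z| + ((2 * ⌊|z|⌋ + (if z < 0 then 1 else 0) : ℤ) : ℝ) := by
      unfold signFold
      push_cast
      ring
    rw [e]
    constructor
    · rw [Int.floor_add_intCast, Int.floor_fract, zero_add]
    · rw [Int.fract_add_intCast, Int.fract_fract]
  have hf := (key x).1
  have hr := (key x).2
  rw [h, (key y).1] at hf
  rw [h, (key y).2] at hr
  have habs : ⌊|x|⌋ = ⌊|y|⌋ := by split_ifs at hf <;> omega
  have hsgn : x < 0 ↔ y < 0 := by
    by_cases hx : x < 0 <;> by_cases hy : y < 0 <;> simp [hx, hy] at hf ⊢ <;> omega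
  have hab : |x| = |y| := by
    rw [← Int.floor_add_fract |x|, ← Int.floor_add_fract |y|, habs, hr]
  by_cases hx : x < 0
  · rw [abs_of_neg hx, abs_of_neg (hsgn.mp hx)] at hab
    linarith
  · have hy : ¬ y < 0 := fun hy => hx (hsgn.mpr hy)
    rwa [abs_of_nonneg (not_lt.mp hx), abs_of_nonneg (not_lt.mp hy)] at hab

theorem eq_of_binDigit_signFold_eq {x y : ℝ}
    (h : ∀ i, binDigit (signFold x) i = binDigit (signFold y) i) : x = y :=
  signFold_injective (eq_of_binDigit_eq (signFold_nonneg x) (signFold_nonneg y) h)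

theorem GoedelAt.unique {Z : ℝ} {n j : ℕ} {x y : ℝ} (hx : GoedelAt Z n j x)
    (hy : GoedelAt Z n j y) : x = y :=
  eq_of_binDigit_signFold_eq fun i => (hx.2.2.2 i).trans (hy.2.2.2 i).symm

theorem GoedelAtInf.unique {Z : ℝ} {k : ℕ} {x y : ℝ} (hx : GoedelAtInf Z k x)
    (hy : GoedelAtInf Z k y) : x = y :=
  eq_of_binDigit_signFold_eq fun i => (hx.2 i).trans (hy.2 i).symm

/-- Every triple of reals has an encoding. -/
theorem exists_goedelAt_three (x y z : ℝ) :
    ∃ Z, GoedelAt Z 3 1 x ∧ GoedelAt Z 3 2 y ∧ GoedelAt Z 3 3 z := by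
  -- Position `m` of the code belongs to the member `c m` and holds its digit at position
  -- `(m - 1) / 3 + 1`.
  let c : ℤ → ℝ := fun m => if m % 3 = 1 then x else if m % 3 = 2 then y else z
  let d : ℤ → ℤ := fun m => binDigit (signFold (c m)) ((m - 1) / 3 + 1)
  obtain ⟨Mx, hx⟩ := exists_binDigit_eq_zero (signFold_nonneg x)
  obtain ⟨My, hy⟩ := exists_binDigit_eq_zero (signFold_nonneg y)
  obtain ⟨Mz, hz⟩ := exists_binDigit_eq_zero (signFold_nonneg z)
  obtain ⟨Z, hZ, h⟩ := exists_binDigit_eq d (fun i => binDigit_eq_zero_or_one _ _)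
    ⟨3 * min Mx (min My Mz) - 3, fun i hi => by
      have hi' : (i - 1) / 3 + 1 ≤ min Mx (min My Mz) := by omega
      rw [le_min_iff, le_min_iff] at hi'
      simp only [d, c]
      split_ifs
      exacts [hx _ hi'.1, hy _ hi'.2.1, hz _ hi'.2.2]⟩
    (fun i => by
      obtain ⟨j, hj, h0⟩ := exists_binDigit_zero_gt (signFold x) (max i 1 + 1)
      refine ⟨3 * (j - 1) + 1, by omega, ?_⟩
      have e1 : (3 * (j - 1) + 1) % 3 = 1 := by omega
      have e2 : (3 * (j - 1) + 1 - 1) / 3 + 1 = j := by omega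
      simp only [d, c, e1, e2, if_true, h0])
  refine ⟨Z, ⟨hZ, by norm_num, by norm_num, fun i => ?_⟩,
    ⟨hZ, by norm_num, by norm_num, fun i => ?_⟩, hZ, by norm_num, by norm_num, fun i => ?_⟩
  · have e1 : (3 * (i - 1) + 1) % 3 = 1 := by omega
    have e2 : (3 * (i - 1) + 1 - 1) / 3 + 1 = i := by omega
    rw [h]
    push_cast
    simp only [d, c, e1, e2, if_true]
  · have e1 : (3 * (i - 1) + 2) % 3 = 2 := by omega
    have e2 : (3 * (i - 1) + 2 - 1) / 3 + 1 = i := by omega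
    rw [h]
    push_cast
    simp only [d, c, e1, e2]
    norm_num
  · have e1 : (3 * (i - 1) + 3) % 3 = 0 := by omega
    have e2 : (3 * (i - 1) + 3 - 1) / 3 + 1 = i := by omega
    rw [h]
    push_cast
    simp only [d, c, e1, e2]
    norm_num

/-- The inverse of `intCode`. -/
def intUncode (c : ℕ) : ℤ := if c % 2 = 0 then (c / 2 : ℕ) else -((c / 2 : ℕ) : ℤ) - 1

theorem intUncode_intCode (i : ℤ) : intUncode (intCode i) = i := by
  cases i with
  | ofNat n => simp [intCode, intUncode]
  | negSucc n =>
    have h1 : (2 * n + 1) % 2 = 1 := by omega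
    have h2 : (2 * n + 1) / 2 = n := by omega
    rw [intCode, intUncode, h1, h2, if_neg (by norm_num), Int.negSucc_eq]
    ring

/-- Every infinite sequence of reals has an encoding. -/
theorem exists_goedelAtInf (s : ℕ → ℝ) : ∃ Z, ∀ k, GoedelAtInf Z k (s k) := by
  let d : ℤ → ℤ := fun m => if m ≤ 0 then 0 else
    binDigit (signFold (s (m - 1).toNat.unpair.1)) (intUncode (m - 1).toNat.unpair.2)
  have hd : ∀ k i, d ((Nat.pair k (intCode i) : ℤ) + 1) = binDigit (signFold (s k)) i := by
    intro k i
    have h1 : ¬ ((Nat.pair k (intCode i) : ℤ) + 1 ≤ 0) := by omega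
    have h2 : ((Nat.pair k (intCode i) : ℤ) + 1 - 1).toNat = Nat.pair k (intCode i) := by omega
    simp only [d, h1, h2, if_false, Nat.unpair_pair, intUncode_intCode]
  obtain ⟨Z, hZ, h⟩ := exists_binDigit_eq d
    (fun i => by
      simp only [d]
      split_ifs
      exacts [Or.inl rfl, binDigit_eq_zero_or_one _ _])
    ⟨0, fun i hi => by simp [d, hi]⟩
    (fun i => by
      -- The digits of the integer part of any member supply zeros.
      obtain ⟨M, hM⟩ := exists_binDigit_eq_zero (signFold_nonneg (s 0))
      obtain ⟨n, hn⟩ : ∃ n : ℕ, Int.negSucc n ≤ M ∧ i ≤ n :=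
        ⟨(max (-M) i).toNat, by rw [Int.negSucc_eq]; omega, by omega⟩
      refine ⟨(Nat.pair 0 (intCode (Int.negSucc n)) : ℤ) + 1, ?_, ?_⟩
      · have := Nat.right_le_pair 0 (intCode (Int.negSucc n))
        simp only [intCode] at this ⊢
        omega
      · rw [hd, hM _ hn.1])
  exact ⟨Z, fun k => ⟨hZ, fun i => by rw [h, hd]⟩⟩

theorem exists_isTraceCode (τ : Trace) : ∃ Z, IsTraceCode Z τ := by
  choose f hf using fun e : Event => exists_goedelAt_three (e.1 : ℝ) e.2.1 e.2.2
  obtain ⟨Z, hZ⟩ := exists_goedelAtInf fun k => (τ[k]?.map f).getD 0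
  refine ⟨Z, _, hZ, fun k h => ?_⟩
  simpa [h] using hf τ[k]

/-- A code and the length determine the trace; the code alone does not, since its members beyond the
trace are arbitrary. -/
theorem IsTraceCode.unique {Z : ℝ} {τ τ' : Trace} (h : IsTraceCode Z τ) (h' : IsTraceCode Z τ')
    (hlen : τ.length = τ'.length) : τ = τ' := by
  obtain ⟨s, hs, ht⟩ := h
  obtain ⟨s', hs', ht'⟩ := h'
  refine List.ext_getElem hlen fun k hk hk' => ?_
  obtain ⟨h1, h2, h3⟩ := ht k hk
  obtain ⟨h1', h2', h3'⟩ := ht' k hk'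
  rw [← (hs k).unique (hs' k)] at h1' h2' h3'
  exact Prod.ext (by exact_mod_cast h1.unique h1') (Prod.ext (h2.unique h2') (h3.unique h3'))

open Classical in
/-- The trace of length `n` that `Z` encodes; the empty trace if there is none. All pairs of reals
thus represent traces, and a quantifier over traces becomes two quantifiers over reals. -/
noncomputable def decode (Z n : ℝ) : Trace :=
  if h : ∃ τ : Trace, IsTraceCode Z τ ∧ n = τ.length then h.choose else []

theorem IsTraceCode.decode_eq {Z : ℝ} {τ : Trace} (h : IsTraceCode Z τ) :
    decode Z τ.length = τ := by
  have hex : ∃ σ : Trace, IsTraceCode Z σ ∧ (τ.length : ℝ) = σ.length := ⟨τ, h, rfl⟩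
  rw [decode, dif_pos hex]
  exact hex.choose_spec.1.unique h (by exact_mod_cast hex.choose_spec.2.symm)

theorem decode_surjective (τ : Trace) : ∃ Z n, decode Z n = τ :=
  let ⟨Z, hZ⟩ := exists_isTraceCode τ
  ⟨Z, _, hZ.decode_eq⟩

/-- An event of a decoded trace is described by Gödel encodings of reals only, without reference to
traces. The first conjunct says that `(Z, n)` is a code at all: without one, `decode` gives the
empty trace, which has no events. -/
theorem decode_getElem?_eq_some {Z n : ℝ} {k : ℕ} {e : Event} :
    (decode Z n)[k]? = some e ↔
      ((∃ m : ℕ, n = m) ∧ (∀ j : ℕ, ∃ x, GoedelAtInf Z j x) ∧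
        ∀ j : ℕ, j < n → ∃ x, GoedelAtInf Z j x ∧
          ∃ (c : ℕ) (a t : ℝ), GoedelAt x 3 1 c ∧ GoedelAt x 3 2 a ∧ GoedelAt x 3 3 t) ∧
      k < n ∧ ∃ x, GoedelAtInf Z k x ∧
        GoedelAt x 3 1 e.1 ∧ GoedelAt x 3 2 e.2.1 ∧ GoedelAt x 3 3 e.2.2 := by
  constructor
  · intro h
    have hex : ∃ σ : Trace, IsTraceCode Z σ ∧ n = σ.length := by
      by_contra hne
      rw [decode, dif_neg hne] at h
      simp at h
    obtain ⟨σ, hσ, rfl⟩ := hex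
    rw [hσ.decode_eq] at h
    obtain ⟨s, hs, ht⟩ := hσ
    obtain ⟨hk, rfl⟩ := List.getElem?_eq_some_iff.mp h
    exact ⟨⟨⟨_, rfl⟩, fun j => ⟨_, hs j⟩,
        fun j hj => ⟨_, hs j, _, _, _, ht j (by exact_mod_cast hj)⟩⟩,
      by exact_mod_cast hk, _, hs k, ht k hk⟩
  · rintro ⟨⟨⟨m, rfl⟩, hs, ht⟩, hk, x, hx, hc, ha, hτ⟩
    choose s hs using hs
    have ht' : ∀ j : Fin m, ∃ e : Event, GoedelAt (s j) 3 1 e.1 ∧ GoedelAt (s j) 3 2 e.2.1 ∧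
        GoedelAt (s j) 3 3 e.2.2 := fun j => by
      obtain ⟨y, hy, c, a, t, h⟩ := ht j (by exact_mod_cast j.2)
      rw [hy.unique (hs j)] at h
      exact ⟨(c, a, t), h⟩
    choose f hf using ht'
    have hcode : IsTraceCode Z (List.ofFn f) := by
      refine ⟨s, hs, fun j hj => ?_⟩
      simpa using hf ⟨j, by simpa using hj⟩
    have hdec := hcode.decode_eq
    rw [List.length_ofFn] at hdec
    have hk' : k < m := by exact_mod_cast hk
    rw [hdec, List.getElem?_ofFn, dif_pos hk', Option.some_inj]
    obtain ⟨h1, h2, h3⟩ := hf ⟨k, hk'⟩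
    rw [hx.unique (hs k)] at hc ha hτ
    exact Prod.ext (by exact_mod_cast h1.unique hc) (Prod.ext (h2.unique ha) (h3.unique hτ))

/-! ### Existential quantifiers and assignments as formulas -/

/-- The existential quantifier over a real variable. -/
def Formula.exReal (x : RVar) (φ : Formula) : Formula := .not (.allReal x (.not φ))

/-- `φ` with the variable `x` bound to the value of `a`. -/
def Formula.letReal (x : RVar) (a : RTerm) (φ : Formula) : Formula :=
  .allReal x (.not (.and (.realEq (.var x) a) (.not φ)))

theorem Formula.sat_exReal {x : RVar} {φ : Formula} {w : State} :
    (exReal x φ).Sat w ↔ ∃ r, φ.Sat (w.setReal x r) := by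
  simp [exReal, Sat]

@[simp] theorem State.setReal_real (w : State) (x : RVar) (r : ℝ) :
    (w.setReal x r).real = Function.update w.real x r := rfl

theorem Formula.sat_letReal {x : RVar} {a : RTerm} {φ : Formula} {w : State}
    (h : ∀ r, a.eval (w.setReal x r) = a.eval w) :
    (letReal x a φ).Sat w ↔ φ.Sat (w.setReal x (a.eval w)) := by
  simp [letReal, Sat, RTerm.eval, h]

/-! ### A differential equation system for time, sine, cosine and exponential -/

/-- The system `s' = c, c' = -s, t' = 1, e' = e`. -/
def flowODE : ODE where
  eqs := [(0, .var (.base 1)), (1, .mul (.rat (-1)) (.var (.base 0))), (2, .rat 1),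
    (3, .var (.base 3))]
  nonempty := by simp
  nodup := by simp

theorem eq_of_hasDerivWithinAt_zero {f : ℝ → ℝ} {d : ℝ} (hd : 0 ≤ d)
    (h : ∀ s ∈ Set.Icc 0 d, HasDerivWithinAt f 0 (Set.Icc 0 d) s) :
    f d = f 0 := by
  rcases hd.eq_or_lt with rfl | hd'
  · rfl
  · exact constant_of_derivWithin_zero (fun s hs => (h s hs).differentiableWithinAt)
      (fun s hs => (h s ⟨hs.1, hs.2.le⟩).derivWithin
        (uniqueDiffOn_Icc hd' s ⟨hs.1, hs.2.le⟩)) d ⟨hd, le_rfl⟩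

/-- Uniqueness of the solution of `flowODE` that starts in `(0, 1, 0, 1)`. -/
theorem flowODE_reach {ρ ω : RVar → ℝ} (h : flowODE.Reach ρ ω) (h0 : ρ (.base 0) = 0)
    (h1 : ρ (.base 1) = 1) (h2 : ρ (.base 2) = 0) (h3 : ρ (.base 3) = 1) :
    0 ≤ ω (.base 2) ∧ ω (.base 0) = Real.sin (ω (.base 2)) ∧
      ω (.base 1) = Real.cos (ω (.base 2)) ∧ ω (.base 3) = Real.exp (ω (.base 2)) ∧
      ∀ k, 4 ≤ k → ω (.base k) = ρ (.base k) := by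
  obtain ⟨d, Φ, hd, hi, hs, rfl⟩ := h
  have hb : ∀ k, Φ 0 (.base k) = ρ (.base k) := fun k => hi _ (by simp)
  have D0 : ∀ s ∈ Set.Icc 0 d, HasDerivWithinAt (fun r => Φ r (.base 0)) (Φ s (.base 1))
      (Set.Icc 0 d) s := fun s hs' => by
    have := (hs s hs').2 (0, .var (.base 1)) (by simp [flowODE])
    simp only [Poly.eval] at this
    rw [← this.1]
    exact this.2
  have D1 : ∀ s ∈ Set.Icc 0 d, HasDerivWithinAt (fun r => Φ r (.base 1)) (-Φ s (.base 0))
      (Set.Icc 0 d) s := fun s hs' => by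
    have := (hs s hs').2 (1, .mul (.rat (-1)) (.var (.base 0))) (by simp [flowODE])
    simp only [Poly.eval] at this
    convert this.2 using 1
    rw [this.1]
    norm_num
  have D2 : ∀ s ∈ Set.Icc 0 d, HasDerivWithinAt (fun r => Φ r (.base 2)) 1
      (Set.Icc 0 d) s := fun s hs' => by
    have := (hs s hs').2 (2, .rat 1) (by simp [flowODE])
    simp only [Poly.eval] at this
    convert this.2 using 1
    rw [this.1]
    norm_num
  have D3 : ∀ s ∈ Set.Icc 0 d, HasDerivWithinAt (fun r => Φ r (.base 3)) (Φ s (.base 3))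
      (Set.Icc 0 d) s := fun s hs' => by
    have := (hs s hs').2 (3, .var (.base 3)) (by simp [flowODE])
    simp only [Poly.eval] at this
    convert this.2 using 1
    exact this.1.symm
  have Ht : Φ d (.base 2) = d := by
    have := eq_of_hasDerivWithinAt_zero hd (f := fun r => Φ r (.base 2) - r) fun s hs' => by
      exact ((D2 s hs').sub (hasDerivWithinAt_id s _)).congr_deriv (by ring)
    simp only [hb, h2] at this
    linarith
  -- The solution is compared with sine and cosine through the two quantities that the rotation
  -- keeps constant.
  have HA := eq_of_hasDerivWithinAt_zero hd
    (f := fun r => Φ r (.base 0) * Real.sin r + Φ r (.base 1) * Real.cos r) fun s hs' => by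
      exact (((D0 s hs').mul (Real.hasDerivAt_sin s).hasDerivWithinAt).add
        ((D1 s hs').mul (Real.hasDerivAt_cos s).hasDerivWithinAt)).congr_deriv (by ring)
  have HB := eq_of_hasDerivWithinAt_zero hd
    (f := fun r => Φ r (.base 0) * Real.cos r - Φ r (.base 1) * Real.sin r) fun s hs' => by
      exact (((D0 s hs').mul (Real.hasDerivAt_cos s).hasDerivWithinAt).sub
        ((D1 s hs').mul (Real.hasDerivAt_sin s).hasDerivWithinAt)).congr_deriv (by ring)
  have HE := eq_of_hasDerivWithinAt_zero hd
    (f := fun r => Φ r (.base 3) * Real.exp (-r)) fun s hs' => by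
      exact ((D3 s hs').mul ((Real.hasDerivAt_exp (-s)).comp s
        (hasDerivAt_neg s)).hasDerivWithinAt).congr_deriv (by simp)
  simp only [hb, h0, h1, h3, Real.sin_zero, Real.cos_zero, Real.exp_zero, neg_zero] at HA HB HE
  have hsc := Real.sin_sq_add_cos_sq d
  rw [Ht]
  refine ⟨hd, ?_, ?_, ?_, fun k hk => ?_⟩
  · linear_combination Real.sin d * HA + Real.cos d * HB - Φ d (.base 0) * hsc
  · linear_combination Real.cos d * HA - Real.sin d * HB - Φ d (.base 1) * hsc
  · rw [Real.exp_neg] at HE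
    field_simp at HE
    linarith
  · rw [(hs d ⟨hd, le_rfl⟩).1 (.base k) (by simp [flowODE]; omega), hb]

/-- Existence of the solution of `flowODE` that starts in `(0, 1, 0, 1)`, for any duration. -/
theorem flowODE_reach_of_nonneg {ρ : RVar → ℝ} (h0 : ρ (.base 0) = 0)
    (h1 : ρ (.base 1) = 1) (h2 : ρ (.base 2) = 0) (h3 : ρ (.base 3) = 1) {d : ℝ} (hd : 0 ≤ d) :
    ∃ ω, flowODE.Reach ρ ω ∧ ω (.base 0) = Real.sin d ∧ ω (.base 1) = Real.cos d ∧
      ω (.base 2) = d ∧ ω (.base 3) = Real.exp d ∧ ∀ k, 4 ≤ k → ω (.base k) = ρ (.base k) := by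
  let Φ : ℝ → RVar → ℝ := fun s y => match y with
    | .base 0 => Real.sin s
    | .base 1 => Real.cos s
    | .base 2 => s
    | .base 3 => Real.exp s
    | .prime 0 => Real.cos s
    | .prime 1 => -Real.sin s
    | .prime 2 => 1
    | .prime 3 => Real.exp s
    | y => ρ y
  refine ⟨Φ d, ⟨d, Φ, hd, ?_, fun s _ => ⟨?_, ?_⟩, rfl⟩, rfl, rfl, rfl, rfl, ?_⟩
  · intro y hy
    simp only [flowODE, List.mem_cons, List.not_mem_nil, or_false, forall_eq_or_imp,
      forall_eq] at hy
    rcases y with (_ | _ | _ | _ | n) | (_ | _ | _ | _ | n) <;> simp_all [Φ]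
  · intro y hy
    simp only [flowODE, List.mem_cons, List.not_mem_nil, or_false, forall_eq_or_imp,
      forall_eq] at hy
    rcases y with (_ | _ | _ | _ | n) | (_ | _ | _ | _ | n) <;> simp_all [Φ]
  · simp only [flowODE, List.mem_cons, List.not_mem_nil, or_false, forall_eq_or_imp,
      forall_eq, Poly.eval, Φ]
    exact ⟨⟨trivial, (Real.hasDerivAt_sin s).hasDerivWithinAt⟩,
      ⟨by norm_num, (Real.hasDerivAt_cos s).hasDerivWithinAt⟩,
      ⟨by norm_num, hasDerivWithinAt_id s _⟩, trivial, (Real.hasDerivAt_exp s).hasDerivWithinAt⟩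
  · intro k hk
    obtain ⟨n, rfl⟩ := Nat.exists_eq_add_of_le' hk
    rfl

/-! ### Definable predicates -/

/-- Polynomial functions of an environment, that is, of an infinite list of reals. -/
inductive IsPolyFun : ((ℕ → ℝ) → ℝ) → Prop
  | var (i : ℕ) : IsPolyFun fun v => v i
  | rat (q : ℚ) : IsPolyFun fun _ => q
  | add {f g : (ℕ → ℝ) → ℝ} : IsPolyFun f → IsPolyFun g → IsPolyFun fun v => f v + g v
  | mul {f g : (ℕ → ℝ) → ℝ} : IsPolyFun f → IsPolyFun g → IsPolyFun fun v => f v * g v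

/-- Predicates on environments that are definable by `FOD` formulas. The quantifier acts on the
head of the environment, in the style of de Bruijn, so that no variable can be captured. The atom
`flow` is what the differential equations contribute beyond real arithmetic. -/
inductive Dfn : ((ℕ → ℝ) → Prop) → Prop
  | eq {f g : (ℕ → ℝ) → ℝ} : IsPolyFun f → IsPolyFun g → Dfn fun v => f v = g v
  | le {f g : (ℕ → ℝ) → ℝ} : IsPolyFun f → IsPolyFun g → Dfn fun v => f v ≤ g v
  | flow {t s c e : (ℕ → ℝ) → ℝ} : IsPolyFun t → IsPolyFun s → IsPolyFun c → IsPolyFun e →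
      Dfn fun v => 0 ≤ t v ∧ s v = Real.sin (t v) ∧ c v = Real.cos (t v) ∧ e v = Real.exp (t v)
  | not {R : (ℕ → ℝ) → Prop} : Dfn R → Dfn fun v => ¬ R v
  | and {R S : (ℕ → ℝ) → Prop} : Dfn R → Dfn S → Dfn fun v => R v ∧ S v
  | all {R : (ℕ → ℝ) → ℝ → Prop} : Dfn (fun v => R (fun i => v (i + 1)) (v 0)) →
      Dfn fun v => ∀ x, R v x

theorem IsPolyFun.exists_term {f : (ℕ → ℝ) → ℝ} (hf : IsPolyFun f) (σ : ℕ → ℕ) :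
    ∃ a : RTerm, a.IsPoly ∧ ∀ w : State, a.eval w = f fun i => w.real (.prime (σ i)) := by
  induction hf with
  | var i => exact ⟨.var (.prime (σ i)), trivial, fun w => rfl⟩
  | rat q => exact ⟨.rat q, trivial, fun w => rfl⟩
  | add _ _ ih ih' =>
    obtain ⟨a, ha, h⟩ := ih
    obtain ⟨b, hb, h'⟩ := ih'
    exact ⟨.add a b, ⟨ha, hb⟩, fun w => by rw [RTerm.eval, h, h']⟩
  | mul _ _ ih ih' =>
    obtain ⟨a, ha, h⟩ := ih
    obtain ⟨b, hb, h'⟩ := ih'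
    exact ⟨.mul a b, ⟨ha, hb⟩, fun w => by rw [RTerm.eval, h, h']⟩

/-- The formula that the flow of `flowODE` from `(0, 1, 0, 1)` passes at time `t` through
`s`, `c` and `e`. It overwrites the unprimed variables `0, …, 7`, so the terms must not depend on
unprimed variables. -/
def flowFormula (t s c e : RTerm) : Formula :=
  .letReal (.base 4) t <| .letReal (.base 5) s <| .letReal (.base 6) c <| .letReal (.base 7) e <|
  .letReal (.base 0) (.rat 0) <| .letReal (.base 1) (.rat 1) <| .letReal (.base 2) (.rat 0) <|
  .letReal (.base 3) (.rat 1) <| .dia flowODE <|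
    .and (.and (.eq (.var (.base 2)) (.var (.base 4))) (.eq (.var (.base 0)) (.var (.base 5))))
      (.and (.eq (.var (.base 1)) (.var (.base 6))) (.eq (.var (.base 3)) (.var (.base 7))))

theorem sat_flowFormula {t s c e : RTerm} {w : State}
    (ht : ∀ w n r, t.eval (w.setReal (.base n) r) = t.eval w)
    (hs : ∀ w n r, s.eval (w.setReal (.base n) r) = s.eval w)
    (hc : ∀ w n r, c.eval (w.setReal (.base n) r) = c.eval w)
    (he : ∀ w n r, e.eval (w.setReal (.base n) r) = e.eval w) :
    (flowFormula t s c e).Sat w ↔ 0 ≤ t.eval w ∧ s.eval w = Real.sin (t.eval w) ∧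
      c.eval w = Real.cos (t.eval w) ∧ e.eval w = Real.exp (t.eval w) := by
  unfold flowFormula
  rw [Formula.sat_letReal fun r => ht _ _ _, Formula.sat_letReal fun r => hs _ _ _,
    Formula.sat_letReal fun r => hc _ _ _, Formula.sat_letReal fun r => he _ _ _,
    Formula.sat_letReal fun r => rfl, Formula.sat_letReal fun r => rfl,
    Formula.sat_letReal fun r => rfl, Formula.sat_letReal fun r => rfl]
  simp only [hs, hc, he, Formula.Sat, FolRA.Sat, Poly.eval]
  suffices H : ∀ ρ : RVar → ℝ, ρ (.base 0) = 0 → ρ (.base 1) = 1 → ρ (.base 2) = 0 →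
      ρ (.base 3) = 1 → ρ (.base 4) = t.eval w → ρ (.base 5) = s.eval w →
      ρ (.base 6) = c.eval w → ρ (.base 7) = e.eval w →
      ((∃ ω, flowODE.Reach ρ ω ∧ (ω (.base 2) = ω (.base 4) ∧ ω (.base 0) = ω (.base 5)) ∧
        ω (.base 1) = ω (.base 6) ∧ ω (.base 3) = ω (.base 7)) ↔
      0 ≤ t.eval w ∧ s.eval w = Real.sin (t.eval w) ∧
      c.eval w = Real.cos (t.eval w) ∧ e.eval w = Real.exp (t.eval w)) from
    H _ (by simp [RTerm.eval]) (by simp [RTerm.eval]) (by simp [RTerm.eval])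
      (by simp [RTerm.eval]) (by simp) (by simp) (by simp) (by simp)
  intro ρ h0 h1 h2 h3 h4 h5 h6 h7
  constructor
  · rintro ⟨ω, hω, ⟨e2, e0⟩, e1, e3⟩
    obtain ⟨p, q0, q1, q3, q⟩ := flowODE_reach hω h0 h1 h2 h3
    rw [q 4 (by norm_num), h4] at e2
    rw [q 5 (by norm_num), h5] at e0
    rw [q 6 (by norm_num), h6] at e1
    rw [q 7 (by norm_num), h7] at e3
    rw [e2] at p q0 q1 q3
    exact ⟨p, e0 ▸ q0, e1 ▸ q1, e3 ▸ q3⟩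
  · rintro ⟨p, q0, q1, q3⟩
    obtain ⟨ω, hω, e0, e1, e2, e3, q⟩ := flowODE_reach_of_nonneg h0 h1 h2 h3 p
    refine ⟨ω, hω, ?_⟩
    rw [q 4 (by norm_num), q 5 (by norm_num), q 6 (by norm_num), q 7 (by norm_num), e0, e1, e2, e3,
      h4, h5, h6, h7]
    exact ⟨⟨rfl, q0.symm⟩, q1.symm, q3.symm⟩

/-- A definable predicate is expressed by an `FOD` formula, whatever differential variables hold
the entries of the environment, as long as these are finitely many: a fresh one can then serve
each quantifier. -/
theorem Dfn.exists_formula {R : (ℕ → ℝ) → Prop} (hR : Dfn R) :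
    ∀ (k : ℕ) (σ : ℕ → ℕ), (∀ i, σ i < k) →
      ∃ F : Formula, F.IsFOD ∧ ∀ w : State, F.Sat w ↔ R fun i => w.real (.prime (σ i)) := by
  induction hR with
  | eq hf hg =>
    intro k σ _
    obtain ⟨a, ha, h⟩ := hf.exists_term σ
    obtain ⟨b, hb, h'⟩ := hg.exists_term σ
    exact ⟨.realEq a b, ⟨ha, hb⟩, fun w => by rw [Formula.Sat, h, h']⟩
  | le hf hg =>
    intro k σ _
    obtain ⟨a, ha, h⟩ := hf.exists_term σ
    obtain ⟨b, hb, h'⟩ := hg.exists_term σ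
    exact ⟨.realGe b a, ⟨hb, ha⟩, fun w => by rw [Formula.Sat, h, h']⟩
  | flow ht hs hc he =>
    intro k σ _
    obtain ⟨t, pt, ht⟩ := ht.exists_term σ
    obtain ⟨s, ps, hs⟩ := hs.exists_term σ
    obtain ⟨c, pc, hc⟩ := hc.exists_term σ
    obtain ⟨e, pe, he⟩ := he.exists_term σ
    refine ⟨flowFormula t s c e, ?_, fun w => ?_⟩
    · simp [flowFormula, Formula.letReal, Formula.IsFOD, RTerm.IsPoly, *]
    · rw [sat_flowFormula (t := t) (s := s) (c := c) (e := e) (fun w n r => by simp [ht])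
        (fun w n r => by simp [hs]) (fun w n r => by simp [hc]) (fun w n r => by simp [he]),
        ht, hs, hc, he]
  | not _ ih =>
    intro k σ hσ
    obtain ⟨F, hF, h⟩ := ih k σ hσ
    exact ⟨.not F, hF, fun w => by rw [Formula.Sat, h]⟩
  | and _ _ ih ih' =>
    intro k σ hσ
    obtain ⟨F, hF, h⟩ := ih k σ hσ
    obtain ⟨G, hG, h'⟩ := ih' k σ hσ
    exact ⟨.and F G, ⟨hF, hG⟩, fun w => by rw [Formula.Sat, h, h']⟩
  | all _ ih =>
    intro k σ hσ
    obtain ⟨F, hF, h⟩ := ih (k + 1) (fun i => Nat.casesOn i k σ) (by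
      rintro (_ | i)
      · exact Nat.lt_succ_self k
      · exact (hσ i).trans (Nat.lt_succ_self k))
    refine ⟨.allReal (.prime k) F, hF, fun w => ?_⟩
    simp only [Formula.Sat, h, State.setReal_real]
    refine forall_congr' fun r => ?_
    have : ∀ i, σ i ≠ k := fun i => (hσ i).ne
    simp [this]

/-! ### Closure properties of definability -/

theorem IsPolyFun.comp {f : (ℕ → ℝ) → ℝ} (hf : IsPolyFun f) {g : ℕ → (ℕ → ℝ) → ℝ}
    (hg : ∀ i, IsPolyFun (g i)) : IsPolyFun fun v => f fun i => g i v := by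
  induction hf with
  | var i => exact hg i
  | rat q => exact .rat q
  | add _ _ ih ih' => exact .add ih ih'
  | mul _ _ ih ih' => exact .mul ih ih'

theorem IsPolyFun.natCast (n : ℕ) : IsPolyFun fun _ => (n : ℝ) := by
  simpa using IsPolyFun.rat n

theorem IsPolyFun.zero : IsPolyFun fun _ => (0 : ℝ) := by simpa using IsPolyFun.rat 0

theorem IsPolyFun.one : IsPolyFun fun _ => (1 : ℝ) := by simpa using IsPolyFun.rat 1

theorem IsPolyFun.two : IsPolyFun fun _ => (2 : ℝ) := by simpa using IsPolyFun.rat 2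

theorem IsPolyFun.three : IsPolyFun fun _ => (3 : ℝ) := by simpa using IsPolyFun.rat 3

theorem IsPolyFun.half : IsPolyFun fun _ => (2⁻¹ : ℝ) := by simpa using IsPolyFun.rat 2⁻¹

theorem IsPolyFun.neg {f : (ℕ → ℝ) → ℝ} (hf : IsPolyFun f) : IsPolyFun fun v => -f v := by
  simpa using (IsPolyFun.rat (-1)).mul hf

theorem IsPolyFun.sub {f g : (ℕ → ℝ) → ℝ} (hf : IsPolyFun f) (hg : IsPolyFun g) :
    IsPolyFun fun v => f v - g v := by
  simpa [sub_eq_add_neg] using hf.add hg.neg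

namespace Dfn

theorem congr {R S : (ℕ → ℝ) → Prop} (h : ∀ v, R v ↔ S v) (hS : Dfn S) : Dfn R := by
  rwa [show R = S from funext fun v => propext (h v)]

/-- Definability is preserved when polynomial functions are substituted for the entries of the
environment. -/
theorem subst {R : (ℕ → ℝ) → Prop} (hR : Dfn R) {g : ℕ → (ℕ → ℝ) → ℝ}
    (hg : ∀ i, IsPolyFun (g i)) : Dfn fun v => R fun i => g i v := by
  induction hR generalizing g with
  | eq h h' => exact .eq (h.comp hg) (h'.comp hg)
  | le h h' => exact .le (h.comp hg) (h'.comp hg)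
  | flow ht hs hc he => exact .flow (ht.comp hg) (hs.comp hg) (hc.comp hg) (he.comp hg)
  | not _ ih => exact .not (ih hg)
  | and _ _ ih ih' => exact .and (ih hg) (ih' hg)
  | @all R _ ih =>
    refine .all (ih (g := fun i v => Nat.casesOn i (v 0) fun i => g i fun j => v (j + 1)) ?_)
    rintro (_ | i)
    · exact .var 0
    · exact (hg i).comp fun j => .var (j + 1)

variable {R S : (ℕ → ℝ) → Prop} {f g : (ℕ → ℝ) → ℝ}

theorem lt (hf : IsPolyFun f) (hg : IsPolyFun g) : Dfn fun v => f v < g v :=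
  (Dfn.not (.le hg hf)).congr fun _ => not_le.symm

theorem or (hR : Dfn R) (hS : Dfn S) : Dfn fun v => R v ∨ S v :=
  (Dfn.not (hR.not.and hS.not)).congr fun _ => by tauto

theorem imp (hR : Dfn R) (hS : Dfn S) : Dfn fun v => R v → S v :=
  (Dfn.not (hR.and hS.not)).congr fun _ => by tauto

theorem iff (hR : Dfn R) (hS : Dfn S) : Dfn fun v => (R v ↔ S v) :=
  ((hR.imp hS).and (hS.imp hR)).congr fun _ => by tauto

theorem ex {R : (ℕ → ℝ) → ℝ → Prop} (h : Dfn fun v => R (fun i => v (i + 1)) (v 0)) :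
    Dfn fun v => ∃ x, R v x :=
  (Dfn.not (.all (R := fun v x => ¬ R v x) h.not)).congr fun _ => by simp

end Dfn

/-! ### Integers, powers of two and binary digits are definable -/

/-- `z` is a natural multiple of the period of the rotation. This and the later predicates are
irreducible, so that the search for a proof of definability stops at them. -/
@[irreducible] def IsPeriod (z : ℝ) : Prop := ∃ n : ℕ, z = n * (2 * Real.pi)

/-- The rotation that starts in `(0, 1)` returns there exactly at the multiples of its period. -/
theorem isPeriod_iff {z : ℝ} : IsPeriod z ↔
    ∃ e, 0 ≤ z ∧ 0 = Real.sin z ∧ 1 = Real.cos z ∧ e = Real.exp z := by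
  unfold IsPeriod
  have hpi := Real.two_pi_pos
  constructor
  · rintro ⟨n, rfl⟩
    refine ⟨_, by positivity, ?_, ?_, rfl⟩
    · rw [← mul_assoc]
      exact_mod_cast (Real.sin_nat_mul_pi (n * 2)).symm
    · exact (Real.cos_nat_mul_two_pi n).symm
  · rintro ⟨e, h0, _, hc, _⟩
    obtain ⟨n, hn⟩ := (Real.cos_eq_one_iff z).mp hc.symm
    have hn0 : 0 ≤ n := by
      by_contra hneg
      have : (n : ℝ) < 0 := by exact_mod_cast not_le.mp hneg
      nlinarith
    lift n to ℕ using hn0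
    exact ⟨n, hn.symm⟩

/-- `x` is a natural number. -/
@[irreducible] def IsNatural (x : ℝ) : Prop := ∃ n : ℕ, x = n

/-- The natural numbers are the quotients of the periods by the least positive period. -/
theorem isNatural_iff {x : ℝ} : IsNatural x ↔ ∃ u, 0 < u ∧ IsPeriod u ∧
    (∀ w, 0 < w → w < u → ¬ IsPeriod w) ∧ IsPeriod (x * u) := by
  unfold IsNatural IsPeriod
  have hpi := Real.two_pi_pos
  constructor
  · rintro ⟨n, rfl⟩
    refine ⟨2 * Real.pi, hpi, ⟨1, by simp⟩, ?_, n, rfl⟩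
    rintro w h0 h1 ⟨m, rfl⟩
    rcases m with _ | m
    · simp at h0
    · push_cast at h1
      have : (0 : ℝ) ≤ m := m.cast_nonneg
      nlinarith
  · rintro ⟨u, hu, ⟨m, rfl⟩, hmin, n, hn⟩
    have hm : m = 1 := by
      rcases m with _ | _ | m
      · simp at hu
      · rfl
      · refine absurd ⟨1, by simp⟩ (hmin (2 * Real.pi) hpi ?_)
        push_cast
        have : (0 : ℝ) ≤ m := m.cast_nonneg
        nlinarith
    subst hm
    refine ⟨n, ?_⟩
    rw [Nat.cast_one, one_mul] at hn
    exact mul_right_cancel₀ hpi.ne' hn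

/-- `x` is an integer. -/
@[irreducible] def IsInteger (x : ℝ) : Prop := ∃ n : ℤ, x = n

theorem isInteger_iff {x : ℝ} : IsInteger x ↔ IsNatural x ∨ IsNatural (-x) := by
  unfold IsInteger IsNatural
  constructor
  · rintro ⟨n, rfl⟩
    obtain ⟨m, rfl | rfl⟩ := n.eq_nat_or_neg
    · exact .inl ⟨m, by simp⟩
    · exact .inr ⟨m, by simp⟩
  · rintro (⟨n, rfl⟩ | ⟨n, hn⟩)
    · exact ⟨n, by simp⟩
    · exact ⟨-n, by push_cast; linarith⟩

/-- `y = exp x`. -/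
@[irreducible] def IsExp (x y : ℝ) : Prop := y = Real.exp x

/-- The flow runs forward in time, so that the exponential of a negative number is obtained as an
inverse. -/
theorem isExp_iff {x y : ℝ} : IsExp x y ↔
    (∃ s c, 0 ≤ x ∧ s = Real.sin x ∧ c = Real.cos x ∧ y = Real.exp x) ∨
    ∃ s c z, (0 ≤ -x ∧ s = Real.sin (-x) ∧ c = Real.cos (-x) ∧ z = Real.exp (-x)) ∧
      y * z = 1 := by
  unfold IsExp
  constructor
  · rintro rfl
    rcases le_total 0 x with h | h
    · exact .inl ⟨_, _, h, rfl, rfl, rfl⟩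
    · exact .inr ⟨_, _, _, ⟨by linarith, rfl, rfl, rfl⟩, by rw [← Real.exp_add]; simp⟩
  · rintro (⟨_, _, _, _, _, h⟩ | ⟨_, _, z, ⟨_, _, _, rfl⟩, h⟩)
    · exact h
    · rw [Real.exp_neg] at h
      field_simp at h
      exact h

/-- `y = 2 ^ x`. -/
@[irreducible] def IsTwoPow (x y : ℝ) : Prop := y = (2 : ℝ) ^ x

/-- The exponent `u` with `exp u = 2` is the natural logarithm of `2`. -/
theorem isTwoPow_iff {x y : ℝ} : IsTwoPow x y ↔ ∃ u, IsExp u 2 ∧ IsExp (x * u) y := by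
  unfold IsTwoPow IsExp
  constructor
  · rintro rfl
    refine ⟨Real.log 2, (Real.exp_log two_pos).symm, ?_⟩
    rw [Real.rpow_def_of_pos two_pos, mul_comm]
  · rintro ⟨u, hu, rfl⟩
    rw [Real.rpow_def_of_pos two_pos, hu, Real.log_exp, mul_comm]

/-- `y = ⌊x⌋`. -/
@[irreducible] def IsFloor (x y : ℝ) : Prop := y = ⌊x⌋

theorem isFloor_iff {x y : ℝ} : IsFloor x y ↔ IsInteger y ∧ y ≤ x ∧ x < y + 1 := by
  unfold IsFloor IsInteger
  constructor
  · rintro rfl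
    exact ⟨⟨_, rfl⟩, Int.floor_le x, Int.lt_floor_add_one x⟩
  · rintro ⟨⟨n, rfl⟩, h⟩
    rw [Int.floor_eq_iff.mpr h]

/-- `d` is the binary digit of `a` at the integral position `i`. -/
@[irreducible] def IsDigit (a i d : ℝ) : Prop := ∃ n : ℤ, i = n ∧ d = binDigit a n

theorem isDigit_iff {a i d : ℝ} : IsDigit a i d ↔ IsInteger i ∧
    ∃ p f h, IsTwoPow i p ∧ IsFloor (p * a) f ∧ IsFloor (f * 2⁻¹) h ∧ d = f - 2 * h := by
  unfold IsDigit IsInteger IsTwoPow IsFloor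
  have key : ∀ n : ℤ, ((⌊(2 : ℝ) ^ (n : ℝ) * a⌋ : ℝ) -
      2 * (⌊(⌊(2 : ℝ) ^ (n : ℝ) * a⌋ : ℝ) * 2⁻¹⌋ : ℝ))
      = binDigit a n := by
    intro n
    rw [Real.rpow_intCast, binDigit]
    have h := Int.floor_div_natCast ((⌊(2 : ℝ) ^ n * a⌋ : ℤ) : ℝ) 2
    rw [Int.floor_intCast, Nat.cast_ofNat, Nat.cast_ofNat, div_eq_mul_inv] at h
    rw [h]
    norm_cast
    omega
  constructor
  · rintro ⟨n, rfl, rfl⟩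
    exact ⟨⟨n, rfl⟩, _, _, _, rfl, rfl, rfl, (key n).symm⟩
  · rintro ⟨⟨n, rfl⟩, _, _, _, rfl, rfl, rfl, rfl⟩
    exact ⟨n, rfl, key n⟩

/-- `s = signFold z`. -/
@[irreducible] def IsSignFold (z s : ℝ) : Prop := s = signFold z

theorem isSignFold_iff {z s : ℝ} : IsSignFold z s ↔
    (∃ f, 0 ≤ z ∧ IsFloor z f ∧ s = f + z) ∨ ∃ f, z < 0 ∧ IsFloor (-z) f ∧ s = f - z + 1 := by
  unfold IsSignFold IsFloor signFold
  have h := Int.floor_add_fract |z|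
  rcases lt_or_ge z 0 with hz | hz
  · rw [abs_of_neg hz] at h ⊢
    simp only [hz, not_le.mpr hz, if_true, false_and, exists_false, false_or, true_and,
      exists_eq_left]
    constructor <;> intro hs <;> linarith
  · rw [abs_of_nonneg hz] at h ⊢
    simp only [hz, not_lt.mpr hz, if_false, false_and, exists_false, or_false, true_and,
      exists_eq_left]
    constructor <;> intro hs <;> linarith

/-- `c` is the code of the integer `i`. -/
@[irreducible] def IsIntCode (i c : ℝ) : Prop := ∃ n : ℤ, i = n ∧ c = intCode n

theorem isIntCode_iff {i c : ℝ} : IsIntCode i c ↔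
    IsInteger i ∧ ((0 ≤ i ∧ c = 2 * i) ∨ (i < 0 ∧ c = -(2 * i) - 1)) := by
  have key : ∀ n : ℤ, (intCode n : ℝ) =
      if 0 ≤ (n : ℝ) then 2 * (n : ℝ) else -(2 * (n : ℝ)) - 1 := by
    rintro (n | n)
    · simp [intCode]
    · have : ¬ (0 ≤ ((Int.negSucc n : ℤ) : ℝ)) := by
        exact_mod_cast not_le.mpr (Int.negSucc_lt_zero n)
      rw [if_neg this]
      simp [intCode]
      ring
  unfold IsIntCode IsInteger
  constructor
  · rintro ⟨n, rfl, rfl⟩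
    refine ⟨⟨n, rfl⟩, ?_⟩
    rw [key]
    split_ifs with h
    · exact .inl ⟨h, rfl⟩
    · exact .inr ⟨not_le.mp h, rfl⟩
  · rintro ⟨⟨n, rfl⟩, ⟨h, rfl⟩ | ⟨h, rfl⟩⟩
    · exact ⟨n, rfl, by rw [key, if_pos h]⟩
    · exact ⟨n, rfl, by rw [key, if_neg (not_le.mpr h)]⟩

/-- `m` is the code of the pair `(a, b)` of natural numbers. -/
@[irreducible] def IsPair (a b m : ℝ) : Prop := ∃ i j : ℕ, a = i ∧ b = j ∧ m = Nat.pair i j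

theorem isPair_iff {a b m : ℝ} : IsPair a b m ↔ IsNatural a ∧ IsNatural b ∧
    ((a < b ∧ m = b * b + a) ∨ (b ≤ a ∧ m = a * a + a + b)) := by
  unfold IsPair IsNatural
  constructor
  · rintro ⟨i, j, rfl, rfl, rfl⟩
    refine ⟨⟨i, rfl⟩, ⟨j, rfl⟩, ?_⟩
    unfold Nat.pair
    split_ifs with h
    · exact .inl ⟨by exact_mod_cast h, by push_cast; ring⟩
    · exact .inr ⟨by exact_mod_cast not_lt.mp h, by push_cast; ring⟩
  · rintro ⟨⟨i, rfl⟩, ⟨j, rfl⟩, ⟨h, rfl⟩ | ⟨h, rfl⟩⟩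
    · refine ⟨i, j, rfl, rfl, ?_⟩
      rw [Nat.pair, if_pos (by exact_mod_cast h)]
      push_cast; ring
    · refine ⟨i, j, rfl, rfl, ?_⟩
      rw [Nat.pair, if_neg (not_lt.mpr (by exact_mod_cast h))]
      push_cast; ring

theorem isDigit_intCast {a d : ℝ} {n : ℤ} : IsDigit a n d ↔ d = binDigit a n := by
  unfold IsDigit
  constructor
  · rintro ⟨m, h, rfl⟩
    rw [Int.cast_inj.mp h]
  · rintro rfl
    exact ⟨n, rfl, rfl⟩

/-- `GoedelAt` with real arguments, for sequences of length three. -/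
@[irreducible] def IsGoedelThree (j : ℕ) (Z z : ℝ) : Prop := GoedelAt Z 3 j z

theorem isGoedelThree_iff {j : ℕ} {Z z : ℝ} (h1 : 1 ≤ j) (h3 : j ≤ 3) :
    IsGoedelThree j Z z ↔ 0 ≤ Z ∧ ∀ i, IsInteger i →
      ∃ s d, IsSignFold z s ∧ IsDigit s i d ∧ IsDigit Z (3 * (i - 1) + j) d := by
  unfold IsGoedelThree IsInteger IsSignFold
  simp only [GoedelAt, h1, h3, true_and, exists_eq_left, exists_and_left]
  refine and_congr_right fun _ => ?_
  constructor
  · rintro h _ ⟨i, rfl⟩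
    refine ⟨_, isDigit_intCast.mpr rfl, ?_⟩
    rw [h i]
    have : (3 * ((i : ℝ) - 1) + j) = ((((3 : ℕ) : ℤ) * (i - 1) + (j : ℤ) : ℤ) : ℝ) := by
      push_cast
      ring
    rw [this, isDigit_intCast]
  · intro h i
    obtain ⟨d, h1, h2⟩ := h i ⟨i, rfl⟩
    have : (3 * ((i : ℝ) - 1) + j) = ((((3 : ℕ) : ℤ) * (i - 1) + (j : ℤ) : ℤ) : ℝ) := by
      push_cast
      ring
    rw [this, isDigit_intCast] at h2
    rw [isDigit_intCast] at h1
    exact_mod_cast h1.symm.trans h2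

/-- `GoedelAtInf` with real arguments. -/
@[irreducible] def IsGoedelInf (Z k z : ℝ) : Prop := ∃ n : ℕ, k = n ∧ GoedelAtInf Z n z

theorem isGoedelInf_natCast {Z z : ℝ} {k : ℕ} : IsGoedelInf Z k z ↔ GoedelAtInf Z k z := by
  unfold IsGoedelInf
  constructor
  · rintro ⟨n, h, h'⟩
    rwa [Nat.cast_inj.mp h]
  · exact fun h => ⟨k, rfl, h⟩

theorem isGoedelInf_iff {Z k z : ℝ} : IsGoedelInf Z k z ↔ IsNatural k ∧ 0 ≤ Z ∧ ∀ i, IsInteger i →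
    ∃ s d c m, IsSignFold z s ∧ IsDigit s i d ∧ IsIntCode i c ∧ IsPair k c m ∧
      IsDigit Z (m + 1) d := by
  have key : ∀ (n : ℕ) (i : ℤ), (∃ s d c m, IsSignFold z s ∧ IsDigit s i d ∧ IsIntCode i c ∧
      IsPair n c m ∧ IsDigit Z (m + 1) d) ↔
      binDigit (signFold z) i = binDigit Z ((Nat.pair n (intCode i) : ℤ) + 1) := by
    intro n i
    have e : ((Nat.pair n (intCode i) : ℝ) + 1) = (((Nat.pair n (intCode i) : ℤ) + 1 : ℤ) : ℝ) := by
      push_cast; rfl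
    unfold IsSignFold IsIntCode IsPair
    constructor
    · rintro ⟨_, d, _, _, rfl, h1, ⟨i', hi, rfl⟩, ⟨n', c', hn, hc, rfl⟩, h2⟩
      rw [← Int.cast_inj.mp hi] at hc
      rw [← Nat.cast_inj.mp hn, ← Nat.cast_inj.mp hc, e, isDigit_intCast] at h2
      rw [isDigit_intCast] at h1
      exact_mod_cast h1.symm.trans h2
    · intro h
      refine ⟨_, _, _, _, rfl, isDigit_intCast.mpr rfl, ⟨i, rfl, rfl⟩, ⟨n, _, rfl, rfl, rfl⟩, ?_⟩
      rw [e, isDigit_intCast, h]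
  unfold IsGoedelInf IsNatural IsInteger GoedelAtInf
  constructor
  · rintro ⟨n, rfl, h0, h⟩
    refine ⟨⟨n, rfl⟩, h0, ?_⟩
    rintro _ ⟨i, rfl⟩
    exact (key n i).mpr (h i)
  · rintro ⟨⟨n, rfl⟩, h0, h⟩
    exact ⟨n, rfl, h0, fun i => (key n i).mp (h i ⟨i, rfl⟩)⟩

/-- The event at position `k` of the trace `τ` is `(c, a, t)`. -/
@[irreducible] def EventAt (τ : Trace) (k c a t : ℝ) : Prop :=
  ∃ j m : ℕ, k = j ∧ c = m ∧ τ[j]? = some (m, a, t)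

theorem eventAt_natCast {τ : Trace} {k c : ℕ} {a t : ℝ} :
    EventAt τ k c a t ↔ τ[k]? = some (c, a, t) := by
  unfold EventAt
  constructor
  · rintro ⟨j, m, hj, hm, h⟩
    rwa [Nat.cast_inj.mp hj, Nat.cast_inj.mp hm]
  · exact fun h => ⟨k, c, rfl, rfl, h⟩

theorem eventAt_decode_iff {Z n k c a t : ℝ} : EventAt (decode Z n) k c a t ↔
    IsNatural k ∧ IsNatural c ∧ IsNatural n ∧ (∀ j, IsNatural j → ∃ x, IsGoedelInf Z j x) ∧
      (∀ j, IsNatural j → j < n → ∃ x, IsGoedelInf Z j x ∧ ∃ c a t, IsNatural c ∧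
        IsGoedelThree 1 x c ∧ IsGoedelThree 2 x a ∧ IsGoedelThree 3 x t) ∧
      k < n ∧ ∃ x, IsGoedelInf Z k x ∧
        IsGoedelThree 1 x c ∧ IsGoedelThree 2 x a ∧ IsGoedelThree 3 x t := by
  unfold EventAt IsNatural IsGoedelThree
  constructor
  · rintro ⟨j, m, rfl, rfl, h⟩
    obtain ⟨⟨hn, h1, h2⟩, hk, x, hx, h3⟩ := decode_getElem?_eq_some.mp h
    refine ⟨⟨j, rfl⟩, ⟨m, rfl⟩, hn, ?_, ?_, hk, x, isGoedelInf_natCast.mpr hx, h3⟩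
    · rintro _ ⟨i, rfl⟩
      exact (h1 i).imp fun x => isGoedelInf_natCast.mpr
    · rintro _ ⟨i, rfl⟩ hi
      obtain ⟨x, hx, c, a, t, h⟩ := h2 i hi
      exact ⟨x, isGoedelInf_natCast.mpr hx, c, a, t, ⟨c, rfl⟩, h⟩
  · rintro ⟨⟨j, rfl⟩, ⟨m, rfl⟩, hn, h1, h2, hk, x, hx, h3⟩
    refine ⟨j, m, rfl, rfl, decode_getElem?_eq_some.mpr ⟨⟨hn, ?_, ?_⟩, hk, x,
      isGoedelInf_natCast.mp hx, h3⟩⟩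
    · intro i
      exact (h1 i ⟨i, rfl⟩).imp fun x => isGoedelInf_natCast.mp
    · intro i hi
      obtain ⟨x, hx, _, a, t, ⟨c, rfl⟩, h⟩ := h2 i ⟨i, rfl⟩ hi
      exact ⟨x, isGoedelInf_natCast.mp hx, c, a, t, h⟩

theorem IsPolyFun.reindex {f : (ℕ → ℝ) → ℝ} (hf : IsPolyFun f) (σ : ℕ → ℕ) :
    IsPolyFun fun v => f fun i => v (σ i) :=
  hf.comp fun i => .var (σ i)

namespace Dfn

variable {f g a c t k : (ℕ → ℝ) → ℝ}

theorem isPeriod (hf : IsPolyFun f) : Dfn fun v => IsPeriod (f v) := by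
  simp only [isPeriod_iff]
  exact .ex (.flow (hf.reindex _) .zero .one (.var 0))

theorem isNatural (hf : IsPolyFun f) : Dfn fun v => IsNatural (f v) := by
  simp only [isNatural_iff]
  apply_rules [Dfn.not, ex, all, Dfn.and, imp, isPeriod, lt, IsPolyFun.zero, IsPolyFun.var,
    IsPolyFun.mul, hf.reindex]

theorem isInteger (hf : IsPolyFun f) : Dfn fun v => IsInteger (f v) := by
  simp only [isInteger_iff]
  exact .or (isNatural hf) (isNatural hf.neg)

theorem isExp (hf : IsPolyFun f) (hg : IsPolyFun g) : Dfn fun v => IsExp (f v) (g v) := by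
  simp only [isExp_iff]
  apply_rules [Dfn.or, ex, Dfn.flow, Dfn.and, Dfn.eq, IsPolyFun.one, IsPolyFun.var, IsPolyFun.mul,
    IsPolyFun.neg, hf.reindex, hg.reindex]

theorem isTwoPow (hf : IsPolyFun f) (hg : IsPolyFun g) : Dfn fun v => IsTwoPow (f v) (g v) := by
  simp only [isTwoPow_iff]
  apply_rules [ex, Dfn.and, isExp, IsPolyFun.two, IsPolyFun.var, IsPolyFun.mul, hf.reindex,
    hg.reindex]

theorem isFloor (hf : IsPolyFun f) (hg : IsPolyFun g) : Dfn fun v => IsFloor (f v) (g v) := by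
  simp only [isFloor_iff]
  exact .and (isInteger hg) (.and (.le hg hf) (.lt hf (hg.add .one)))

theorem isDigit (ha : IsPolyFun a) (hf : IsPolyFun f) (hg : IsPolyFun g) :
    Dfn fun v => IsDigit (a v) (f v) (g v) := by
  simp only [isDigit_iff]
  apply_rules [ex, Dfn.and, isInteger, isTwoPow, isFloor, Dfn.eq, IsPolyFun.two, IsPolyFun.half,
    IsPolyFun.var, IsPolyFun.mul, IsPolyFun.sub, ha.reindex, hf.reindex, hg.reindex]

theorem isSignFold (hf : IsPolyFun f) (hg : IsPolyFun g) :
    Dfn fun v => IsSignFold (f v) (g v) := by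
  simp only [isSignFold_iff]
  apply_rules [Dfn.or, ex, Dfn.and, Dfn.le, lt, isFloor, Dfn.eq, IsPolyFun.zero, IsPolyFun.one,
    IsPolyFun.neg, IsPolyFun.var, IsPolyFun.sub, IsPolyFun.add, hf.reindex, hg.reindex]

theorem isIntCode (hf : IsPolyFun f) (hg : IsPolyFun g) :
    Dfn fun v => IsIntCode (f v) (g v) := by
  simp only [isIntCode_iff]
  apply_rules [Dfn.or, Dfn.and, isInteger, Dfn.le, lt, Dfn.eq, IsPolyFun.zero, IsPolyFun.one,
    IsPolyFun.two, IsPolyFun.neg, IsPolyFun.sub, IsPolyFun.mul]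

theorem isPair (ha : IsPolyFun a) (hf : IsPolyFun f) (hg : IsPolyFun g) :
    Dfn fun v => IsPair (a v) (f v) (g v) := by
  simp only [isPair_iff]
  apply_rules [Dfn.or, Dfn.and, isNatural, Dfn.le, lt, Dfn.eq, IsPolyFun.add, IsPolyFun.mul]

theorem isGoedelThree {j : ℕ} (h1 : 1 ≤ j) (h3 : j ≤ 3) (hf : IsPolyFun f) (hg : IsPolyFun g) :
    Dfn fun v => IsGoedelThree j (f v) (g v) := by
  simp only [isGoedelThree_iff h1 h3]
  apply_rules [all, imp, ex, Dfn.and, isInteger, isSignFold, isDigit, Dfn.le, IsPolyFun.zero,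
    IsPolyFun.one, IsPolyFun.three, IsPolyFun.natCast, IsPolyFun.var, IsPolyFun.sub,
    IsPolyFun.add, IsPolyFun.mul, hf.reindex, hg.reindex]

theorem isGoedelInf (ha : IsPolyFun a) (hf : IsPolyFun f) (hg : IsPolyFun g) :
    Dfn fun v => IsGoedelInf (a v) (f v) (g v) := by
  simp only [isGoedelInf_iff]
  apply_rules [all, imp, ex, Dfn.and, isInteger, isNatural, isSignFold, isDigit, isIntCode, isPair,
    Dfn.le, IsPolyFun.zero, IsPolyFun.one, IsPolyFun.var, IsPolyFun.add, ha.reindex, hf.reindex,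
    hg.reindex]

/-- The events of a decoded trace are definable from its code and its length: every operation on
traces that is described through events is therefore definable. -/
theorem eventAt (hf : IsPolyFun f) (hg : IsPolyFun g) (hk : IsPolyFun k) (hc : IsPolyFun c)
    (ha : IsPolyFun a) (ht : IsPolyFun t) :
    Dfn fun v => EventAt (decode (f v) (g v)) (k v) (c v) (a v) (t v) := by
  simp only [eventAt_decode_iff]
  apply_rules (maxDepth := 200) [all, imp, ex, Dfn.and, isNatural, isGoedelInf, isGoedelThree,
    lt, IsPolyFun.var, hf.reindex, hg.reindex, hk.reindex, hc.reindex, ha.reindex, ht.reindex] <;>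
    norm_num

end Dfn

/-! ### Operations on traces are definable -/

theorem eventAt_iff {τ : Trace} {k c a t : ℝ} :
    EventAt τ k c a t ↔ ∃ j m : ℕ, k = j ∧ c = m ∧ τ[j]? = some (m, a, t) := by
  unfold EventAt
  rfl

theorem trace_eq_iff {τ σ : Trace} :
    τ = σ ↔ ∀ k c a t, EventAt τ k c a t ↔ EventAt σ k c a t := by
  refine ⟨fun h => by simp [h], fun h => List.ext_getElem? fun j => Option.ext fun e => ?_⟩
  obtain ⟨m, a, t⟩ := e
  rw [← eventAt_natCast, ← eventAt_natCast, h]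

theorem trace_prefix_iff {τ σ : Trace} :
    τ <+: σ ↔ ∀ k c a t, EventAt τ k c a t → EventAt σ k c a t := by
  rw [List.prefix_iff_getElem?]
  constructor
  · intro h k c a t
    rw [eventAt_iff, eventAt_iff]
    rintro ⟨j, m, rfl, rfl, hj⟩
    obtain ⟨hlt, he⟩ := List.getElem?_eq_some_iff.mp hj
    exact ⟨j, m, rfl, rfl, by rw [h j hlt, he]⟩
  · intro h j hj
    exact eventAt_natCast.mp (h j τ[j].1 τ[j].2.1 τ[j].2.2
      (eventAt_natCast.mpr (List.getElem?_eq_getElem hj)))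

theorem exists_eventAt_natCast {τ : Trace} {k : ℕ} :
    (∃ c a t, EventAt τ k c a t) ↔ k < τ.length := by
  constructor
  · rintro ⟨c, a, t, h⟩
    obtain ⟨j, m, hj, -, h⟩ := eventAt_iff.mp h
    rw [Nat.cast_inj.mp hj]
    exact (List.getElem?_eq_some_iff.mp h).1
  · intro h
    exact ⟨_, _, _, eventAt_natCast.mpr (List.getElem?_eq_getElem h)⟩

/-- `y` is the length of the trace `τ`. -/
@[irreducible] def IsLength (τ : Trace) (y : ℝ) : Prop := y = τ.length

theorem isLength_iff {τ : Trace} {y : ℝ} : IsLength τ y ↔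
    IsNatural y ∧ ∀ k, IsNatural k → (k < y ↔ ∃ c a t, EventAt τ k c a t) := by
  unfold IsLength IsNatural
  constructor
  · rintro rfl
    refine ⟨⟨_, rfl⟩, ?_⟩
    rintro _ ⟨k, rfl⟩
    rw [exists_eventAt_natCast, Nat.cast_lt]
  · rintro ⟨⟨n, rfl⟩, h⟩
    rw [Nat.cast_inj]
    by_contra hne
    rcases lt_or_gt_of_ne hne with hlt | hlt
    · exact absurd (Nat.cast_lt.mp ((h n ⟨n, rfl⟩).mpr (exists_eventAt_natCast.mpr hlt)))
        (lt_irrefl n)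
    · exact absurd (exists_eventAt_natCast.mp ((h τ.length ⟨_, rfl⟩).mp (Nat.cast_lt.mpr hlt)))
        (lt_irrefl _)

theorem eventAt_append {ρ σ : Trace} {k c a t : ℝ} : EventAt (ρ ++ σ) k c a t ↔
    EventAt ρ k c a t ∨ EventAt σ (k - ρ.length) c a t := by
  simp only [eventAt_iff]
  constructor
  · rintro ⟨j, m, rfl, rfl, h⟩
    rw [List.getElem?_append] at h
    split_ifs at h with hj
    · exact .inl ⟨j, m, rfl, rfl, h⟩
    · exact .inr ⟨j - ρ.length, m, by push_cast [not_lt.mp hj]; rfl, rfl, h⟩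
  · rintro (⟨j, m, rfl, rfl, h⟩ | ⟨j, m, hj, rfl, h⟩)
    · refine ⟨j, m, rfl, rfl, ?_⟩
      rw [List.getElem?_append_left (List.getElem?_eq_some_iff.mp h).1, h]
    · refine ⟨ρ.length + j, m, by push_cast; linarith, rfl, ?_⟩
      rw [List.getElem?_append_right (by omega), Nat.add_sub_cancel_left, h]

theorem eventAt_singleton {m : ℕ} {p q k c a t : ℝ} :
    EventAt [(m, p, q)] k c a t ↔ k = 0 ∧ c = m ∧ a = p ∧ t = q := by
  rw [eventAt_iff]
  constructor
  · rintro ⟨j, m', rfl, rfl, h⟩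
    rw [List.getElem?_singleton] at h
    split_ifs at h with hj
    simp only [Option.some.injEq, Prod.mk.injEq] at h
    obtain ⟨rfl, rfl, rfl⟩ := h
    simp [hj]
  · rintro ⟨rfl, rfl, rfl, rfl⟩
    exact ⟨0, m, by simp, rfl, rfl⟩

theorem not_eventAt_nil {k c a t : ℝ} : ¬ EventAt [] k c a t := by
  rw [eventAt_iff]
  rintro ⟨j, m, -, -, h⟩
  simp at h

theorem eventAt_item {τ : Trace} {x k c a t : ℝ} : EventAt (Trace.item τ x) k c a t ↔
    k = 0 ∧ ∃ f, IsFloor x f ∧ EventAt τ f c a t := by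
  unfold Trace.item IsFloor
  simp only [exists_eq_left]
  split_ifs with h
  · obtain ⟨n, hn⟩ := Int.eq_ofNat_of_zero_le h
    rw [hn, Int.toNat_natCast, Int.cast_natCast]
    rcases hτ : τ[n]? with _ | ⟨m, p, q⟩
    · simp only [Option.toList_none, not_eventAt_nil, false_iff, not_and]
      intro _ h'
      obtain ⟨j, m, hj, -, h'⟩ := eventAt_iff.mp h'
      rw [← Nat.cast_inj.mp hj, hτ] at h'
      cases h'
    · rw [Option.toList_some, eventAt_singleton, eventAt_iff]
      refine and_congr_right fun _ => ?_
      constructor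
      · rintro ⟨rfl, rfl, rfl⟩
        exact ⟨n, m, rfl, rfl, hτ⟩
      · rintro ⟨j, m', hj, rfl, h'⟩
        rw [← Nat.cast_inj.mp hj, hτ] at h'
        simp only [Option.some.injEq, Prod.mk.injEq] at h'
        obtain ⟨rfl, rfl, rfl⟩ := h'
        exact ⟨rfl, rfl, rfl⟩
  · refine iff_of_false not_eventAt_nil ?_
    rintro ⟨-, h'⟩
    obtain ⟨j, m, hj, -, -⟩ := eventAt_iff.mp h'
    refine h ?_
    have : (0 : ℝ) ≤ (⌊x⌋ : ℝ) := by rw [hj]; positivity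
    exact_mod_cast this

/-- A value computed from the last event, with `0` for the empty trace, in terms of `EventAt`. -/
theorem eq_getLast?_map_iff {τ : Trace} (F : Event → ℝ) {y : ℝ} :
    y = (τ.getLast?.map F).getD 0 ↔ (IsLength τ 0 ∧ y = 0) ∨
      ∃ l c a t, IsLength τ (l + 1) ∧ EventAt τ l c a t ∧
        ∃ m : ℕ, c = m ∧ y = F (m, a, t) := by
  unfold IsLength
  rcases List.eq_nil_or_concat τ with rfl | ⟨σ, ⟨m, p, q⟩, rfl⟩
  · simp only [List.getLast?_nil, Option.map_none, Option.getD_none, not_eventAt_nil]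
    simp
  · have hl : ∀ l : ℝ, l + 1 = ((σ ++ [(m, p, q)]).length : ℝ) ↔ l = σ.length := by
      intro l
      simp
    have h0 : ¬ ((0 : ℝ) = ((σ ++ [(m, p, q)]).length : ℝ)) := by
      simp only [List.length_append, List.length_singleton, Nat.cast_add, Nat.cast_one]
      positivity
    simp only [List.concat_eq_append] at *
    simp only [hl, h0, false_and, false_or, List.getLast?_append, List.getLast?_singleton,
      Option.some_or, Option.map_some, Option.getD_some]
    constructor
    · rintro rfl
      refine ⟨_, m, p, q, rfl, ?_, m, rfl, rfl⟩
      rw [eventAt_append, sub_self, eventAt_singleton]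
      exact .inr ⟨rfl, rfl, rfl, rfl⟩
    · rintro ⟨_, _, a, t, rfl, h, m', rfl, rfl⟩
      rw [eventAt_append, sub_self, eventAt_singleton] at h
      rcases h with h | ⟨-, hm, rfl, rfl⟩
      · exact absurd (exists_eventAt_natCast.mp ⟨_, _, _, h⟩) (lt_irrefl _)
      · rw [Nat.cast_inj.mp hm]

/-- The value of the event at position `k` of `σ` is `g`. -/
@[irreducible] def ValueAt (σ : Trace) (k g : ℝ) : Prop := ∃ c t, EventAt σ k c g t

theorem valueAt_natCast {σ : Trace} {k : ℕ} {g : ℝ} :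
    ValueAt σ k g ↔ (σ[k]?.map fun e => e.2.1) = some g := by
  unfold ValueAt
  simp only [eventAt_iff, Option.map_eq_some_iff]
  constructor
  · rintro ⟨c, t, j, m, hj, rfl, h⟩
    rw [Nat.cast_inj.mp hj]
    exact ⟨_, h, rfl⟩
  · rintro ⟨⟨m, a, t⟩, h, rfl⟩
    exact ⟨m, t, k, m, rfl, rfl, h⟩

/-- The trace `ρ` consists of the events of `τ` whose channel satisfies `B`, as witnessed by a trace
of running counts with code `(Z, n)`: its `k`-th member counts the selected events among the first
`k` events of `τ`, so it is the position in `ρ` of the `k`-th event of `τ` if that one is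
selected. -/
def IsFiltered (B : ℝ → Prop) (τ ρ : Trace) : Prop :=
  ∃ Z n l g, IsLength τ l ∧ ValueAt (decode Z n) 0 0 ∧
    (∀ k c a t, EventAt τ k c a t → ∃ g, ValueAt (decode Z n) k g ∧
      ((B c ∧ ValueAt (decode Z n) (k + 1) (g + 1) ∧ EventAt ρ g c a t) ∨
        (¬ B c ∧ ValueAt (decode Z n) (k + 1) g))) ∧
    ValueAt (decode Z n) l g ∧ IsLength ρ g

/-- The position of an event in a projection depends on how many earlier events are kept. These
running counts are the values of the events of an auxiliary trace, which again has a code. -/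
theorem eq_filter_iff {τ ρ : Trace} {p : ℕ → Bool} {B : ℝ → Prop} (hB : ∀ c : ℕ, B c ↔ p c) :
    ρ = τ.filter (fun e => p e.1) ↔ IsFiltered B τ ρ := by
  have hlen : ∀ k (hk : k < τ.length), (τ.take (k + 1)).filter (fun e => p e.1) =
      (τ.take k).filter (fun e => p e.1) ++ if p τ[k].1 then [τ[k]] else [] := by
    intro k hk
    rw [List.take_succ_eq_append_getElem hk, List.filter_append]
    congr 1
    by_cases h : p τ[k].1 <;> simp [h]
  unfold IsFiltered IsLength
  constructor
  · rintro rfl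
    obtain ⟨Z, n, hσ⟩ := decode_surjective ((List.range (τ.length + 1)).map fun k =>
      ((0, ((τ.take k).filter (fun e => p e.1)).length, 0) : Event))
    have hval : ∀ k ≤ τ.length, ValueAt (decode Z n) k
        ((τ.take k).filter (fun e => p e.1)).length := by
      intro k hk
      rw [valueAt_natCast, hσ, List.getElem?_map, List.getElem?_range (by omega)]
      rfl
    refine ⟨Z, n, _, _, rfl, by simpa using hval 0 (Nat.zero_le _), ?_, hval _ le_rfl, by simp⟩
    intro k c a t h
    obtain ⟨j, m, rfl, rfl, hget⟩ := eventAt_iff.mp h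
    obtain ⟨hj, he⟩ := List.getElem?_eq_some_iff.mp hget
    refine ⟨_, hval j hj.le, ?_⟩
    have h1 := hval (j + 1) hj
    have h2 := hlen j hj
    rw [hB]
    simp only [he] at h2
    by_cases hp : p m
    · rw [if_pos hp] at h2
      refine .inl ⟨hp, by simpa [h2] using h1, eventAt_natCast.mpr ?_⟩
      conv_lhs => rw [← List.take_append_drop (j + 1) τ, List.filter_append, h2]
      simp
    · rw [if_neg hp] at h2
      exact .inr ⟨hp, by simpa [h2] using h1⟩
  · rintro ⟨Z, n, _, _, rfl, h0, hstep, hl, hρ⟩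
    have key : ∀ k ≤ τ.length, ValueAt (decode Z n) k
        ((τ.take k).filter (fun e => p e.1)).length ∧
        ρ.take ((τ.take k).filter (fun e => p e.1)).length =
          (τ.take k).filter (fun e => p e.1) := by
      intro k
      induction k with
      | zero => simpa using h0
      | succ k ih =>
        intro hk
        obtain ⟨h1, h2⟩ := ih (by omega)
        obtain ⟨g, hg, h⟩ := hstep k (τ[k].1 : ℕ) τ[k].2.1 τ[k].2.2
          (eventAt_natCast.mpr (List.getElem?_eq_getElem (show k < τ.length by omega)))
        rw [valueAt_natCast] at h1 hg
        obtain rfl : ((τ.take k).filter (fun e => p e.1)).length = g :=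
          Option.some_inj.mp (h1.symm.trans hg)
        rw [hlen k (by omega)]
        rw [hB] at h
        push_cast
        rcases h with ⟨hp, hv, hev⟩ | ⟨hp, hv⟩
        · rw [if_pos hp]
          refine ⟨by simpa using hv, ?_⟩
          obtain ⟨hi, hev⟩ := List.getElem?_eq_some_iff.mp (eventAt_natCast.mp hev)
          rw [List.length_append, List.length_singleton, List.take_succ_eq_append_getElem hi, h2,
            hev]
        · rw [if_neg hp]
          simpa using ⟨hv, h2⟩
    obtain ⟨h1, h2⟩ := key _ le_rfl
    rw [valueAt_natCast] at h1 hl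
    have hlen' := Option.some_inj.mp (h1.symm.trans hl)
    rw [hρ, Nat.cast_inj, List.take_length] at hlen'
    rw [List.take_length, hlen', List.take_length] at h2
    exact h2

/-- The binary digit of the number `m` of weight `2 ^ c` is one. -/
@[irreducible] def HasBit (m c : ℝ) : Prop := IsDigit m (-c) 1

theorem hasBit_natCast {m c : ℕ} : HasBit m c ↔ m.testBit c := by
  unfold HasBit
  have e : (-(c : ℝ)) = ((-(c : ℤ) : ℤ) : ℝ) := by push_cast; rfl
  rw [e, isDigit_intCast, binDigit, Nat.testBit_eq_decide_div_mod_eq, decide_eq_true_iff]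
  have h := Int.floor_div_natCast (m : ℝ) (2 ^ c)
  rw [Int.floor_natCast] at h
  rw [zpow_neg, zpow_natCast, mul_comm, ← div_eq_mul_inv]
  push_cast at h
  rw [h]
  norm_cast
  exact eq_comm

namespace Dfn

variable {f g a c k m : (ℕ → ℝ) → ℝ}

theorem isLength (hf : IsPolyFun f) (hg : IsPolyFun g) (hk : IsPolyFun k) :
    Dfn fun v => IsLength (decode (f v) (g v)) (k v) := by
  simp only [isLength_iff]
  apply_rules (maxDepth := 200) [all, iff, imp, ex, Dfn.and, isNatural, eventAt, lt,
    IsPolyFun.var, hf.reindex, hg.reindex, hk.reindex]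

theorem valueAt (hf : IsPolyFun f) (hg : IsPolyFun g) (hk : IsPolyFun k) (ha : IsPolyFun a) :
    Dfn fun v => ValueAt (decode (f v) (g v)) (k v) (a v) := by
  unfold ValueAt
  apply_rules [ex, eventAt, IsPolyFun.var, hf.reindex, hg.reindex, hk.reindex, ha.reindex]

theorem hasBit (hm : IsPolyFun m) (hc : IsPolyFun c) : Dfn fun v => HasBit (m v) (c v) := by
  unfold HasBit
  exact isDigit hm hc.neg .one

/-- Quantification over natural numbers is definable. -/
theorem exNat {S : (ℕ → ℝ) → ℕ → Prop} {R : (ℕ → ℝ) → ℝ → Prop} (hRS : ∀ v n, S v n ↔ R v n)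
    (h : Dfn fun v => R (fun i => v (i + 1)) (v 0)) (hf : IsPolyFun f) :
    Dfn fun v => ∃ n : ℕ, f v = n ∧ S v n := by
  refine congr (S := fun v => IsNatural (f v) ∧ ∃ x, f v = x ∧ R v x) (fun v => ?_)
    (.and (isNatural hf) (.ex (.and (.eq (hf.reindex _) (.var 0)) h)))
  unfold IsNatural
  simp only [exists_eq_left', hRS]
  exact ⟨fun ⟨n, h, h'⟩ => ⟨⟨n, h⟩, h ▸ h'⟩, fun ⟨⟨n, h⟩, h'⟩ => ⟨n, h, h ▸ h'⟩⟩

theorem trace_eq : Dfn fun v => decode (v 0) (v 1) = decode (v 2) (v 3) := by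
  simp only [trace_eq_iff]
  apply_rules (maxDepth := 200) [all, iff, eventAt, IsPolyFun.var]

theorem trace_prefix : Dfn fun v => decode (v 2) (v 3) <+: decode (v 4) (v 5) := by
  simp only [trace_prefix_iff]
  apply_rules (maxDepth := 200) [all, imp, eventAt, IsPolyFun.var]

theorem trace_append :
    Dfn fun v => decode (v 0) (v 1) = decode (v 2) (v 3) ++ decode (v 4) (v 5) := by
  refine congr (S := fun v => ∃ l, IsLength (decode (v 2) (v 3)) l ∧ ∀ k c a t,
    EventAt (decode (v 0) (v 1)) k c a t ↔ EventAt (decode (v 2) (v 3)) k c a t ∨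
      EventAt (decode (v 4) (v 5)) (k - l) c a t) (fun v => ?_) ?_
  · unfold IsLength
    simp only [trace_eq_iff, eventAt_append, exists_eq_left]
  · apply_rules (maxDepth := 200) [ex, all, iff, Dfn.and, Dfn.or, eventAt, isLength,
      IsPolyFun.var, IsPolyFun.sub]

theorem trace_item : Dfn fun v => decode (v 0) (v 1) = Trace.item (decode (v 2) (v 3)) (v 4) := by
  simp only [trace_eq_iff, eventAt_item]
  apply_rules (maxDepth := 200) [ex, all, iff, Dfn.and, Dfn.eq, eventAt, isFloor,
      IsPolyFun.var, IsPolyFun.zero]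

theorem trace_empty : Dfn fun v => decode (v 0) (v 1) = [] := by
  simp only [trace_eq_iff, not_eventAt_nil, iff_false]
  apply_rules (maxDepth := 200) [all, Dfn.not, eventAt, IsPolyFun.var]

theorem trace_event :
    Dfn fun v => ∃ m : ℕ, v 2 = m ∧ decode (v 0) (v 1) = [(m, v 4, v 5)] := by
  refine exNat (R := fun v m => ∀ k c a t, EventAt (decode (v 0) (v 1)) k c a t ↔
    k = 0 ∧ c = m ∧ a = v 4 ∧ t = v 5) (fun v n => ?_) ?_ (.var 2)
  · simp only [trace_eq_iff, eventAt_singleton]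
  · apply_rules (maxDepth := 200) [all, iff, Dfn.and, Dfn.eq, eventAt, IsPolyFun.var,
      IsPolyFun.zero]

theorem trace_keep : Dfn fun v => ∃ m : ℕ, v 4 = m ∧
    decode (v 0) (v 1) = (decode (v 2) (v 3)).filter fun e => m.testBit e.1 := by
  refine exNat (R := fun v x => IsFiltered (HasBit x) (decode (v 2) (v 3)) (decode (v 0) (v 1)))
    (fun v n => eq_filter_iff fun c => hasBit_natCast) ?_ (.var 4)
  unfold IsFiltered
  apply_rules (maxDepth := 200) [Dfn.not, ex, all, Dfn.and, Dfn.or, imp, eventAt, valueAt,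
    isLength, hasBit, IsPolyFun.var, IsPolyFun.zero, IsPolyFun.one, IsPolyFun.add]

theorem trace_drop : Dfn fun v => ∃ m : ℕ, v 4 = m ∧
    decode (v 0) (v 1) = (decode (v 2) (v 3)).filter fun e => !m.testBit e.1 := by
  refine exNat (R := fun v x => IsFiltered (fun c => ¬ HasBit x c) (decode (v 2) (v 3))
    (decode (v 0) (v 1))) (fun v n => eq_filter_iff (p := fun c => !n.testBit c) fun c => by
      simp [hasBit_natCast]) ?_ (.var 4)
  unfold IsFiltered
  apply_rules (maxDepth := 200) [Dfn.not, ex, all, Dfn.and, Dfn.or, imp, eventAt, valueAt,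
    isLength, hasBit, IsPolyFun.var, IsPolyFun.zero, IsPolyFun.one, IsPolyFun.add]

theorem trace_length : Dfn fun v => v 0 = (decode (v 2) (v 3)).length := by
  have h : Dfn fun v => IsLength (decode (v 2) (v 3)) (v 0) := isLength (.var 2) (.var 3) (.var 0)
  unfold IsLength at h
  exact h

theorem trace_lastChan : Dfn fun v => v 0 = (decode (v 2) (v 3)).lastChan := by
  refine congr (S := fun v => (IsLength (decode (v 2) (v 3)) 0 ∧ v 0 = 0) ∨ ∃ l a t,
    IsLength (decode (v 2) (v 3)) (l + 1) ∧ EventAt (decode (v 2) (v 3)) l (v 0) a t)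
    (fun v => (eq_getLast?_map_iff _).trans (or_congr_right ?_)) ?_
  · constructor
    · rintro ⟨l, c, a, t, h, h', m, rfl, e⟩
      exact ⟨l, a, t, h, by rwa [e]⟩
    · rintro ⟨l, a, t, h, h'⟩
      obtain ⟨j, m, hj, hm, -⟩ := eventAt_iff.mp h'
      exact ⟨l, _, a, t, h, h', m, hm, hm⟩
  · apply_rules (maxDepth := 200) [ex, Dfn.and, Dfn.or, Dfn.eq, eventAt, isLength, IsPolyFun.var,
      IsPolyFun.zero, IsPolyFun.one, IsPolyFun.add]

theorem trace_lastVal : Dfn fun v => v 0 = (decode (v 2) (v 3)).lastVal := by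
  refine congr (S := fun v => (IsLength (decode (v 2) (v 3)) 0 ∧ v 0 = 0) ∨ ∃ l c t,
    IsLength (decode (v 2) (v 3)) (l + 1) ∧ EventAt (decode (v 2) (v 3)) l c (v 0) t)
    (fun v => (eq_getLast?_map_iff _).trans (or_congr_right ?_)) ?_
  · constructor
    · rintro ⟨l, c, a, t, h, h', m, rfl, e⟩
      exact ⟨l, m, t, h, by rwa [e]⟩
    · rintro ⟨l, c, t, h, h'⟩
      obtain ⟨j, m, hj, hm, -⟩ := eventAt_iff.mp h'
      exact ⟨l, c, _, t, h, h', m, hm, rfl⟩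
  · apply_rules (maxDepth := 200) [ex, Dfn.and, Dfn.or, Dfn.eq, eventAt, isLength, IsPolyFun.var,
      IsPolyFun.zero, IsPolyFun.one, IsPolyFun.add]

theorem trace_lastTime : Dfn fun v => v 0 = (decode (v 2) (v 3)).lastTime := by
  refine congr (S := fun v => (IsLength (decode (v 2) (v 3)) 0 ∧ v 0 = 0) ∨ ∃ l c a,
    IsLength (decode (v 2) (v 3)) (l + 1) ∧ EventAt (decode (v 2) (v 3)) l c a (v 0))
    (fun v => (eq_getLast?_map_iff _).trans (or_congr_right ?_)) ?_
  · constructor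
    · rintro ⟨l, c, a, t, h, h', m, rfl, e⟩
      exact ⟨l, m, a, h, by rwa [e]⟩
    · rintro ⟨l, c, a, h, h'⟩
      obtain ⟨j, m, hj, hm, -⟩ := eventAt_iff.mp h'
      exact ⟨l, c, a, _, h, h', m, hm, rfl⟩
  · apply_rules (maxDepth := 200) [ex, Dfn.and, Dfn.or, Dfn.eq, eventAt, isLength, IsPolyFun.var,
      IsPolyFun.zero, IsPolyFun.one, IsPolyFun.add]

end Dfn

/-! ### Coincidence -/

/-- For differential terms, only variables below the bound contribute to the sum. -/
theorem Poly.eval_congr (p : Poly) {ρ ρ' : RVar → ℝ}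
    (h : ∀ x : RVar, x.index < p.bound → ρ x = ρ' x) : p.eval ρ = p.eval ρ' := by
  induction p generalizing ρ ρ' with
  | var x => exact h x (Nat.lt_succ_self _)
  | rat q => rfl
  | add p q ih ih' =>
    rw [eval, eval, ih fun x hx => h x (lt_max_of_lt_left hx),
      ih' fun x hx => h x (lt_max_of_lt_right hx)]
  | mul p q ih ih' =>
    rw [eval, eval, ih fun x hx => h x (lt_max_of_lt_left hx),
      ih' fun x hx => h x (lt_max_of_lt_right hx)]
  | diff p ih =>
    rw [eval, eval]
    refine finsum_congr fun n => ?_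
    by_cases hn : n < p.bound
    · rw [h (.prime n) hn, h (.base n) hn]
      congr 2
      funext r
      refine ih fun x hx => ?_
      by_cases hxn : x = .base n
      · subst hxn; simp
      · simp [hxn, h x hx]
    · -- A variable that does not occur contributes a derivative of a constant.
      have key : ∀ ρ : RVar → ℝ, (fun r => p.eval (Function.update ρ (.base n) r)) =
          fun _ => p.eval ρ := by
        intro ρ
        funext r
        refine ih fun x hx => ?_
        rw [Function.update_of_ne]
        rintro rfl
        exact hn hx
      rw [key, key]
      simp

/-- `F v` depends only on the real variables with a name below `b` and on finitely many trace
variables. -/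
def FinitelyDependent {α : Sort*} (b : ℕ) (F : State → α) : Prop :=
  ∃ K : ℕ, ∀ v v' : State, (∀ x : RVar, x.index < b → v.real x = v'.real x) →
    (∀ t < K, v.trace t = v'.trace t) → F v = F v'

namespace FinitelyDependent

variable {α β γ : Sort*} {b c : ℕ} {F : State → α} {G : State → β}

theorem map (hF : FinitelyDependent b F) (f : α → γ) : FinitelyDependent b fun v => f (F v) :=
  let ⟨K, h⟩ := hF
  ⟨K, fun v v' hr ht => congrArg f (h v v' hr ht)⟩

theorem map₂ (hF : FinitelyDependent b F) (hG : FinitelyDependent c G) (f : α → β → γ) :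
    FinitelyDependent (max b c) fun v => f (F v) (G v) :=
  let ⟨K, h⟩ := hF
  let ⟨K', h'⟩ := hG
  ⟨max K K', fun v v' hr ht => congrArg₂ f
    (h v v' (fun x hx => hr x (lt_max_of_lt_left hx)) fun t hx => ht t (lt_max_of_lt_left hx))
    (h' v v' (fun x hx => hr x (lt_max_of_lt_right hx)) fun t hx => ht t (lt_max_of_lt_right hx))⟩

theorem of_real {F : (RVar → ℝ) → α}
    (h : ∀ ρ ρ' : RVar → ℝ, (∀ x : RVar, x.index < b → ρ x = ρ' x) → F ρ = F ρ') :
    FinitelyDependent b fun v => F v.real :=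
  ⟨0, fun _ _ hr _ => h _ _ hr⟩

end FinitelyDependent

theorem Poly.finitelyDependent (p : Poly) : FinitelyDependent p.bound fun v => p.eval v.real :=
  .of_real fun _ _ => p.eval_congr

mutual

theorem RTerm.finitelyDependent : ∀ a : RTerm, FinitelyDependent a.bound a.eval
  | .var x => (Poly.var x).finitelyDependent
  | .rat q => (Poly.rat q).finitelyDependent
  | .add a b => a.finitelyDependent.map₂ b.finitelyDependent (· + ·)
  | .mul a b => a.finitelyDependent.map₂ b.finitelyDependent (· * ·)
  | .diff p => (Poly.diff p).finitelyDependent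
  | .chan e => e.finitelyDependent.map Trace.lastChan
  | .val e => e.finitelyDependent.map Trace.lastVal
  | .time e => e.finitelyDependent.map Trace.lastTime
  | .len e => e.finitelyDependent.map fun τ => (τ.length : ℝ)

theorem TTerm.finitelyDependent : ∀ e : TTerm, FinitelyDependent e.bound e.eval
  | .var t => ⟨t + 1, fun _ _ _ h => h t (Nat.lt_succ_self _)⟩
  | .empty => ⟨0, fun _ _ _ _ => rfl⟩
  | .event c p q => p.finitelyDependent.map₂ q.finitelyDependent fun a b => [(c, a, b)]
  | .concat e f => e.finitelyDependent.map₂ f.finitelyDependent (· ++ ·)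
  | .proj e C => e.finitelyDependent.map fun τ : Trace => τ.filter fun ev : Event => C.has ev.1
  | .item e a => e.finitelyDependent.map₂ a.finitelyDependent Trace.item

end

theorem update_congr {ρ ρ' : RVar → ℝ} {N : ℕ} {x y : RVar} (r : ℝ)
    (h : y.index < N → ρ y = ρ' y) (hy : y.index < N) :
    Function.update ρ x r y = Function.update ρ' x r y := by
  by_cases hxy : y = x
  · subst hxy; simp
  · simp [hxy, h hy]

theorem FolRA.sat_congr (χ : FolRA) {ρ ρ' : RVar → ℝ}
    (h : ∀ x : RVar, x.index < χ.bound → ρ x = ρ' x) : χ.Sat ρ ↔ χ.Sat ρ' := by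
  induction χ generalizing ρ ρ' with
  | eq p q =>
    rw [Sat, Sat, p.eval_congr fun x hx => h x (lt_max_of_lt_left hx),
      q.eval_congr fun x hx => h x (lt_max_of_lt_right hx)]
  | ge p q =>
    rw [Sat, Sat, p.eval_congr fun x hx => h x (lt_max_of_lt_left hx),
      q.eval_congr fun x hx => h x (lt_max_of_lt_right hx)]
  | not χ ih => rw [Sat, Sat, ih h]
  | and χ ξ ih ih' =>
    rw [Sat, Sat, ih fun x hx => h x (lt_max_of_lt_left hx),
      ih' fun x hx => h x (lt_max_of_lt_right hx)]
  | all x χ ih =>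
    exact forall_congr' fun r => ih fun y hy =>
      update_congr r (fun hy => h y (lt_max_of_lt_right hy)) hy

theorem ODE.bound_spec (o : ODE) {e : ℕ × Poly} (he : e ∈ o.eqs) :
    e.1 < o.bound ∧ e.2.bound ≤ o.bound := by
  have key : ∀ l : List (ℕ × Poly), e ∈ l →
      max (e.1 + 1) e.2.bound ≤ (l.map fun e => max (e.1 + 1) e.2.bound).foldr max 0 := by
    intro l
    induction l with
    | nil => simp
    | cons f l ih =>
      intro h
      rw [List.map_cons, List.foldr_cons]
      rcases List.mem_cons.mp h with rfl | h
      · exact le_max_left _ _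
      · exact (ih h).trans (le_max_right _ _)
  have := max_le_iff.mp (key _ he)
  exact ⟨this.1, this.2⟩

/-- A solution stays one when variables that do not occur in the system are given other constant
values. -/
theorem ODE.reach_congr (o : ODE) {N : ℕ} (hN : o.bound ≤ N) {ρ ρ' ω : RVar → ℝ}
    (h : ∀ x : RVar, x.index < N → ρ x = ρ' x) (hω : o.Reach ρ ω) :
    ∃ ω', o.Reach ρ' ω' ∧ ∀ x : RVar, x.index < N → ω x = ω' x := by
  obtain ⟨d, Φ, hd, hi, hs, rfl⟩ := hω
  refine ⟨_, ⟨d, fun s y => if y.index < N then Φ s y else ρ' y, hd, ?_,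
    fun s hs' => ⟨?_, ?_⟩, rfl⟩, fun x hx => by simp [hx]⟩
  · intro y hy
    by_cases hyN : y.index < N
    · simp [hyN, hi y hy, h y hyN]
    · simp [hyN]
  · intro y hy
    by_cases hyN : y.index < N
    · simp [hyN, (hs s hs').1 y hy]
    · simp [hyN]
  · intro e he
    have hb : e.1 < N := (o.bound_spec he).1.trans_le hN
    have h1 : (RVar.base e.1).index < N := hb
    have h2 : (RVar.prime e.1).index < N := hb
    simp only [h1, h2, if_true]
    obtain ⟨h3, h4⟩ := (hs s hs').2 e he
    refine ⟨h3.trans (e.2.eval_congr fun x hx => ?_), h4⟩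
    have := hx.trans_le ((o.bound_spec he).2.trans hN)
    simp [this]

theorem ODE.reach_exists_congr (o : ODE) (χ : FolRA) {ρ ρ' : RVar → ℝ}
    (h : ∀ x : RVar, x.index < max o.bound χ.bound → ρ x = ρ' x) :
    (∃ ω, o.Reach ρ ω ∧ χ.Sat ω) ↔ ∃ ω, o.Reach ρ' ω ∧ χ.Sat ω := by
  have key : ∀ ρ ρ' : RVar → ℝ, (∀ x : RVar, x.index < max o.bound χ.bound → ρ x = ρ' x) →
      (∃ ω, o.Reach ρ ω ∧ χ.Sat ω) → ∃ ω, o.Reach ρ' ω ∧ χ.Sat ω := by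
    rintro ρ ρ' h ⟨ω, hω, H⟩
    obtain ⟨ω', hω', hag⟩ := o.reach_congr (le_max_left _ _) h hω
    exact ⟨ω', hω', (χ.sat_congr fun x hx => hag x (lt_max_of_lt_right hx)).mp H⟩
  exact ⟨key _ _ h, key _ _ fun x hx => (h x hx).symm⟩

theorem Formula.finitelyDependent (φ : Formula) : FinitelyDependent φ.bound φ.Sat := by
  induction φ with
  | realEq a b => exact a.finitelyDependent.map₂ b.finitelyDependent (· = ·)
  | realGe a b => exact a.finitelyDependent.map₂ b.finitelyDependent (· ≥ ·)
  | traceEq e f => exact e.finitelyDependent.map₂ f.finitelyDependent (· = ·)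
  | tracePrefix e f => exact e.finitelyDependent.map₂ f.finitelyDependent (· <+: ·)
  | not φ ih => exact ih.map Not
  | and φ ψ ih ih' => exact ih.map₂ ih' And
  | allReal x φ ih =>
    obtain ⟨K, h⟩ := ih
    exact ⟨K, fun v v' hr ht => forall_congr fun r => h _ _ (fun y hy =>
      update_congr r (fun hy => hr y (lt_max_of_lt_right hy)) hy) ht⟩
  | allTrace t φ ih =>
    obtain ⟨K, h⟩ := ih
    refine ⟨K, fun v v' hr ht => forall_congr fun τ => h _ _ hr fun s hs => ?_⟩
    by_cases hst : s = t
    · subst hst; simp [State.setTrace]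
    · simp [State.setTrace, hst, ht s hs]
  | box o χ =>
    refine .of_real (F := fun ρ => ∀ ω, o.Reach ρ ω → χ.Sat ω) fun ρ ρ' h => propext ?_
    have := not_congr (o.reach_exists_congr (.not χ) h)
    simpa [FolRA.Sat] using this
  | dia o χ =>
    exact .of_real (F := fun ρ => ∃ ω, o.Reach ρ ω ∧ χ.Sat ω) fun ρ ρ' h =>
      propext (o.reach_exists_congr χ h)

/-- Only finitely many trace variables matter for a formula, so that changes to the others and to
those that are not free do not affect its truth. -/
theorem Formula.sat_congr_freeTVars (φ : Formula) {v v' : State}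
    (hr : ∀ x : RVar, x.index < φ.bound → v.real x = v'.real x)
    (ht : ∀ t ∈ φ.freeTVars, v.trace t = v'.trace t) : φ.Sat v ↔ φ.Sat v' := by
  obtain ⟨K, h⟩ := φ.finitelyDependent
  -- The first `K` trace variables are changed one at a time: changing one that is not free
  -- preserves truth by the definition of freeness, in any state.
  have key : ∀ n, φ.Sat v ↔ φ.Sat ⟨v.real, fun t => if t < n then v'.trace t else v.trace t⟩ := by
    intro n
    induction n with
    | zero => simp
    | succ n ih =>
      rw [ih]
      have e : (⟨v.real, fun t => if t < n + 1 then v'.trace t else v.trace t⟩ : State) =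
          State.setTrace ⟨v.real, fun t => if t < n then v'.trace t else v.trace t⟩ n
            (v'.trace n) := by
        ext1
        · rfl
        · funext t
          rcases lt_trichotomy t n with h | rfl | h
          · simp [State.setTrace, h, h.ne, h.le]
          · simp [State.setTrace]
          · simp [State.setTrace, h.ne', not_le.mpr h, not_lt.mpr h.le]
      by_cases hn : n ∈ φ.freeTVars
      · rw [e]
        have e' : ∀ u : State, u.trace n = v'.trace n → u.setTrace n (v'.trace n) = u := by
          intro u hu
          rw [State.setTrace, ← hu, Function.update_eq_self]
        rw [e']
        simp [ht n hn]
      · rw [e]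
        by_contra hne
        exact hn ⟨_, _, hne⟩
  rw [key K]
  exact iff_of_eq (h _ _ hr fun t htK => by simp [htK])

/-! ### The translation -/

/-- The operations on reals and traces that the translation expresses by fixed formulas. -/
inductive Op where
  | add | mul | chan | val | time | len
  | same | empty | event | concat | keep | drop | item
  | realEq | realGe | traceEq | tracePrefix

/-- The relation between the result `r` and the arguments `a` and `b` of an operation. A trace is
represented by a code and a length, a real by the first of two reals. Operations may ignore
arguments, and atomic formulas ignore the result. The channels in a projection `keep` or `drop` are
the positions of the ones among the binary digits of a number, and the channel of `event` is the
first argument, so that finitely many operations suffice. -/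
def Op.Rel : Op → (r₀ r₁ a₀ a₁ b₀ b₁ : ℝ) → Prop
  | .add, r₀, _, a₀, _, b₀, _ => r₀ = a₀ + b₀
  | .mul, r₀, _, a₀, _, b₀, _ => r₀ = a₀ * b₀
  | .chan, r₀, _, a₀, a₁, _, _ => r₀ = (decode a₀ a₁).lastChan
  | .val, r₀, _, a₀, a₁, _, _ => r₀ = (decode a₀ a₁).lastVal
  | .time, r₀, _, a₀, a₁, _, _ => r₀ = (decode a₀ a₁).lastTime
  | .len, r₀, _, a₀, a₁, _, _ => r₀ = (decode a₀ a₁).length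
  | .same, r₀, r₁, a₀, a₁, _, _ => decode r₀ r₁ = decode a₀ a₁
  | .empty, r₀, r₁, _, _, _, _ => decode r₀ r₁ = []
  | .event, r₀, r₁, a₀, _, b₀, b₁ => ∃ m : ℕ, a₀ = m ∧ decode r₀ r₁ = [(m, b₀, b₁)]
  | .concat, r₀, r₁, a₀, a₁, b₀, b₁ => decode r₀ r₁ = decode a₀ a₁ ++ decode b₀ b₁
  | .keep, r₀, r₁, a₀, a₁, b₀, _ => ∃ m : ℕ, b₀ = m ∧
      decode r₀ r₁ = (decode a₀ a₁).filter fun e => m.testBit e.1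
  | .drop, r₀, r₁, a₀, a₁, b₀, _ => ∃ m : ℕ, b₀ = m ∧
      decode r₀ r₁ = (decode a₀ a₁).filter fun e => !m.testBit e.1
  | .item, r₀, r₁, a₀, a₁, b₀, _ => decode r₀ r₁ = Trace.item (decode a₀ a₁) b₀
  | .realEq, _, _, a₀, _, b₀, _ => a₀ = b₀
  | .realGe, _, _, a₀, _, b₀, _ => b₀ ≤ a₀
  | .traceEq, _, _, a₀, a₁, b₀, b₁ => decode a₀ a₁ = decode b₀ b₁
  | .tracePrefix, _, _, a₀, a₁, b₀, b₁ => decode a₀ a₁ <+: decode b₀ b₁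

theorem Op.dfn_rel : ∀ o : Op, Dfn fun v => o.Rel (v 0) (v 1) (v 2) (v 3) (v 4) (v 5)
  | .add => .eq (.var 0) (.add (.var 2) (.var 4))
  | .mul => .eq (.var 0) (.mul (.var 2) (.var 4))
  | .chan => Dfn.trace_lastChan
  | .val => Dfn.trace_lastVal
  | .time => Dfn.trace_lastTime
  | .len => Dfn.trace_length
  | .same => Dfn.trace_eq
  | .empty => Dfn.trace_empty
  | .event => Dfn.trace_event
  | .concat => Dfn.trace_append
  | .keep => Dfn.trace_keep
  | .drop => Dfn.trace_drop
  | .item => Dfn.trace_item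
  | .realEq => .eq (.var 2) (.var 4)
  | .realGe => .le (.var 4) (.var 2)
  | .traceEq => Dfn.trace_eq.subst (g := fun i v => v (i + 2)) fun i => .var (i + 2)
  | .tracePrefix => Dfn.trace_prefix

/-- The fixed formula that expresses an operation, with result and arguments in the first six
differential variables. It exists by the definability of the operation; as there are only finitely
many operations, the choice of their formulas does not affect computability. -/
noncomputable def Op.formula (o : Op) : Formula :=
  (o.dfn_rel.exists_formula 6 (fun i => min i 5) fun i => by simp).choose

theorem Op.isFOD_formula (o : Op) : o.formula.IsFOD :=
  (o.dfn_rel.exists_formula 6 (fun i => min i 5) fun i => by simp).choose_spec.1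

theorem Op.sat_formula (o : Op) (w : State) : o.formula.Sat w ↔
    o.Rel (w.real (.prime 0)) (w.real (.prime 1)) (w.real (.prime 2)) (w.real (.prime 3))
      (w.real (.prime 4)) (w.real (.prime 5)) :=
  (o.dfn_rel.exists_formula 6 (fun i => min i 5) fun i => by simp).choose_spec.2 w

/-- The auxiliary variables for formulas with variable names below `N`. They are differential
variables, and so differ from the representants of trace variables. -/
def auxVar (N i : ℕ) : RVar := .prime (N + 6 + i)

/-- Application of an operation to arguments that are specified by formulas. A specification has
the specified value in the first two auxiliary variables. The values of the arguments are kept in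
the four following ones and are copied to the variables that the formula of the operation expects.
That formula may overwrite variables of the formula to be translated, which is harmless because the
specifications of the arguments lie outside the scope of these assignments. -/
noncomputable def Op.apply (N : ℕ) (o : Op) (A B : Formula) : Formula :=
  .exReal (auxVar N 2) <| .exReal (auxVar N 3) <| .exReal (auxVar N 4) <| .exReal (auxVar N 5) <|
  .and
    (.and
      (.letReal (auxVar N 0) (.var (auxVar N 2)) <| .letReal (auxVar N 1) (.var (auxVar N 3)) A)
      (.letReal (auxVar N 0) (.var (auxVar N 4)) <| .letReal (auxVar N 1) (.var (auxVar N 5)) B))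
    (.letReal (.prime 0) (.var (auxVar N 0)) <| .letReal (.prime 1) (.var (auxVar N 1)) <|
      .letReal (.prime 2) (.var (auxVar N 2)) <| .letReal (.prime 3) (.var (auxVar N 3)) <|
      .letReal (.prime 4) (.var (auxVar N 4)) <| .letReal (.prime 5) (.var (auxVar N 5)) o.formula)

/-- The formula `A` specifies the values that satisfy `P`, in every state that differs from `ρ` in
auxiliary variables only. -/
def Specifies (N : ℕ) (ρ : RVar → ℝ) (A : Formula) (P : ℝ → ℝ → Prop) : Prop :=
  ∀ w : State, (∀ x : RVar, (∀ i, x ≠ auxVar N i) → w.real x = ρ x) →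
    (A.Sat w ↔ P (w.real (auxVar N 0)) (w.real (auxVar N 1)))

theorem auxVar_inj {N i j : ℕ} : auxVar N i = auxVar N j ↔ i = j := by simp [auxVar]

theorem sat_letReal_var {x y : RVar} (h : y ≠ x) {φ : Formula} {w : State} :
    (Formula.letReal x (.var y) φ).Sat w ↔ φ.Sat (w.setReal x (w.real y)) :=
  Formula.sat_letReal fun r => by simp [RTerm.eval, h]

/-- The specification of the result is the composition of the relation of the operation with the
specifications of the arguments. -/
theorem Op.specifies_apply {N : ℕ} {ρ : RVar → ℝ} {o : Op} {A B : Formula}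
    {P Q R : ℝ → ℝ → Prop} (hA : Specifies N ρ A P) (hB : Specifies N ρ B Q)
    (h : ∀ r₀ r₁, R r₀ r₁ ↔
      ∃ a₀ a₁ b₀ b₁, (P a₀ a₁ ∧ Q b₀ b₁) ∧ o.Rel r₀ r₁ a₀ a₁ b₀ b₁) :
    Specifies N ρ (o.apply N A B) R := by
  intro w hw
  have hne : ∀ i j, i < 6 → auxVar N j ≠ .prime i := fun i j hi h => by
    simp only [auxVar, RVar.prime.injEq] at h
    omega
  have hset : ∀ {w : State}, (∀ x : RVar, (∀ i, x ≠ auxVar N i) → w.real x = ρ x) →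
      ∀ i r x, (∀ i, x ≠ auxVar N i) → (w.setReal (auxVar N i) r).real x = ρ x :=
    fun hw i r x hx => by rw [State.setReal_real, Function.update_of_ne (hx i), hw x hx]
  simp only [h, Op.apply, Formula.sat_exReal]
  refine exists_congr fun a₀ => exists_congr fun a₁ => exists_congr fun b₀ =>
    exists_congr fun b₁ => ?_
  have hw' := hset (hset (hset (hset hw 2 a₀) 3 a₁) 4 b₀) 5 b₁
  rw [Formula.Sat, Formula.Sat, sat_letReal_var (by simp [auxVar_inj]),
    sat_letReal_var (by simp [auxVar_inj]), sat_letReal_var (by simp [auxVar_inj]),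
    sat_letReal_var (by simp [auxVar_inj]), hA _ (hset (hset hw' _ _) _ _),
    hB _ (hset (hset hw' _ _) _ _), sat_letReal_var (hne _ _ (by norm_num)),
    sat_letReal_var (hne _ _ (by norm_num)), sat_letReal_var (hne _ _ (by norm_num)),
    sat_letReal_var (hne _ _ (by norm_num)), sat_letReal_var (hne _ _ (by norm_num)),
    sat_letReal_var (hne _ _ (by norm_num)), Op.sat_formula]
  simp [auxVar_inj, hne]

/-- A polynomial as a real term. -/
def Poly.toRTerm : Poly → RTerm
  | .var x => .var x
  | .rat q => .rat q
  | .add p q => .add p.toRTerm q.toRTerm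
  | .mul p q => .mul p.toRTerm q.toRTerm
  | .diff p => .diff p

theorem Poly.eval_toRTerm (p : Poly) (w : State) : p.toRTerm.eval w = p.eval w.real := by
  induction p with
  | var x => rfl
  | rat q => rfl
  | add p q ih ih' => rw [toRTerm, RTerm.eval, ih, ih', eval]
  | mul p q ih ih' => rw [toRTerm, RTerm.eval, ih, ih', eval]
  | diff p => rfl

theorem Poly.isPoly_toRTerm (p : Poly) : p.toRTerm.IsPoly := by
  induction p with
  | add p q ih ih' => exact ⟨ih, ih'⟩
  | mul p q ih ih' => exact ⟨ih, ih'⟩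
  | _ => trivial

/-- The number whose binary digits of weight one are at the positions of a list. -/
def bitMask (l : List ℕ) : ℕ :=
  l.foldr (fun c m => if m / 2 ^ c % 2 = 1 then m else m + 2 ^ c) 0

theorem testBit_add_two_pow {m c : ℕ} (h : m / 2 ^ c % 2 ≠ 1) (j : ℕ) :
    (m + 2 ^ c).testBit j = (decide (j = c) || m.testBit j) := by
  have hc : m.testBit c = false := by simpa [Nat.testBit_eq_decide_div_mod_eq] using h
  rcases lt_trichotomy j c with hj | rfl | hj
  · rw [add_comm, Nat.testBit_two_pow_add_gt hj]
    simp [hj.ne]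
  · rw [add_comm, Nat.testBit_two_pow_add_eq, hc]
    simp
  · have h0 : m / 2 ^ c % 2 = 0 := by omega
    have key : (m + 2 ^ c) / 2 ^ (c + 1) = m / 2 ^ (c + 1) := by
      rw [pow_succ, ← Nat.div_div_eq_div_mul, ← Nat.div_div_eq_div_mul,
        Nat.add_div_right _ (by positivity)]
      omega
    obtain ⟨k, rfl⟩ : ∃ k, j = c + 1 + k := ⟨j - (c + 1), by omega⟩
    have hne : c + 1 + k ≠ c := by omega
    rw [Nat.testBit_eq_decide_div_mod_eq, Nat.testBit_eq_decide_div_mod_eq, pow_add 2 (c + 1) k,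
      ← Nat.div_div_eq_div_mul, ← Nat.div_div_eq_div_mul, key]
    simp [hne]

theorem testBit_bitMask (l : List ℕ) (j : ℕ) : (bitMask l).testBit j = decide (j ∈ l) := by
  induction l generalizing j with
  | nil => simp [bitMask]
  | cons c l ih =>
    change Nat.testBit (if bitMask l / 2 ^ c % 2 = 1 then bitMask l else bitMask l + 2 ^ c) j = _
    split_ifs with h
    · have hc : c ∈ l := by
        have hc := ih c
        rw [Nat.testBit_eq_decide_div_mod_eq, h] at hc
        simpa using hc.symm
      rw [ih]
      by_cases hj : j = c
      · simp [hj, hc]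
      · simp [hj]
    · rw [testBit_add_two_pow h, ih]
      simp

/-- The operation that projects onto a channel set, given the mask of the list that presents it. -/
def ChanSet.op : ChanSet → Op
  | .finite _ => .keep
  | .cofinite _ => .drop

/-- The bit mask of the list of channels that presents a channel set. -/
def ChanSet.mask : ChanSet → ℕ
  | .finite l => bitMask l
  | .cofinite l => bitMask l

theorem ChanSet.op_rel (C : ChanSet) (r₀ r₁ a₀ a₁ b₁ : ℝ) : C.op.Rel r₀ r₁ a₀ a₁ C.mask b₁ ↔
    decode r₀ r₁ = (decode a₀ a₁).filter fun e => C.has e.1 := by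
  cases C <;> simp [op, mask, Op.Rel, has, testBit_bitMask]

/-- Specification of a real by a real term. -/
def specReal (N : ℕ) (a : RTerm) : Formula := .realEq (.var (auxVar N 0)) a

/-- Specification of two reals by real terms. -/
def specPair (N : ℕ) (a b : RTerm) : Formula :=
  .and (.realEq (.var (auxVar N 0)) a) (.realEq (.var (auxVar N 1)) b)

/-- The variable that represents the code of the trace variable `t`, for names below `N`. -/
def codeRVar (N t : ℕ) : RVar := .base (N + 2 * t)

/-- The variable that represents the length of the trace variable `t`, for names below `N`. -/
def lenRVar (N t : ℕ) : RVar := .base (N + (2 * t + 1))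

mutual

/-- Specification of the value of a real term. -/
noncomputable def RTerm.spec (N : ℕ) : RTerm → Formula
  | .var x => specReal N (.var x)
  | .rat q => specReal N (.rat q)
  | .add a b => Op.add.apply N (a.spec N) (b.spec N)
  | .mul a b => Op.mul.apply N (a.spec N) (b.spec N)
  | .diff p => specReal N (.diff p)
  | .chan e => Op.chan.apply N (e.spec N) (e.spec N)
  | .val e => Op.val.apply N (e.spec N) (e.spec N)
  | .time e => Op.time.apply N (e.spec N) (e.spec N)
  | .len e => Op.len.apply N (e.spec N) (e.spec N)

/-- Specification of the value of a trace term through all its codes with its length. An operation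
with fewer than two arguments obtains a repeated or an arbitrary one. -/
noncomputable def TTerm.spec (N : ℕ) : TTerm → Formula
  | .var t => Op.same.apply N (specPair N (.var (codeRVar N t)) (.var (lenRVar N t)))
      (specPair N (.var (codeRVar N t)) (.var (lenRVar N t)))
  | .empty => Op.empty.apply N (specReal N (.rat 0)) (specReal N (.rat 0))
  | .event c p q => Op.event.apply N (specReal N (.rat c)) (specPair N p.toRTerm q.toRTerm)
  | .concat e f => Op.concat.apply N (e.spec N) (f.spec N)
  | .proj e C => C.op.apply N (e.spec N) (specReal N (.rat C.mask))
  | .item e a => Op.item.apply N (e.spec N) (a.spec N)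

end

/-- The translation of formulas with variable names below `N`. The formulas of real arithmetic in
differential equation properties contain no traces and are kept. -/
noncomputable def Formula.translate (N : ℕ) : Formula → Formula
  | .realEq a b => Op.realEq.apply N (a.spec N) (b.spec N)
  | .realGe a b => Op.realGe.apply N (a.spec N) (b.spec N)
  | .traceEq e f => Op.traceEq.apply N (e.spec N) (f.spec N)
  | .tracePrefix e f => Op.tracePrefix.apply N (e.spec N) (f.spec N)
  | .not φ => .not (φ.translate N)
  | .and φ ψ => .and (φ.translate N) (ψ.translate N)
  | .allReal x φ => .allReal x (φ.translate N)
  | .allTrace t φ => .allReal (codeRVar N t) (.allReal (lenRVar N t) (φ.translate N))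
  | .box o χ => .box o χ
  | .dia o χ => .dia o χ

/-! ### The translation avoids traces -/

theorem Op.isFOD_apply {N : ℕ} {o : Op} {A B : Formula} (hA : A.IsFOD) (hB : B.IsFOD) :
    (o.apply N A B).IsFOD := by
  simp [apply, Formula.exReal, Formula.letReal, Formula.IsFOD, RTerm.IsPoly, hA, hB,
    o.isFOD_formula]

mutual

theorem RTerm.isFOD_spec (N : ℕ) : ∀ a : RTerm, (a.spec N).IsFOD
  | .var _ => ⟨trivial, trivial⟩
  | .rat _ => ⟨trivial, trivial⟩
  | .add a b => Op.isFOD_apply (a.isFOD_spec N) (b.isFOD_spec N)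
  | .mul a b => Op.isFOD_apply (a.isFOD_spec N) (b.isFOD_spec N)
  | .diff _ => ⟨trivial, trivial⟩
  | .chan e => Op.isFOD_apply (e.isFOD_spec N) (e.isFOD_spec N)
  | .val e => Op.isFOD_apply (e.isFOD_spec N) (e.isFOD_spec N)
  | .time e => Op.isFOD_apply (e.isFOD_spec N) (e.isFOD_spec N)
  | .len e => Op.isFOD_apply (e.isFOD_spec N) (e.isFOD_spec N)

theorem TTerm.isFOD_spec (N : ℕ) : ∀ e : TTerm, (e.spec N).IsFOD
  | .var _ => Op.isFOD_apply ⟨⟨trivial, trivial⟩, trivial, trivial⟩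
      ⟨⟨trivial, trivial⟩, trivial, trivial⟩
  | .empty => Op.isFOD_apply ⟨trivial, trivial⟩ ⟨trivial, trivial⟩
  | .event _ p q => Op.isFOD_apply ⟨trivial, trivial⟩
      ⟨⟨trivial, p.isPoly_toRTerm⟩, trivial, q.isPoly_toRTerm⟩
  | .concat e f => Op.isFOD_apply (e.isFOD_spec N) (f.isFOD_spec N)
  | .proj e _ => Op.isFOD_apply (e.isFOD_spec N) ⟨trivial, trivial⟩
  | .item e a => Op.isFOD_apply (e.isFOD_spec N) (a.isFOD_spec N)

end

theorem Formula.isFOD_translate (N : ℕ) (φ : Formula) : (φ.translate N).IsFOD := by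
  induction φ with
  | realEq a b => exact Op.isFOD_apply (a.isFOD_spec N) (b.isFOD_spec N)
  | realGe a b => exact Op.isFOD_apply (a.isFOD_spec N) (b.isFOD_spec N)
  | traceEq a b => exact Op.isFOD_apply (a.isFOD_spec N) (b.isFOD_spec N)
  | tracePrefix a b => exact Op.isFOD_apply (a.isFOD_spec N) (b.isFOD_spec N)
  | not φ ih => exact ih
  | and φ ψ ih ih' => exact ⟨ih, ih'⟩
  | allReal x φ ih => exact ih
  | allTrace t φ ih => exact ih
  | box o χ => trivial
  | dia o χ => trivial

/-! ### Correctness of the translation -/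

/-- The state in which the traces are decoded from their representants. -/
noncomputable def decodeState (N : ℕ) (ρ : RVar → ℝ) : State where
  real := ρ
  trace t := decode (ρ (codeRVar N t)) (ρ (lenRVar N t))

theorem specifies_specReal {N : ℕ} {ρ : RVar → ℝ} {a : RTerm} {r : ℝ}
    (h : ∀ w : State, (∀ x : RVar, (∀ i, x ≠ auxVar N i) → w.real x = ρ x) → a.eval w = r) :
    Specifies N ρ (specReal N a) fun r₀ _ => r₀ = r := fun w hw => by
  rw [specReal, Formula.Sat, h w hw, RTerm.eval]

theorem specifies_specPair {N : ℕ} {ρ : RVar → ℝ} {a b : RTerm} {r s : ℝ}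
    (ha : ∀ w : State, (∀ x : RVar, (∀ i, x ≠ auxVar N i) → w.real x = ρ x) → a.eval w = r)
    (hb : ∀ w : State, (∀ x : RVar, (∀ i, x ≠ auxVar N i) → w.real x = ρ x) → b.eval w = s) :
    Specifies N ρ (specPair N a b) fun r₀ r₁ => r₀ = r ∧ r₁ = s := fun w hw => by
  rw [specPair, Formula.Sat, Formula.Sat, Formula.Sat, ha w hw, hb w hw, RTerm.eval, RTerm.eval]

theorem ne_auxVar_of_index_lt {N i : ℕ} {x : RVar} (h : x.index < N) : x ≠ auxVar N i := by
  rintro rfl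
  simp only [auxVar, RVar.index] at h
  omega

theorem Poly.eval_eq_of_bound_le {N : ℕ} {p : Poly} (h : p.bound ≤ N) {ρ ρ' : RVar → ℝ}
    (hw : ∀ x : RVar, (∀ i, x ≠ auxVar N i) → ρ' x = ρ x) : p.eval ρ' = p.eval ρ :=
  p.eval_congr fun x hx => hw x fun _ => ne_auxVar_of_index_lt (hx.trans_le h)

/-- Arguments may be specified by arbitrary codes, as the operations depend on the decoded traces
only and every trace has a code. -/
theorem exists_decode_decode {τ σ : Trace} {F : Trace → Trace → Prop} :
    (∃ a₀ a₁ b₀ b₁, (decode a₀ a₁ = τ ∧ decode b₀ b₁ = σ) ∧ F (decode a₀ a₁) (decode b₀ b₁)) ↔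
      F τ σ := by
  constructor
  · rintro ⟨_, _, _, _, ⟨rfl, rfl⟩, h⟩
    exact h
  · intro h
    obtain ⟨a₀, a₁, rfl⟩ := decode_surjective τ
    obtain ⟨b₀, b₁, rfl⟩ := decode_surjective σ
    exact ⟨a₀, a₁, b₀, b₁, ⟨rfl, rfl⟩, h⟩

theorem exists_decode_real {τ : Trace} {r : ℝ} {F : Trace → ℝ → Prop} :
    (∃ a₀ a₁ b₀ _b₁ : ℝ, (decode a₀ a₁ = τ ∧ b₀ = r) ∧ F (decode a₀ a₁) b₀) ↔ F τ r := by
  constructor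
  · rintro ⟨_, _, _, _, ⟨rfl, rfl⟩, h⟩
    exact h
  · intro h
    obtain ⟨a₀, a₁, rfl⟩ := decode_surjective τ
    exact ⟨a₀, a₁, r, 0, ⟨rfl, rfl⟩, h⟩

mutual

theorem RTerm.specifies_spec {N : ℕ} (ρ : RVar → ℝ) : ∀ a : RTerm, a.bound ≤ N →
    Specifies N ρ (a.spec N) fun r _ => r = a.eval (decodeState N ρ)
  | .var x, h => specifies_specReal fun w hw => hw x fun _ => ne_auxVar_of_index_lt h
  | .rat q, _ => specifies_specReal fun w hw => rfl
  | .add a b, h => Op.specifies_apply (a.specifies_spec ρ (max_le_iff.mp h).1)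
      (b.specifies_spec ρ (max_le_iff.mp h).2) fun r₀ r₁ => by simp [Op.Rel, RTerm.eval]
  | .mul a b, h => Op.specifies_apply (a.specifies_spec ρ (max_le_iff.mp h).1)
      (b.specifies_spec ρ (max_le_iff.mp h).2) fun r₀ r₁ => by simp [Op.Rel, RTerm.eval]
  | .diff p, h => specifies_specReal fun w hw => Poly.eval_eq_of_bound_le (p := .diff p) h hw
  | .chan e, h => Op.specifies_apply (e.specifies_spec ρ h) (e.specifies_spec ρ h)
      fun r₀ _ => (exists_decode_decode (F := fun τ _ => r₀ = τ.lastChan)).symm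
  | .val e, h => Op.specifies_apply (e.specifies_spec ρ h) (e.specifies_spec ρ h)
      fun r₀ _ => (exists_decode_decode (F := fun τ _ => r₀ = τ.lastVal)).symm
  | .time e, h => Op.specifies_apply (e.specifies_spec ρ h) (e.specifies_spec ρ h)
      fun r₀ _ => (exists_decode_decode (F := fun τ _ => r₀ = τ.lastTime)).symm
  | .len e, h => Op.specifies_apply (e.specifies_spec ρ h) (e.specifies_spec ρ h)
      fun r₀ _ => (exists_decode_decode (F := fun τ _ => r₀ = τ.length)).symm

theorem TTerm.specifies_spec {N : ℕ} (ρ : RVar → ℝ) : ∀ e : TTerm, e.bound ≤ N →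
    Specifies N ρ (e.spec N) fun r₀ r₁ => decode r₀ r₁ = e.eval (decodeState N ρ)
  | .var t, _ => Op.specifies_apply
      (specifies_specPair (fun w hw => hw _ (by simp [codeRVar, auxVar]))
        fun w hw => hw _ (by simp [lenRVar, auxVar]))
      (specifies_specPair (fun w hw => hw _ (by simp [codeRVar, auxVar]))
        fun w hw => hw _ (by simp [lenRVar, auxVar]))
      fun r₀ r₁ => by simp [Op.Rel, TTerm.eval, decodeState]
  | .empty, _ => Op.specifies_apply (specifies_specReal fun w hw => rfl)
      (specifies_specReal fun w hw => rfl) fun r₀ r₁ => by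
        simp [Op.Rel, TTerm.eval]
  | .event c p q, h => Op.specifies_apply
      (specifies_specReal (r := c) fun w hw => by simp [RTerm.eval])
      (specifies_specPair
        (fun w hw => (p.eval_toRTerm w).trans (Poly.eval_eq_of_bound_le (max_le_iff.mp h).1 hw))
        fun w hw => (q.eval_toRTerm w).trans (Poly.eval_eq_of_bound_le (max_le_iff.mp h).2 hw))
      fun r₀ r₁ => by simp [Op.Rel, TTerm.eval, decodeState]
  | .concat e f, h => Op.specifies_apply (e.specifies_spec ρ (max_le_iff.mp h).1)
      (f.specifies_spec ρ (max_le_iff.mp h).2) fun r₀ r₁ =>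
        (exists_decode_decode (F := fun τ σ => decode r₀ r₁ = τ ++ σ)).symm
  | .proj e C, h => Op.specifies_apply (e.specifies_spec ρ h)
      (specifies_specReal (r := C.mask) fun w hw => by simp [RTerm.eval]) fun r₀ r₁ => by
        refine (exists_decode_real (r := C.mask) (F := fun τ _ => decode r₀ r₁ =
          τ.filter fun ev => C.has ev.1)).symm.trans ?_
        refine exists_congr fun a₀ => exists_congr fun a₁ => exists_congr fun b₀ =>
          exists_congr fun b₁ => and_congr_right fun hab => ?_
        rw [hab.2, ChanSet.op_rel]
  | .item e a, h => Op.specifies_apply (e.specifies_spec ρ (max_le_iff.mp h).1)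
      (a.specifies_spec ρ (max_le_iff.mp h).2) fun r₀ r₁ =>
        (exists_decode_real (F := fun τ x => decode r₀ r₁ = Trace.item τ x)).symm

end

theorem sat_atom_iff {N : ℕ} {w : State} {o : Op} {A B : Formula} {P Q : ℝ → ℝ → Prop} {R : Prop}
    (hA : Specifies N w.real A P) (hB : Specifies N w.real B Q)
    (h : ∀ r₀ r₁, R ↔ ∃ a₀ a₁ b₀ b₁, (P a₀ a₁ ∧ Q b₀ b₁) ∧ o.Rel r₀ r₁ a₀ a₁ b₀ b₁) :
    (o.apply N A B).Sat w ↔ R :=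
  Op.specifies_apply (R := fun _ _ => R) hA hB h w fun _ _ => rfl

theorem decodeState_setReal {N : ℕ} {ρ : RVar → ℝ} {x : RVar} (h : x.index < N) (r : ℝ) :
    decodeState N (Function.update ρ x r) = (decodeState N ρ).setReal x r := by
  have h1 : ∀ t, codeRVar N t ≠ x := by
    rintro t rfl
    simp only [codeRVar, RVar.index] at h
    omega
  have h2 : ∀ t, lenRVar N t ≠ x := by
    rintro t rfl
    simp only [lenRVar, RVar.index] at h
    omega
  ext1
  · rfl
  · funext t
    simp [decodeState, State.setReal, h1, h2]

/-- The translation is true in a state if and only if the formula is true of the decoded traces,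
whatever reals the representants hold. -/
theorem Formula.sat_translate {N : ℕ} (φ : Formula) (h : φ.bound ≤ N) (w : State) :
    (φ.translate N).Sat w ↔ φ.Sat (decodeState N w.real) := by
  induction φ generalizing w with
  | realEq a b =>
    exact sat_atom_iff (a.specifies_spec _ (max_le_iff.mp h).1)
      (b.specifies_spec _ (max_le_iff.mp h).2) fun _ _ => by simp [Op.Rel, Sat]
  | realGe a b =>
    exact sat_atom_iff (a.specifies_spec _ (max_le_iff.mp h).1)
      (b.specifies_spec _ (max_le_iff.mp h).2) fun _ _ => by simp [Op.Rel, Sat]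
  | traceEq e f =>
    exact sat_atom_iff (e.specifies_spec _ (max_le_iff.mp h).1)
      (f.specifies_spec _ (max_le_iff.mp h).2) fun _ _ =>
        (exists_decode_decode (F := fun τ σ => τ = σ)).symm
  | tracePrefix e f =>
    exact sat_atom_iff (e.specifies_spec _ (max_le_iff.mp h).1)
      (f.specifies_spec _ (max_le_iff.mp h).2) fun _ _ =>
        (exists_decode_decode (F := fun τ σ => τ <+: σ)).symm
  | not φ ih => exact not_congr (ih h w)
  | and φ ψ ih ih' =>
    exact and_congr (ih (max_le_iff.mp h).1 w) (ih' (max_le_iff.mp h).2 w)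
  | allReal x φ ih =>
    refine forall_congr' fun r => (ih (max_le_iff.mp h).2 _).trans ?_
    rw [State.setReal_real, decodeState_setReal (max_le_iff.mp h).1]
  | allTrace t φ ih =>
    have key : ∀ Z n, (φ.translate N).Sat ((w.setReal (codeRVar N t) Z).setReal (lenRVar N t) n) ↔
        φ.Sat ((decodeState N w.real).setTrace t (decode Z n)) := by
      intro Z n
      -- The two states differ only in the real variables that represent `t`, which lie above the
      -- bound of `φ`.
      obtain ⟨K, hK⟩ := φ.finitelyDependent
      refine (ih h _).trans (iff_of_eq (hK _ _ (fun x hx => ?_) fun s _ => ?_))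
      · have hx' : x.index < N := hx.trans_le h
        have h1 : x ≠ codeRVar N t := by
          rintro rfl
          simp only [codeRVar, RVar.index] at hx'
          omega
        have h2 : x ≠ lenRVar N t := by
          rintro rfl
          simp only [lenRVar, RVar.index] at hx'
          omega
        simp [decodeState, State.setTrace, h1, h2]
      · have h1 : ∀ s t, codeRVar N s ≠ lenRVar N t := fun s t => by
          simp only [codeRVar, lenRVar, ne_eq, RVar.base.injEq]
          omega
        by_cases hst : s = t
        · subst hst
          simp [decodeState, State.setTrace, h1]
        · have h2 : codeRVar N s ≠ codeRVar N t := by simpa [codeRVar] using hst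
          have h3 : lenRVar N s ≠ lenRVar N t := by simpa [lenRVar] using hst
          have h4 : lenRVar N s ≠ codeRVar N t := (h1 t s).symm
          simp [decodeState, State.setTrace, h1, h2, h3, h4, hst]
    constructor
    · intro H τ
      obtain ⟨Z, n, rfl⟩ := decode_surjective τ
      exact (key Z n).mp (H Z n)
    · exact fun H Z n => (key Z n).mpr (H _)
  | box o χ => rfl
  | dia o χ => rfl

/-! ### Dual states -/

/-- Each representant determines its trace variable, so that the representants of all free trace
variables can be set at once. -/
theorem exists_isFODDual (φ : Formula) (v : State) : ∃ w, IsFODDual φ v w := by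
  classical
  choose Z hZ using exists_isTraceCode
  let ρ : RVar → ℝ := fun x =>
    if h : ∃ t ∈ φ.freeTVars, x = φ.codeVar t then Z (v.trace h.choose)
    else if h : ∃ t ∈ φ.freeTVars, x = φ.lenVar t then ((v.trace h.choose).length : ℝ)
    else v.real x
  have hcode : ∀ s t, φ.codeVar s = φ.codeVar t → s = t := fun s t h => by
    simpa [Formula.codeVar] using h
  have hlen : ∀ s t, φ.lenVar s = φ.lenVar t → s = t := fun s t h => by
    simpa [Formula.lenVar] using h
  have hne : ∀ s t, φ.codeVar s ≠ φ.lenVar t := fun s t => by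
    simp only [Formula.codeVar, Formula.lenVar, ne_eq, RVar.base.injEq]
    omega
  refine ⟨⟨ρ, v.trace⟩, rfl, fun t ht => ⟨?_, ?_⟩, fun x hx => ?_⟩
  · have h : ∃ s ∈ φ.freeTVars, φ.codeVar t = φ.codeVar s := ⟨t, ht, rfl⟩
    have e : ρ (φ.codeVar t) = Z (v.trace t) := by
      simp only [ρ]
      rw [dif_pos h, ← hcode _ _ h.choose_spec.2]
    change IsTraceCode (ρ _) _
    rw [e]
    exact hZ _
  · have h : ∃ s ∈ φ.freeTVars, φ.lenVar t = φ.lenVar s := ⟨t, ht, rfl⟩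
    have h' : ¬ ∃ s ∈ φ.freeTVars, φ.lenVar t = φ.codeVar s :=
      fun ⟨s, _, hs⟩ => hne s t hs.symm
    simp only [ρ]
    rw [dif_neg h', dif_pos h, ← hlen _ _ h.choose_spec.2]
  · have h : ¬ ∃ s ∈ φ.freeTVars, x = φ.codeVar s := fun ⟨s, hs, e⟩ => (hx s hs).1 e
    have h' : ¬ ∃ s ∈ φ.freeTVars, x = φ.lenVar s := fun ⟨s, hs, e⟩ => (hx s hs).2 e
    simp only [ρ]
    rw [dif_neg h, dif_neg h']

theorem IsFODDual.sat_iff {φ : Formula} {v w : State} (h : IsFODDual φ v w) :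
    φ.Sat v ↔ (φ.translate φ.bound).Sat w := by
  obtain ⟨-, h1, h2⟩ := h
  rw [φ.sat_translate le_rfl]
  refine φ.sat_congr_freeTVars (fun x hx => (h2 x fun t _ => ⟨?_, ?_⟩).symm) fun t ht => ?_
  · rintro rfl
    simp only [Formula.codeVar, RVar.index] at hx
    omega
  · rintro rfl
    simp only [Formula.lenVar, RVar.index] at hx
    omega
  · obtain ⟨hc, hl⟩ := h1 t ht
    change _ = decode (w.real (φ.codeVar t)) (w.real (φ.lenVar t))
    rw [hl, hc.decode_eq]

/-- From left to right, an arbitrary state is read through its decoded traces, whether or not it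
is a dual state; from right to left, dual states exist. -/
theorem Formula.valid_translate_iff (φ : Formula) :
    φ.Valid ↔ (φ.translate φ.bound).Valid := by
  constructor
  · exact fun h w => (φ.sat_translate le_rfl w).mpr (h _)
  · intro h v
    obtain ⟨w, hw⟩ := exists_isFODDual φ v
    exact hw.sat_iff.mpr (h w)

/-! ### Course-of-values recursion on Gödel numbers -/

section CourseOfValues

variable {α σ : Type*}

/-- The first `n` values of the function defined by course-of-values recursion with `step`. -/
def valuesBelow (step : α → List σ → σ) (a : α) : ℕ → List σ
  | 0 => []
  | n + 1 => valuesBelow step a n ++ [step a (valuesBelow step a n)]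

/-- The function defined by course-of-values recursion: `step` obtains the list of all earlier
values, whose length is the argument. -/
def courseOfValues (step : α → List σ → σ) (a : α) (n : ℕ) : σ :=
  step a (valuesBelow step a n)

@[simp] theorem length_valuesBelow (step : α → List σ → σ) (a : α) (n : ℕ) :
    (valuesBelow step a n).length = n := by
  induction n with
  | zero => rfl
  | succ n ih => simp [valuesBelow, ih]

/-- The entry of a list at a position, with a default value beyond its end. -/
def entry [Inhabited σ] (l : List σ) (k : ℕ) : σ := l.getD k default

theorem entry_valuesBelow [Inhabited σ] (step : α → List σ → σ) (a : α) {n k : ℕ} (h : k < n) :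
    entry (valuesBelow step a n) k = courseOfValues step a k := by
  unfold entry
  induction n with
  | zero => omega
  | succ n ih =>
    rw [valuesBelow]
    rcases Nat.lt_succ_iff_lt_or_eq.mp h with h | rfl
    · rw [List.getD_append _ _ _ _ (by simpa using h), ih h]
    · rw [List.getD_append_right _ _ _ _ (by simp)]
      simp [courseOfValues]

theorem primrec_courseOfValues [Primcodable α] [Primcodable σ] {step : α → List σ → σ}
    (h : Primrec₂ step) : Primrec₂ (courseOfValues step) := by
  have h' : Primrec₂ (valuesBelow step) := by
    refine (Primrec.nat_rec (f := fun _ => ([] : List σ)) (Primrec.const [])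
      (g := fun a p => p.2 ++ [step a p.2])
      (Primrec.list_concat.comp (Primrec.snd.comp Primrec.snd)
        (h.comp Primrec.fst (Primrec.snd.comp Primrec.snd)))).of_eq fun a n => ?_
    induction n with
    | zero => rfl
    | succ n ih => simp only [valuesBelow, ← ih]
  exact h.comp Primrec.fst h'

end CourseOfValues

theorem lt_natPair {t a : ℕ} (ht : 0 < t) : a < Nat.pair t a := by
  unfold Nat.pair
  split_ifs <;> nlinarith

theorem left_lt_natPair_pair {t a b : ℕ} (ht : 0 < t) : a < Nat.pair t (Nat.pair a b) :=
  (Nat.left_le_pair a b).trans_lt (lt_natPair ht)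

theorem right_lt_natPair_pair {t a b : ℕ} (ht : 0 < t) : b < Nat.pair t (Nat.pair a b) :=
  (Nat.right_le_pair a b).trans_lt (lt_natPair ht)

/-! ### Primitive recursive functions on Gödel numbers -/

section PrimrecRules

variable {α σ : Type*} [Primcodable α] [Primcodable σ] {f g : α → ℕ}

theorem primrec_natPair (hf : Primrec f) (hg : Primrec g) :
    Primrec fun a => Nat.pair (f a) (g a) :=
  Primrec₂.natPair.comp hf hg

theorem primrec_unpair_fst (hf : Primrec f) : Primrec fun a => (Nat.unpair (f a)).1 :=
  Primrec.fst.comp (Primrec.unpair.comp hf)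

theorem primrec_unpair_snd (hf : Primrec f) : Primrec fun a => (Nat.unpair (f a)).2 :=
  Primrec.snd.comp (Primrec.unpair.comp hf)

theorem primrec_max (hf : Primrec f) (hg : Primrec g) : Primrec fun a => max (f a) (g a) :=
  Primrec.nat_max.comp hf hg

theorem primrec_add (hf : Primrec f) (hg : Primrec g) : Primrec fun a => f a + g a :=
  Primrec.nat_add.comp hf hg

theorem primrec_mul (hf : Primrec f) (hg : Primrec g) : Primrec fun a => f a * g a :=
  Primrec.nat_mul.comp hf hg

theorem primrec_div (hf : Primrec f) (hg : Primrec g) : Primrec fun a => f a / g a :=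
  Primrec.nat_div.comp hf hg

theorem primrec_getD {l : α → List σ} {d : σ} (hl : Primrec l) (hf : Primrec f) :
    Primrec fun a => (l a).getD (f a) d :=
  (Primrec.list_getD d).comp hl hf

theorem primrec_entry [Inhabited σ] {l : α → List σ} (hl : Primrec l) (hf : Primrec f) :
    Primrec fun a => entry (l a) (f a) :=
  primrec_getD hl hf

theorem primrec_cons {x : α → σ} {l : α → List σ} (hx : Primrec x) (hl : Primrec l) :
    Primrec fun a => x a :: l a :=
  Primrec.list_cons.comp hx hl

theorem primrec_length {l : α → List σ} (hl : Primrec l) : Primrec fun a => (l a).length :=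
  Primrec.list_length.comp hl

theorem primrec_fst {τ : Type*} [Primcodable τ] {x : α → σ × τ} (hx : Primrec x) :
    Primrec fun a => (x a).1 := Primrec.fst.comp hx

theorem primrec_snd {τ : Type*} [Primcodable τ] {x : α → σ × τ} (hx : Primrec x) :
    Primrec fun a => (x a).2 := Primrec.snd.comp hx

end PrimrecRules

/-! ### Effectivity of the bound -/

/-- The step of the recursion that computes the bounds of real terms and of trace terms, as a pair.
The number `n` at hand is the length of the list of earlier values. Its first component is the tag
of the outermost constructor, which selects an entry from a list with one entry for each
constructor; its second component `a` codes the arguments, as the pair of `b` and `c` if there are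
two. On numbers that are not Gödel numbers the result is irrelevant. -/
def termBoundStep (_ : Unit) (l : List (ℕ × ℕ)) : ℕ × ℕ :=
  let n := l.length
  let a := n.unpair.2
  let b := a.unpair.1
  let c := a.unpair.2
  let R := fun k => (entry l k).1
  let T := fun k => (entry l k).2
  ([a / 2 + 1, 0, max (R b) (R c), max (R b) (R c), R a, T a, T a, T a, T a].getD n.unpair.1 0,
    [0, 0, max (R c.unpair.1) (R c.unpair.2), max (T b) (T c), T b, max (T b) (R c)].getD
      n.unpair.1 0)

theorem primrec_termBoundStep : Primrec₂ termBoundStep := by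
  have hl : Primrec fun p : Unit × List (ℕ × ℕ) => p.2 := Primrec.snd
  have hn := primrec_length hl
  have ht := primrec_unpair_fst hn
  have ha := primrec_unpair_snd hn
  have hb := primrec_unpair_fst ha
  have hc := primrec_unpair_snd ha
  have hR : ∀ {f : Unit × List (ℕ × ℕ) → ℕ}, Primrec f →
      Primrec fun p : Unit × List (ℕ × ℕ) => (entry p.2 (f p)).1 :=
    fun hf => primrec_fst (primrec_entry hl hf)
  have hT : ∀ {f : Unit × List (ℕ × ℕ) → ℕ}, Primrec f →
      Primrec fun p : Unit × List (ℕ × ℕ) => (entry p.2 (f p)).2 :=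
    fun hf => primrec_snd (primrec_entry hl hf)
  have h0 : Primrec fun _ : Unit × List (ℕ × ℕ) => 0 := Primrec.const 0
  exact Primrec.pair
    (primrec_getD (primrec_cons
        (primrec_add (primrec_div ha (Primrec.const 2)) (Primrec.const 1)) <|
      primrec_cons h0 <| primrec_cons (primrec_max (hR hb) (hR hc)) <|
      primrec_cons (primrec_max (hR hb) (hR hc)) <| primrec_cons (hR ha) <|
      primrec_cons (hT ha) <| primrec_cons (hT ha) <| primrec_cons (hT ha) <|
      primrec_cons (hT ha) <| Primrec.const []) ht)
    (primrec_getD (primrec_cons h0 <| primrec_cons h0 <|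
      primrec_cons (primrec_max (hR (primrec_unpair_fst hc)) (hR (primrec_unpair_snd hc))) <|
      primrec_cons (primrec_max (hT hb) (hT hc)) <| primrec_cons (hT hb) <|
      primrec_cons (primrec_max (hT hb) (hR hc)) <| Primrec.const []) ht)

/-- The bounds of the real term and of the trace term with a given number. -/
def termBound (n : ℕ) : ℕ × ℕ := courseOfValues termBoundStep () n

theorem primrec_termBound : Primrec termBound :=
  (primrec_courseOfValues primrec_termBoundStep).comp (Primrec.const ()) Primrec.id

theorem RVar.index_eq_code_div (x : RVar) : x.index = x.code / 2 := by
  cases x <;> simp only [index, code] <;> omega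

theorem entry_valuesBelow_termBoundStep {n k : ℕ} (h : k < n) :
    entry (valuesBelow termBoundStep () n) k = termBound k :=
  entry_valuesBelow _ _ h

/-- Polynomials and real terms use the same numbers for the constructors that they share. -/
theorem termBound_polyCode (p : Poly) : (termBound p.code).1 = p.bound := by
  induction p with
  | var x =>
    simp [termBound, courseOfValues, termBoundStep, Poly.code, Poly.bound,
      RVar.index_eq_code_div]
  | rat q => simp [termBound, courseOfValues, termBoundStep, Poly.code, Poly.bound]
  | add p q ih ih' =>
    rw [termBound]
    simp [courseOfValues, termBoundStep, Poly.code, Poly.bound,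
      entry_valuesBelow_termBoundStep, left_lt_natPair_pair, right_lt_natPair_pair, ih, ih']
  | mul p q ih ih' =>
    rw [termBound]
    simp [courseOfValues, termBoundStep, Poly.code, Poly.bound,
      entry_valuesBelow_termBoundStep, left_lt_natPair_pair, right_lt_natPair_pair, ih, ih']
  | diff p ih =>
    rw [termBound]
    simp [courseOfValues, termBoundStep, Poly.code, Poly.bound,
      entry_valuesBelow_termBoundStep, lt_natPair, ih]

mutual

theorem termBound_code_fst : ∀ a : RTerm, (termBound a.code).1 = a.bound
  | .var x => termBound_polyCode (.var x)
  | .rat q => termBound_polyCode (.rat q)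
  | .add a b => by
    have ha := termBound_code_fst a
    have hb := termBound_code_fst b
    rw [termBound]
    simp [courseOfValues, termBoundStep, RTerm.code, RTerm.bound,
      entry_valuesBelow_termBoundStep, left_lt_natPair_pair, right_lt_natPair_pair, ha, hb]
  | .mul a b => by
    have ha := termBound_code_fst a
    have hb := termBound_code_fst b
    rw [termBound]
    simp [courseOfValues, termBoundStep, RTerm.code, RTerm.bound,
      entry_valuesBelow_termBoundStep, left_lt_natPair_pair, right_lt_natPair_pair, ha, hb]
  | .diff p => termBound_polyCode (.diff p)
  | .chan e => by
    have h := termBound_code_snd e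
    rw [termBound]
    simp [courseOfValues, termBoundStep, RTerm.code, RTerm.bound,
      entry_valuesBelow_termBoundStep, lt_natPair, h]
  | .val e => by
    have h := termBound_code_snd e
    rw [termBound]
    simp [courseOfValues, termBoundStep, RTerm.code, RTerm.bound,
      entry_valuesBelow_termBoundStep, lt_natPair, h]
  | .time e => by
    have h := termBound_code_snd e
    rw [termBound]
    simp [courseOfValues, termBoundStep, RTerm.code, RTerm.bound,
      entry_valuesBelow_termBoundStep, lt_natPair, h]
  | .len e => by
    have h := termBound_code_snd e
    rw [termBound]
    simp [courseOfValues, termBoundStep, RTerm.code, RTerm.bound,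
      entry_valuesBelow_termBoundStep, lt_natPair, h]

theorem termBound_code_snd : ∀ e : TTerm, (termBound e.code).2 = e.bound
  | .var t => by
    rw [termBound]
    simp [courseOfValues, termBoundStep, TTerm.code, TTerm.bound]
  | .empty => by
    rw [termBound]
    simp [courseOfValues, termBoundStep, TTerm.code, TTerm.bound]
  | .event c p q => by
    have hp : p.code < Nat.pair 2 (Nat.pair c (Nat.pair p.code q.code)) :=
      (Nat.left_le_pair _ _).trans_lt (right_lt_natPair_pair two_pos)
    have hq : q.code < Nat.pair 2 (Nat.pair c (Nat.pair p.code q.code)) :=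
      (Nat.right_le_pair _ _).trans_lt (right_lt_natPair_pair two_pos)
    rw [termBound]
    simp [courseOfValues, termBoundStep, TTerm.code, TTerm.bound,
      entry_valuesBelow_termBoundStep, hp, hq, termBound_polyCode]
  | .concat e f => by
    have he := termBound_code_snd e
    have hf := termBound_code_snd f
    rw [termBound]
    simp [courseOfValues, termBoundStep, TTerm.code, TTerm.bound,
      entry_valuesBelow_termBoundStep, left_lt_natPair_pair, right_lt_natPair_pair, he, hf]
  | .proj e C => by
    have he := termBound_code_snd e
    rw [termBound]
    simp [courseOfValues, termBoundStep, TTerm.code, TTerm.bound,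
      entry_valuesBelow_termBoundStep, left_lt_natPair_pair, he]
  | .item e a => by
    have he := termBound_code_snd e
    have ha := termBound_code_fst a
    rw [termBound]
    simp [courseOfValues, termBoundStep, TTerm.code, TTerm.bound,
      entry_valuesBelow_termBoundStep, left_lt_natPair_pair, right_lt_natPair_pair, he, ha]

end

/-- The step of the recursion that computes the bounds of formulas of real arithmetic. -/
def folBoundStep (_ : Unit) (l : List ℕ) : ℕ :=
  let n := l.length
  let a := n.unpair.2
  let b := a.unpair.1
  let c := a.unpair.2
  [max (termBound b).1 (termBound c).1, max (termBound b).1 (termBound c).1, entry l a,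
    max (entry l b) (entry l c), max (b / 2 + 1) (entry l c)].getD n.unpair.1 0

theorem primrec_folBoundStep : Primrec₂ folBoundStep := by
  have hl : Primrec fun p : Unit × List ℕ => p.2 := Primrec.snd
  have hn := primrec_length hl
  have ht := primrec_unpair_fst hn
  have ha := primrec_unpair_snd hn
  have hb := primrec_unpair_fst ha
  have hc := primrec_unpair_snd ha
  have hm := primrec_max (primrec_fst (primrec_termBound.comp hb))
    (primrec_fst (primrec_termBound.comp hc))
  exact primrec_getD (primrec_cons hm <| primrec_cons hm <| primrec_cons (primrec_entry hl ha) <|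
    primrec_cons (primrec_max (primrec_entry hl hb) (primrec_entry hl hc)) <|
    primrec_cons (primrec_max (primrec_add (primrec_div hb (Primrec.const 2)) (Primrec.const 1))
      (primrec_entry hl hc)) <| Primrec.const []) ht

/-- The bound of the formula of real arithmetic with a given number. -/
def folBound (n : ℕ) : ℕ := courseOfValues folBoundStep () n

theorem primrec_folBound : Primrec folBound :=
  (primrec_courseOfValues primrec_folBoundStep).comp (Primrec.const ()) Primrec.id

theorem entry_valuesBelow_folBoundStep {n k : ℕ} (h : k < n) :
    entry (valuesBelow folBoundStep () n) k = folBound k :=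
  entry_valuesBelow _ _ h

theorem folBound_code (χ : FolRA) : folBound χ.code = χ.bound := by
  induction χ with
  | eq p q =>
    simp [folBound, courseOfValues, folBoundStep, FolRA.code, FolRA.bound, termBound_polyCode]
  | ge p q =>
    simp [folBound, courseOfValues, folBoundStep, FolRA.code, FolRA.bound, termBound_polyCode]
  | not χ ih =>
    rw [folBound]
    simp [courseOfValues, folBoundStep, FolRA.code, FolRA.bound, entry_valuesBelow_folBoundStep,
      lt_natPair, ih]
  | and χ ξ ih ih' =>
    rw [folBound]
    simp [courseOfValues, folBoundStep, FolRA.code, FolRA.bound, entry_valuesBelow_folBoundStep,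
      left_lt_natPair_pair, right_lt_natPair_pair, ih, ih']
  | all x χ ih =>
    rw [folBound]
    simp [courseOfValues, folBoundStep, FolRA.code, FolRA.bound, entry_valuesBelow_folBoundStep,
      right_lt_natPair_pair, ih, RVar.index_eq_code_div]

/-- The list of numbers with a given code. -/
def listOfCode (n : ℕ) : List ℕ := (Encodable.decode n : Option (List ℕ)).getD []

theorem primrec_listOfCode : Primrec listOfCode :=
  Primrec.option_getD.comp Primrec.decode (Primrec.const [])

theorem listOfCode_encode (l : List ℕ) : listOfCode (Encodable.encode l) = l := by
  simp [listOfCode]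

/-- The bound of the differential equation system with a given number. -/
def odeBound (n : ℕ) : ℕ :=
  ((listOfCode n).map fun m => max (m.unpair.1 + 1) (termBound m.unpair.2).1).foldr max 0

theorem primrec_odeBound : Primrec odeBound := by
  refine Primrec.list_foldr (h := fun _ p => max p.1 p.2)
    (Primrec.list_map primrec_listOfCode ?_) (Primrec.const 0) ?_
  · have hm : Primrec fun p : ℕ × ℕ => p.2 := Primrec.snd
    exact primrec_max (primrec_add (primrec_unpair_fst hm) (Primrec.const 1))
      (primrec_fst (primrec_termBound.comp (primrec_unpair_snd hm)))
  · exact primrec_max (primrec_fst Primrec.snd) (primrec_snd Primrec.snd)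

theorem odeBound_code (o : ODE) : odeBound o.code = o.bound := by
  simp only [odeBound, ODE.code, ODE.bound, listOfCode_encode, List.map_map, Function.comp_def,
    Nat.unpair_pair, termBound_polyCode]

/-- The step of the recursion that computes the bounds of formulas. -/
def formulaBoundStep (_ : Unit) (l : List ℕ) : ℕ :=
  let n := l.length
  let a := n.unpair.2
  let b := a.unpair.1
  let c := a.unpair.2
  let r := max (termBound b).1 (termBound c).1
  let t := max (termBound b).2 (termBound c).2
  let o := max (odeBound b) (folBound c)
  [r, r, t, t, entry l a, max (entry l b) (entry l c), max (b / 2 + 1) (entry l c), entry l c, o,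
    o].getD n.unpair.1 0

theorem primrec_formulaBoundStep : Primrec₂ formulaBoundStep := by
  have hl : Primrec fun p : Unit × List ℕ => p.2 := Primrec.snd
  have hn := primrec_length hl
  have ht := primrec_unpair_fst hn
  have ha := primrec_unpair_snd hn
  have hb := primrec_unpair_fst ha
  have hc := primrec_unpair_snd ha
  have hm := primrec_max (primrec_fst (primrec_termBound.comp hb))
    (primrec_fst (primrec_termBound.comp hc))
  have hm' := primrec_max (primrec_snd (primrec_termBound.comp hb))
    (primrec_snd (primrec_termBound.comp hc))
  have ho := primrec_max (primrec_odeBound.comp hb) (primrec_folBound.comp hc)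
  exact primrec_getD (primrec_cons hm <| primrec_cons hm <| primrec_cons hm' <|
    primrec_cons hm' <| primrec_cons (primrec_entry hl ha) <|
    primrec_cons (primrec_max (primrec_entry hl hb) (primrec_entry hl hc)) <|
    primrec_cons (primrec_max (primrec_add (primrec_div hb (Primrec.const 2)) (Primrec.const 1))
      (primrec_entry hl hc)) <| primrec_cons (primrec_entry hl hc) <| primrec_cons ho <|
    primrec_cons ho <| Primrec.const []) ht

/-- The bound of the formula with a given number. -/
def formulaBound (n : ℕ) : ℕ := courseOfValues formulaBoundStep () n

theorem primrec_formulaBound : Primrec formulaBound :=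
  (primrec_courseOfValues primrec_formulaBoundStep).comp (Primrec.const ()) Primrec.id

theorem entry_valuesBelow_formulaBoundStep {n k : ℕ} (h : k < n) :
    entry (valuesBelow formulaBoundStep () n) k = formulaBound k :=
  entry_valuesBelow _ _ h

theorem formulaBound_code (φ : Formula) : formulaBound φ.code = φ.bound := by
  induction φ with
  | realEq a b | realGe a b =>
    simp [formulaBound, courseOfValues, formulaBoundStep, Formula.code, Formula.bound,
      termBound_code_fst]
  | traceEq e f | tracePrefix e f =>
    simp [formulaBound, courseOfValues, formulaBoundStep, Formula.code, Formula.bound,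
      termBound_code_snd]
  | box o χ | dia o χ =>
    simp [formulaBound, courseOfValues, formulaBoundStep, Formula.code, Formula.bound,
      odeBound_code, folBound_code]
  | not φ ih =>
    rw [formulaBound]
    simp [courseOfValues, formulaBoundStep, Formula.code, Formula.bound,
      entry_valuesBelow_formulaBoundStep, lt_natPair, ih]
  | and φ ψ ih ih' =>
    rw [formulaBound]
    simp [courseOfValues, formulaBoundStep, Formula.code, Formula.bound,
      entry_valuesBelow_formulaBoundStep, left_lt_natPair_pair, right_lt_natPair_pair, ih, ih']
  | allReal x φ ih =>
    rw [formulaBound]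
    simp [courseOfValues, formulaBoundStep, Formula.code, Formula.bound,
      entry_valuesBelow_formulaBoundStep, right_lt_natPair_pair, ih, RVar.index_eq_code_div]
  | allTrace t φ ih =>
    rw [formulaBound]
    simp [courseOfValues, formulaBoundStep, Formula.code, Formula.bound,
      entry_valuesBelow_formulaBoundStep, right_lt_natPair_pair, ih]

/-! ### Effectivity of the translation -/

section Codes

variable {α : Type*} [Primcodable α] {f g h k : α → ℕ}

/-- The code of `Formula.exReal`. -/
def exCode (x n : ℕ) : ℕ := Nat.pair 4 (Nat.pair 6 (Nat.pair x (Nat.pair 4 n)))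

theorem primrec_exCode (hf : Primrec f) (hg : Primrec g) :
    Primrec fun a => exCode (f a) (g a) :=
  primrec_natPair (Primrec.const 4) <| primrec_natPair (Primrec.const 6) <|
    primrec_natPair hf <| primrec_natPair (Primrec.const 4) hg

/-- The code of `Formula.letReal` for a variable. -/
def letCode (x y n : ℕ) : ℕ :=
  Nat.pair 6 (Nat.pair x (Nat.pair 4 (Nat.pair 5 (Nat.pair
    (Nat.pair 0 (Nat.pair (Nat.pair 0 x) (Nat.pair 0 y))) (Nat.pair 4 n)))))

theorem primrec_letCode (hf : Primrec f) (hg : Primrec g) (hh : Primrec h) :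
    Primrec fun a => letCode (f a) (g a) (h a) := by
  have h0 : Primrec fun _ : α => 0 := Primrec.const 0
  exact primrec_natPair (Primrec.const 6) <| primrec_natPair hf <|
    primrec_natPair (Primrec.const 4) <| primrec_natPair (Primrec.const 5) <|
    primrec_natPair (primrec_natPair h0 <| primrec_natPair (primrec_natPair h0 hf) <|
      primrec_natPair h0 hg) <| primrec_natPair (Primrec.const 4) hh

/-- The code of an auxiliary variable. -/
def auxCode (N i : ℕ) : ℕ := 2 * (N + 6 + i) + 1

theorem primrec_auxCode (hf : Primrec f) (i : ℕ) : Primrec fun a => auxCode (f a) i :=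
  primrec_add (primrec_mul (Primrec.const 2) <| primrec_add (primrec_add hf (Primrec.const 6))
    (Primrec.const i)) (Primrec.const 1)

/-- The code of `Op.apply`, from the code `D` of the formula of the operation. -/
def applyCode (N D A B : ℕ) : ℕ :=
  exCode (auxCode N 2) <| exCode (auxCode N 3) <| exCode (auxCode N 4) <| exCode (auxCode N 5) <|
  Nat.pair 5 <| Nat.pair
    (Nat.pair 5 <| Nat.pair
      (letCode (auxCode N 0) (auxCode N 2) <| letCode (auxCode N 1) (auxCode N 3) A)
      (letCode (auxCode N 0) (auxCode N 4) <| letCode (auxCode N 1) (auxCode N 5) B))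
    (letCode 1 (auxCode N 0) <| letCode 3 (auxCode N 1) <| letCode 5 (auxCode N 2) <|
      letCode 7 (auxCode N 3) <| letCode 9 (auxCode N 4) <| letCode 11 (auxCode N 5) D)

theorem Op.code_apply (N : ℕ) (o : Op) (A B : Formula) :
    (o.apply N A B).code = applyCode N o.formula.code A.code B.code := rfl

theorem primrec_applyCode (hf : Primrec f) (hg : Primrec g) (hh : Primrec h) (hk : Primrec k) :
    Primrec fun a => applyCode (f a) (g a) (h a) (k a) := by
  have hx := fun i => primrec_auxCode hf i
  have hc : ∀ n : ℕ, Primrec fun _ : α => n := fun n => Primrec.const n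
  exact primrec_exCode (hx 2) <| primrec_exCode (hx 3) <| primrec_exCode (hx 4) <|
    primrec_exCode (hx 5) <| primrec_natPair (hc 5) <| primrec_natPair
      (primrec_natPair (hc 5) <| primrec_natPair
        (primrec_letCode (hx 0) (hx 2) <| primrec_letCode (hx 1) (hx 3) hh)
        (primrec_letCode (hx 0) (hx 4) <| primrec_letCode (hx 1) (hx 5) hk))
      (primrec_letCode (hc 1) (hx 0) <| primrec_letCode (hc 3) (hx 1) <|
        primrec_letCode (hc 5) (hx 2) <| primrec_letCode (hc 7) (hx 3) <|
        primrec_letCode (hc 9) (hx 4) <| primrec_letCode (hc 11) (hx 5) hg)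

/-- The code of `specReal`. -/
def specRealCode (N a : ℕ) : ℕ := Nat.pair 0 (Nat.pair (Nat.pair 0 (auxCode N 0)) a)

theorem primrec_specRealCode (hf : Primrec f) (hg : Primrec g) :
    Primrec fun a => specRealCode (f a) (g a) :=
  primrec_natPair (Primrec.const 0) <|
    primrec_natPair (primrec_natPair (Primrec.const 0) (primrec_auxCode hf 0)) hg

theorem code_specReal (N : ℕ) (a : RTerm) : (specReal N a).code = specRealCode N a.code := rfl

/-- The code of `specPair`. -/
def specPairCode (N a b : ℕ) : ℕ :=
  Nat.pair 5 (Nat.pair (specRealCode N a)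
    (Nat.pair 0 (Nat.pair (Nat.pair 0 (auxCode N 1)) b)))

theorem primrec_specPairCode (hf : Primrec f) (hg : Primrec g) (hh : Primrec h) :
    Primrec fun a => specPairCode (f a) (g a) (h a) :=
  primrec_natPair (Primrec.const 5) <| primrec_natPair (primrec_specRealCode hf hg) <|
    primrec_natPair (Primrec.const 0) <|
      primrec_natPair (primrec_natPair (Primrec.const 0) (primrec_auxCode hf 1)) hh

theorem code_specPair (N : ℕ) (a b : RTerm) :
    (specPair N a b).code = specPairCode N a.code b.code := rfl

/-- The code of the rational constant with a natural number as its value. -/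
def natConstCode (n : ℕ) : ℕ := Nat.pair 1 (Nat.pair (2 * n) 1)

theorem primrec_natConstCode (hf : Primrec f) : Primrec fun a => natConstCode (f a) :=
  primrec_natPair (Primrec.const 1) <|
    primrec_natPair (primrec_mul (Primrec.const 2) hf) (Primrec.const 1)

theorem RTerm.code_natCast (n : ℕ) : (RTerm.rat n).code = natConstCode n := by
  rw [code, ratCode, Rat.num_natCast, Rat.den_natCast]
  rfl

theorem primrec_bitMask : Primrec bitMask := by
  have hc : Primrec fun p : List ℕ × ℕ × ℕ => p.2.1 := primrec_fst Primrec.snd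
  have hm : Primrec fun p : List ℕ × ℕ × ℕ => p.2.2 := primrec_snd Primrec.snd
  have hp : Primrec fun p : List ℕ × ℕ × ℕ => 2 ^ p.2.1 :=
    (Primrec₂.unpaired'.mp Nat.Primrec.pow).comp (Primrec.const 2) hc
  refine Primrec.list_foldr (h := fun _ p => if p.2 / 2 ^ p.1 % 2 = 1 then p.2 else p.2 + 2 ^ p.1)
    Primrec.id (Primrec.const 0) ?_
  exact Primrec.ite (Primrec.eq.comp (Primrec.nat_mod.comp (primrec_div hm hp) (Primrec.const 2))
    (Primrec.const 1)) hm (primrec_add hm hp)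

end Codes

/-- The number of a polynomial need not be changed when it becomes a real term. -/
theorem Poly.code_toRTerm (p : Poly) : p.toRTerm.code = p.code := by
  induction p with
  | var x => rfl
  | rat q => rfl
  | add p q ih ih' => rw [toRTerm, RTerm.code, ih, ih', code]
  | mul p q ih ih' => rw [toRTerm, RTerm.code, ih, ih', code]
  | diff p ih => rfl

/-- The step of the recursion that computes the specifications of real terms and of trace
terms. The codes of the formulas of the finitely many operations enter as constants. -/
noncomputable def termSpecStep (N : ℕ) (l : List (ℕ × ℕ)) : ℕ × ℕ :=
  let n := l.length
  let t := n.unpair.1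
  let a := n.unpair.2
  let b := a.unpair.1
  let c := a.unpair.2
  let R := fun k => (entry l k).1
  let T := fun k => (entry l k).2
  let u := specRealCode N n
  let v := specPairCode N (Nat.pair 0 (2 * (N + 2 * a))) (Nat.pair 0 (2 * (N + (2 * a + 1))))
  let z := specRealCode N (natConstCode 0)
  ([u, u, applyCode N Op.add.formula.code (R b) (R c),
      applyCode N Op.mul.formula.code (R b) (R c), u,
      applyCode N Op.chan.formula.code (T a) (T a), applyCode N Op.val.formula.code (T a) (T a),
      applyCode N Op.time.formula.code (T a) (T a),
      applyCode N Op.len.formula.code (T a) (T a)].getD t 0,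
    [applyCode N Op.same.formula.code v v, applyCode N Op.empty.formula.code z z,
      applyCode N Op.event.formula.code (specRealCode N (natConstCode b))
        (specPairCode N c.unpair.1 c.unpair.2),
      applyCode N Op.concat.formula.code (T b) (T c),
      applyCode N ([Op.keep.formula.code, Op.drop.formula.code].getD c.unpair.1 0) (T b)
        (specRealCode N (natConstCode (bitMask (listOfCode c.unpair.2)))),
      applyCode N Op.item.formula.code (T b) (R c)].getD t 0)

theorem primrec_termSpecStep : Primrec₂ termSpecStep := by
  have hN : Primrec fun p : ℕ × List (ℕ × ℕ) => p.1 := Primrec.fst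
  have hl : Primrec fun p : ℕ × List (ℕ × ℕ) => p.2 := Primrec.snd
  have hn := primrec_length hl
  have ht := primrec_unpair_fst hn
  have ha := primrec_unpair_snd hn
  have hb := primrec_unpair_fst ha
  have hc := primrec_unpair_snd ha
  have hR : ∀ {f : ℕ × List (ℕ × ℕ) → ℕ}, Primrec f →
      Primrec fun p : ℕ × List (ℕ × ℕ) => (entry p.2 (f p)).1 :=
    fun hf => primrec_fst (primrec_entry hl hf)
  have hT : ∀ {f : ℕ × List (ℕ × ℕ) → ℕ}, Primrec f →
      Primrec fun p : ℕ × List (ℕ × ℕ) => (entry p.2 (f p)).2 :=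
    fun hf => primrec_snd (primrec_entry hl hf)
  have hC : ∀ m : ℕ, Primrec fun _ : ℕ × List (ℕ × ℕ) => m := fun m => Primrec.const m
  have hu := primrec_specRealCode hN hn
  have hv := primrec_specPairCode hN
    (primrec_natPair (hC 0) <| primrec_mul (hC 2) <| primrec_add hN <| primrec_mul (hC 2) ha)
    (primrec_natPair (hC 0) <| primrec_mul (hC 2) <| primrec_add hN <|
      primrec_add (primrec_mul (hC 2) ha) (hC 1))
  have hz := primrec_specRealCode hN (primrec_natConstCode (hC 0))
  refine Primrec.pair (primrec_getD ?_ ht) (primrec_getD ?_ ht)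
  · exact primrec_cons hu <| primrec_cons hu <|
      primrec_cons (primrec_applyCode hN (hC _) (hR hb) (hR hc)) <|
      primrec_cons (primrec_applyCode hN (hC _) (hR hb) (hR hc)) <| primrec_cons hu <|
      primrec_cons (primrec_applyCode hN (hC _) (hT ha) (hT ha)) <|
      primrec_cons (primrec_applyCode hN (hC _) (hT ha) (hT ha)) <|
      primrec_cons (primrec_applyCode hN (hC _) (hT ha) (hT ha)) <|
      primrec_cons (primrec_applyCode hN (hC _) (hT ha) (hT ha)) <| Primrec.const []
  · exact primrec_cons (primrec_applyCode hN (hC _) hv hv) <|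
      primrec_cons (primrec_applyCode hN (hC _) hz hz) <|
      primrec_cons (primrec_applyCode hN (hC _)
        (primrec_specRealCode hN (primrec_natConstCode hb))
        (primrec_specPairCode hN (primrec_unpair_fst hc) (primrec_unpair_snd hc))) <|
      primrec_cons (primrec_applyCode hN (hC _) (hT hb) (hT hc)) <|
      primrec_cons (primrec_applyCode hN
        (primrec_getD (primrec_cons (hC _) <| primrec_cons (hC _) <| Primrec.const [])
          (primrec_unpair_fst hc)) (hT hb)
        (primrec_specRealCode hN (primrec_natConstCode
          (primrec_bitMask.comp (primrec_listOfCode.comp (primrec_unpair_snd hc)))))) <|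
      primrec_cons (primrec_applyCode hN (hC _) (hT hb) (hR hc)) <| Primrec.const []

/-- The codes of the specifications of the real term and of the trace term with a given number. -/
noncomputable def termSpec (N n : ℕ) : ℕ × ℕ := courseOfValues termSpecStep N n

theorem primrec_termSpec : Primrec₂ termSpec := primrec_courseOfValues primrec_termSpecStep

theorem entry_valuesBelow_termSpecStep {N n k : ℕ} (h : k < n) :
    entry (valuesBelow termSpecStep N n) k = termSpec N k :=
  entry_valuesBelow _ _ h

mutual

theorem termSpec_code_fst (N : ℕ) : ∀ a : RTerm, (termSpec N a.code).1 = (a.spec N).code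
  | .var x => by
    simp [termSpec, courseOfValues, termSpecStep, RTerm.spec, RTerm.code, code_specReal]
  | .rat q => by
    simp [termSpec, courseOfValues, termSpecStep, RTerm.spec, RTerm.code, code_specReal]
  | .add a b => by
    have ha := termSpec_code_fst N a
    have hb := termSpec_code_fst N b
    rw [termSpec]
    simp [courseOfValues, termSpecStep, RTerm.spec, RTerm.code, Op.code_apply,
      entry_valuesBelow_termSpecStep, left_lt_natPair_pair, right_lt_natPair_pair, ha, hb]
  | .mul a b => by
    have ha := termSpec_code_fst N a
    have hb := termSpec_code_fst N b
    rw [termSpec]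
    simp [courseOfValues, termSpecStep, RTerm.spec, RTerm.code, Op.code_apply,
      entry_valuesBelow_termSpecStep, left_lt_natPair_pair, right_lt_natPair_pair, ha, hb]
  | .diff p => by
    simp [termSpec, courseOfValues, termSpecStep, RTerm.spec, RTerm.code, code_specReal]
  | .chan e => by
    have h := termSpec_code_snd N e
    rw [termSpec]
    simp [courseOfValues, termSpecStep, RTerm.spec, RTerm.code, Op.code_apply,
      entry_valuesBelow_termSpecStep, lt_natPair, h]
  | .val e => by
    have h := termSpec_code_snd N e
    rw [termSpec]
    simp [courseOfValues, termSpecStep, RTerm.spec, RTerm.code, Op.code_apply,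
      entry_valuesBelow_termSpecStep, lt_natPair, h]
  | .time e => by
    have h := termSpec_code_snd N e
    rw [termSpec]
    simp [courseOfValues, termSpecStep, RTerm.spec, RTerm.code, Op.code_apply,
      entry_valuesBelow_termSpecStep, lt_natPair, h]
  | .len e => by
    have h := termSpec_code_snd N e
    rw [termSpec]
    simp [courseOfValues, termSpecStep, RTerm.spec, RTerm.code, Op.code_apply,
      entry_valuesBelow_termSpecStep, lt_natPair, h]

theorem termSpec_code_snd (N : ℕ) : ∀ e : TTerm, (termSpec N e.code).2 = (e.spec N).code
  | .var t => by
    simp [termSpec, courseOfValues, termSpecStep, TTerm.spec, TTerm.code, Op.code_apply,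
      code_specPair, RTerm.code, RVar.code, codeRVar, lenRVar]
  | .empty => by
    have h := RTerm.code_natCast 0
    rw [Nat.cast_zero] at h
    simp [termSpec, courseOfValues, termSpecStep, TTerm.spec, TTerm.code, Op.code_apply,
      code_specReal, h]
  | .event c p q => by
    simp [termSpec, courseOfValues, termSpecStep, TTerm.spec, TTerm.code, Op.code_apply,
      code_specReal, code_specPair, Poly.code_toRTerm, RTerm.code_natCast]
  | .concat e f => by
    have he := termSpec_code_snd N e
    have hf := termSpec_code_snd N f
    rw [termSpec]
    simp [courseOfValues, termSpecStep, TTerm.spec, TTerm.code, Op.code_apply,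
      entry_valuesBelow_termSpecStep, left_lt_natPair_pair, right_lt_natPair_pair, he, hf]
  | .proj e C => by
    have he := termSpec_code_snd N e
    rw [termSpec]
    cases C <;>
    simp [courseOfValues, termSpecStep, TTerm.spec, TTerm.code, Op.code_apply,
      entry_valuesBelow_termSpecStep, left_lt_natPair_pair, he, ChanSet.code, ChanSet.op,
      ChanSet.mask, code_specReal, RTerm.code_natCast, listOfCode_encode]
  | .item e a => by
    have he := termSpec_code_snd N e
    have ha := termSpec_code_fst N a
    rw [termSpec]
    simp [courseOfValues, termSpecStep, TTerm.spec, TTerm.code, Op.code_apply,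
      entry_valuesBelow_termSpecStep, left_lt_natPair_pair, right_lt_natPair_pair, he, ha]

end

/-- The step of the recursion that computes the translations of formulas. -/
noncomputable def translateStep (N : ℕ) (l : List ℕ) : ℕ :=
  let n := l.length
  let a := n.unpair.2
  let b := a.unpair.1
  let c := a.unpair.2
  let R := fun k => (termSpec N k).1
  let T := fun k => (termSpec N k).2
  [applyCode N Op.realEq.formula.code (R b) (R c),
    applyCode N Op.realGe.formula.code (R b) (R c),
    applyCode N Op.traceEq.formula.code (T b) (T c),
    applyCode N Op.tracePrefix.formula.code (T b) (T c),
    Nat.pair 4 (entry l a), Nat.pair 5 (Nat.pair (entry l b) (entry l c)),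
    Nat.pair 6 (Nat.pair b (entry l c)),
    Nat.pair 6 (Nat.pair (2 * (N + 2 * b))
      (Nat.pair 6 (Nat.pair (2 * (N + (2 * b + 1))) (entry l c)))),
    n, n].getD n.unpair.1 0

theorem primrec_translateStep : Primrec₂ translateStep := by
  have hN : Primrec fun p : ℕ × List ℕ => p.1 := Primrec.fst
  have hl : Primrec fun p : ℕ × List ℕ => p.2 := Primrec.snd
  have hn := primrec_length hl
  have ht := primrec_unpair_fst hn
  have ha := primrec_unpair_snd hn
  have hb := primrec_unpair_fst ha
  have hc := primrec_unpair_snd ha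
  have hR : ∀ {f : ℕ × List ℕ → ℕ}, Primrec f →
      Primrec fun p : ℕ × List ℕ => (termSpec p.1 (f p)).1 :=
    fun hf => primrec_fst (primrec_termSpec.comp hN hf)
  have hT : ∀ {f : ℕ × List ℕ → ℕ}, Primrec f →
      Primrec fun p : ℕ × List ℕ => (termSpec p.1 (f p)).2 :=
    fun hf => primrec_snd (primrec_termSpec.comp hN hf)
  have hC : ∀ m : ℕ, Primrec fun _ : ℕ × List ℕ => m := fun m => Primrec.const m
  refine primrec_getD ?_ ht
  exact primrec_cons (primrec_applyCode hN (hC _) (hR hb) (hR hc)) <|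
    primrec_cons (primrec_applyCode hN (hC _) (hR hb) (hR hc)) <|
    primrec_cons (primrec_applyCode hN (hC _) (hT hb) (hT hc)) <|
    primrec_cons (primrec_applyCode hN (hC _) (hT hb) (hT hc)) <|
    primrec_cons (primrec_natPair (hC 4) (primrec_entry hl ha)) <|
    primrec_cons (primrec_natPair (hC 5)
      (primrec_natPair (primrec_entry hl hb) (primrec_entry hl hc))) <|
    primrec_cons (primrec_natPair (hC 6) (primrec_natPair hb (primrec_entry hl hc))) <|
    primrec_cons (primrec_natPair (hC 6) <| primrec_natPair
      (primrec_mul (hC 2) <| primrec_add hN <| primrec_mul (hC 2) hb) <|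
      primrec_natPair (hC 6) <| primrec_natPair
      (primrec_mul (hC 2) <| primrec_add hN <| primrec_add (primrec_mul (hC 2) hb) (hC 1)) <|
      primrec_entry hl hc) <|
    primrec_cons hn <| primrec_cons hn <| Primrec.const []

/-- The code of the translation of the formula with a given number. -/
noncomputable def translateCode (N n : ℕ) : ℕ := courseOfValues translateStep N n

theorem primrec_translateCode : Primrec₂ translateCode :=
  primrec_courseOfValues primrec_translateStep

theorem entry_valuesBelow_translateStep {N n k : ℕ} (h : k < n) :
    entry (valuesBelow translateStep N n) k = translateCode N k :=
  entry_valuesBelow _ _ h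

theorem translateCode_code (N : ℕ) (φ : Formula) :
    translateCode N φ.code = (φ.translate N).code := by
  induction φ with
  | realEq a b | realGe a b =>
    simp [translateCode, courseOfValues, translateStep, Formula.code, Formula.translate,
      Op.code_apply, termSpec_code_fst]
  | traceEq e f | tracePrefix e f =>
    simp [translateCode, courseOfValues, translateStep, Formula.code, Formula.translate,
      Op.code_apply, termSpec_code_snd]
  | box o χ | dia o χ =>
    simp [translateCode, courseOfValues, translateStep, Formula.code, Formula.translate]
  | not φ ih =>
    rw [translateCode]
    simp [courseOfValues, translateStep, Formula.code, Formula.translate,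
      entry_valuesBelow_translateStep, lt_natPair, ih]
  | and φ ψ ih ih' =>
    rw [translateCode]
    simp [courseOfValues, translateStep, Formula.code, Formula.translate,
      entry_valuesBelow_translateStep, left_lt_natPair_pair, right_lt_natPair_pair, ih, ih']
  | allReal x φ ih =>
    rw [translateCode]
    simp [courseOfValues, translateStep, Formula.code, Formula.translate,
      entry_valuesBelow_translateStep, right_lt_natPair_pair, ih]
  | allTrace t φ ih =>
    rw [translateCode]
    simp [courseOfValues, translateStep, Formula.code, Formula.translate,
      entry_valuesBelow_translateStep, right_lt_natPair_pair, ih, codeRVar, lenRVar, RVar.code]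

/-- The bound of a formula and its translation are both primitive recursive on Gödel numbers. -/
theorem effective_translate : Effective fun φ => φ.translate φ.bound :=
  ⟨fun n => translateCode (formulaBound n) n,
    (primrec_translateCode.comp primrec_formulaBound Primrec.id).to_comp,
    fun φ => by
      change translateCode (formulaBound φ.code) φ.code = _
      rw [formulaBound_code, translateCode_code]⟩

end ChanFOD

theorem mainTheorem4 :
    ∃ T : ChanFOD.Formula → ChanFOD.Formula,
      ChanFOD.Effective T ∧
      ∀ φ : ChanFOD.Formula,
        (T φ).IsFOD ∧
        (∀ v : ChanFOD.State, ∃ w : ChanFOD.State, ChanFOD.IsFODDual φ v w) ∧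
        (∀ v w : ChanFOD.State, ChanFOD.IsFODDual φ v w → (φ.Sat v ↔ (T φ).Sat w)) ∧
        (φ.Valid ↔ (T φ).Valid) :=
  ⟨fun φ => φ.translate φ.bound, ChanFOD.effective_translate, fun φ =>
    ⟨φ.isFOD_translate _, ChanFOD.exists_isFODDual φ, fun _ _ h => h.sat_iff,
      φ.valid_translate_iff⟩⟩
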